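/- Let $\mathfrak m(\xi)=\sqrt{(1+\xi^2)\tanh(\xi)/\xi}$ with $\mathfrak m(0)=1$, let $\mathcal M$ be the Fourier multiplier on $\mathbb R$ with symbol $\mathfrak m(\xi)$, let $(-\Delta)^{s/2}$ be the one with symbol $|\xi|^{s}$, and set $\|f\|_{\mathcal N}=\|(-\Delta)^{1/4}\mathcal M^{1/2}f\|_{L^2(\mathbb R)}$. For a time interval $J=[0,\infty)$ or $J=[0,T)$ and $u_0\in L^2(\mathbb R)$, a weak solution on $J$ of $$\partial_t u=-(-\Delta)^{1/2}\mathcal M u+\partial_x\Big(\frac{u^2}{2}\Big),\qquad u(0,\cdot)=u_0, \tag{1}$$ is a measurable real function $u\in L^\infty(J,L^2(\mathbb R))\cap L^2(J,\mathcal N(\mathbb R))$ such that for every real $\varphi\in C_c^\infty(J\times\mathbb R)$ (not required to vanish at $t=0$) $$\int_J\int_{\mathbb R}\Big(u\,\big(\partial_t\varphi-(-\Delta)^{1/2}\mathcal M\varphi\big)-\frac{u^2}{2}\,\partial_x\varphi\Big)\,dx\,dt+\int_{\mathbb R}u_0(x)\,\varphi(0,x)\,dx=0 .$$ **Proposition.**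 Let $u_0\in L^2(\mathbb R)\cap L^\infty(\mathbb R)$ be real-valued and let $u$ be a (global) weak solution of (1) on $[0,\infty)$. Let $0<T<\infty$ and suppose that $u\in L^4([0,T],H^{3/4+\epsilon}(\mathbb R))$ for some $\epsilon>0$. Then $$u\in L^\infty([0,T],L^\infty(\mathbb R)).$$ Consequently the regularity and uniqueness criteria for bounded solutions hold on $[0,T]$: if moreover $u_0\in\dot H^\rho(\mathbb R)$ for some $\rho>0$, then $u\in L^\infty([0,T],\dot H^\rho(\mathbb R))$, and every weak solution $v$ of (1) on $[0,T)$ with the same initial datum $u_0$ satisfies $v(t,\cdot)=u(t,\cdot)$ almost everywhere on $\mathbb R$ for almost every $t\in[0,T]$. -/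

import Mathlib

open MeasureTheory Set
open scoped ENNReal FourierTransform

noncomputable section

namespace Whitham

/-- The symbol `m(ξ) = √((1 + ξ²) tanh(ξ) / ξ)` of the operator `M`, with `m(0) = 1`. -/
def symbolM (ξ : ℝ) : ℝ :=
  if ξ = 0 then 1 else Real.sqrt ((1 + ξ ^ 2) * (Real.tanh ξ / ξ))

/-- The symbol `|ξ| m(ξ)` of the operator `(-Δ)^{1/2} M`. -/
def symbolA (ξ : ℝ) : ℝ := |ξ| * symbolM ξ

/-- The operator `(-Δ)^{1/2} M` acting on a test function `f`. Mathlib's Fourier transform is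
`∫ exp(-2πixξ) f(x) dx`, hence a symbol `a(ξ)` in the angular frequency appears as `a(2πξ)`.
The symbol is real and even, so the result is real for real `f`. -/
def opA (f : ℝ → ℝ) (x : ℝ) : ℝ :=
  (𝓕⁻ (fun ξ : ℝ => (symbolA (2 * Real.pi * ξ) : ℂ) * 𝓕 (fun y : ℝ => (f y : ℂ)) ξ) x).re

open Classical in
/-- For `f ∈ L²(ℝ)`, the (extended) `L²` norm of `w(D) f`, where `w(D)` is the Fourier multiplier
with symbol `w`; the Fourier transform is the one of `L²`. It is `∞` if `f ∉ L²(ℝ)`. -/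
def multiplierNorm (w : ℝ → ℝ) (f : ℝ → ℝ) : ℝ≥0∞ :=
  if h : MemLp f 2 volume then
    (∫⁻ ξ : ℝ, (ENNReal.ofReal |w (2 * Real.pi * ξ)|
      * ‖(𝓕 ((h.ofReal (K := ℂ)).toLp (fun x : ℝ => (f x : ℂ))) : Lp ℂ 2 (volume : Measure ℝ)) ξ‖ₑ)
        ^ (2 : ℝ)) ^ (1 / 2 : ℝ)
  else ⊤

/-- The norm of `𝒩(ℝ)`, i.e. `‖(-Δ)^{1/4} M^{1/2} f‖_{L²}`, for `f ∈ L²(ℝ)`. -/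
def normN (f : ℝ → ℝ) : ℝ≥0∞ := multiplierNorm (fun ξ => Real.sqrt (symbolA ξ)) f

/-- The norm of the inhomogeneous Sobolev space `H^s(ℝ)`, `s ≥ 0`. -/
def normH (s : ℝ) (f : ℝ → ℝ) : ℝ≥0∞ := multiplierNorm (fun ξ => (1 + ξ ^ 2) ^ (s / 2)) f

/-- The norm `‖(-Δ)^{s/2} f‖_{L²}` of the homogeneous Sobolev space, `s > 0`, for `f ∈ L²(ℝ)`. -/
def normHdot (s : ℝ) (f : ℝ → ℝ) : ℝ≥0∞ := multiplierNorm (fun ξ => |ξ| ^ s) f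

/-- `u ∈ L^p(J, X)`, where `N` is the (extended) norm of the space `X` of functions of `x`. -/
def MemLpTime (J : Set ℝ) (p : ℝ≥0∞) (N : (ℝ → ℝ) → ℝ≥0∞) (u : ℝ → ℝ → ℝ) : Prop :=
  eLpNorm (fun t => N (u t)) p (volume.restrict J) < ⊤

/-- Test functions on `J × ℝ`, where `J` is `[0, ∞)` or `[0, T)`: smooth compactly supported
functions on `ℝ × ℝ` whose support, for nonnegative times, lies in `J × ℝ`. They need not vanish
at time `0`. -/
structure IsTestFunction (J : Set ℝ) (φ : ℝ → ℝ → ℝ) : Prop where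
  smooth : ContDiff ℝ (⊤ : ℕ∞) (Function.uncurry φ)
  compact : HasCompactSupport (Function.uncurry φ)
  support : ∀ p ∈ tsupport (Function.uncurry φ), 0 ≤ p.1 → p.1 ∈ J

/-- `u ∈ L^∞(J, L²) ∩ L²(J, 𝒩)` is a weak solution on the time interval `J` (which is `[0, ∞)` or
`[0, T)`) of `∂ₜ u = -(-Δ)^{1/2} M u + ∂ₓ (u² / 2)`, `u(0, ·) = u₀`. -/
structure IsWeakSolution (J : Set ℝ) (u₀ : ℝ → ℝ) (u : ℝ → ℝ → ℝ) : Prop where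
  measurable : AEStronglyMeasurable (Function.uncurry u)
    ((volume.restrict J).prod (volume : Measure ℝ))
  memLinftyL2 : MemLpTime J ⊤ (fun f => eLpNorm f 2 volume) u
  memL2N : MemLpTime J 2 normN u
  weak : ∀ φ : ℝ → ℝ → ℝ, IsTestFunction J φ →
    (∫ t in J, ∫ x : ℝ,
        (u t x * (deriv (fun τ => φ τ x) t - opA (φ t) x)
          - (u t x) ^ 2 / 2 * deriv (φ t) x))
      + ∫ x : ℝ, u₀ x * φ 0 x = 0

end Whitham

end

/-! On the Fourier side the equation splits into scalar linear equations in time, one for each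
frequency, with solution U(t,ξ) = exp(-t a(ξ)) û₀(ξ) + ∫₀ᵗ exp(-(t-s) a(ξ)) πiξ G(s,ξ) ds, where a
is `freqA` and G is the transform of u² (`HasSpectrum.duhamel`). The symbol a is comparable to
|ξ|√(1+|ξ|), and a ≥ |ξ|^{3/2}. The derivative costs |ξ|, and Cauchy–Schwarz in time leaves |ξ|²/a ≲
|ξ|^{1/2}. Hence the Duhamel term at order ρ is controlled, both in L^∞L² and in L²L² with the extra
weight a, by the L² norm in time of u² at order ρ + 1/4 (`lintegral_mul_duh_sq_le`,
`lintegral_lintegral_freqA_mul_duh_sq_le`).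

Boundedness. For r = 3/4 + ε the space H^r is an algebra, so u ∈ L⁴H^r gives u² ∈ L²H^r and places
the Duhamel term in L^∞H^{r-1/4}. Since r - 1/4 > 1/2, its Fourier transform is integrable, so it is
bounded (`sq_lintegral_duh_le`). The linear part is bounded because u₀ is and because the kernel of
the semigroup has L¹ norm locally bounded in time (`sq_lintegral_kernel_le`).

Regularity. Interpolating the two Duhamel bounds turns L⁴H^r into L⁴H^{r+1/8} as long as u₀ has the
matching regularity; finitely many iterations reach the order ρ of the datum
(`HasSpectrum.exists_besselEnergy_le_of_initial`).

Uniqueness takes place in the energy class. That class embeds in L⁴Ḣ^{3/8}, and the product maps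
Ḣ^{3/8} × Ḣ^{3/8} to Ḣ^{1/4} (`lintegral_riesz_correlation_le`), which is exactly the norm the
Duhamel bound asks for. The factorization u² - v² = (u-v)(u+v) gives a contraction on short time
windows, and finitely many windows cover the interval.

Duhamel's formula itself is extracted from the weak formulation with countably many test functions,
because each of them has its own exceptional set of times (`HasSpectrum.integral_eq`). -/

namespace Whitham

open scoped SchwartzMap ContDiff ComplexConjugate
open Filter Topology

/-! ### The Fourier transform on `L²` as an operation on functions -/

open Classical in
/-- The `L²` Fourier transform of a function; `0` outside `L²`. -/
noncomputable def fourierL2 (f : ℝ → ℂ) : ℝ → ℂ :=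
  if h : MemLp f 2 volume then (𝓕 (h.toLp f) : Lp ℂ 2 (volume : Measure ℝ)) else 0

theorem fourierL2_of_memLp {f : ℝ → ℂ} (h : MemLp f 2 volume) :
    fourierL2 f = (𝓕 (h.toLp f) : Lp ℂ 2 (volume : Measure ℝ)) := by
  simp [fourierL2, h]

theorem memLp_fourierL2 (f : ℝ → ℂ) : MemLp (fourierL2 f) 2 volume := by
  by_cases h : MemLp f 2 volume
  · rw [fourierL2_of_memLp h]; exact Lp.memLp _
  · simp [fourierL2, h]

theorem fourierL2_sub {f g : ℝ → ℂ} (hf : MemLp f 2 volume) (hg : MemLp g 2 volume) :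
    fourierL2 (f - g) =ᵐ[volume] fourierL2 f - fourierL2 g := by
  rw [fourierL2_of_memLp hf, fourierL2_of_memLp hg, fourierL2_of_memLp (hf.sub hg),
    MemLp.toLp_sub hf hg,
    show 𝓕 (hf.toLp f - hg.toLp g) = 𝓕 (hf.toLp f) - 𝓕 (hg.toLp g) from
      (Lp.fourierTransformₗᵢ ℝ ℂ).map_sub _ _]
  exact Lp.coeFn_sub _ _

theorem fourierL2_add {f g : ℝ → ℂ} (hf : MemLp f 2 volume) (hg : MemLp g 2 volume) :
    fourierL2 (f + g) =ᵐ[volume] fourierL2 f + fourierL2 g := by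
  rw [fourierL2_of_memLp hf, fourierL2_of_memLp hg, fourierL2_of_memLp (hf.add hg),
    MemLp.toLp_add hf hg, FourierTransform.fourier_add]
  exact Lp.coeFn_add _ _

theorem fourierL2_congr {f g : ℝ → ℂ} (hf : MemLp f 2 volume) (h : f =ᵐ[volume] g) :
    fourierL2 f = fourierL2 g := by
  have hg : MemLp g 2 volume := hf.ae_eq h
  rw [fourierL2_of_memLp hf, fourierL2_of_memLp hg, (MemLp.toLp_eq_toLp_iff hf hg).2 h]

theorem integral_conj_mul_fourierL2 {f g : ℝ → ℂ} (hf : MemLp f 2 volume)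
    (hg : MemLp g 2 volume) :
    ∫ ξ, conj (fourierL2 f ξ) * fourierL2 g ξ = ∫ x, conj (f x) * g x := by
  have h := Lp.inner_fourier_eq (hf.toLp f) (hg.toLp g)
  rw [L2.inner_def, L2.inner_def] at h
  rw [fourierL2_of_memLp hf, fourierL2_of_memLp hg]
  simp only [RCLike.inner_apply] at h
  calc _ = _ := integral_congr_ae (Eventually.of_forall fun x => mul_comm _ _)
    _ = _ := h
    _ = _ := by
      apply integral_congr_ae
      filter_upwards [hf.coeFn_toLp, hg.coeFn_toLp] with x h1 h2
      rw [h1, h2, mul_comm]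

theorem eLpNorm_fourierL2 {f : ℝ → ℂ} (hf : MemLp f 2 volume) :
    eLpNorm (fourierL2 f) 2 volume = eLpNorm f 2 volume := by
  have h := Lp.norm_fourier_eq (hf.toLp f)
  rw [Lp.norm_def, Lp.norm_def] at h
  rw [fourierL2_of_memLp hf, ← eLpNorm_congr_ae hf.coeFn_toLp]
  exact (ENNReal.toReal_eq_toReal_iff' (Lp.eLpNorm_ne_top _) (Lp.eLpNorm_ne_top _)).1 h

theorem fourierL2_injective {f g : ℝ → ℂ} (hf : MemLp f 2 volume) (hg : MemLp g 2 volume)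
    (h : fourierL2 f =ᵐ[volume] fourierL2 g) : f =ᵐ[volume] g := by
  rw [fourierL2_of_memLp hf, fourierL2_of_memLp hg] at h
  have h1 : (𝓕 (hf.toLp f) : Lp ℂ 2 (volume : Measure ℝ)) = 𝓕 (hg.toLp g) := Lp.ext h
  have h2 := congrArg (𝓕⁻ ·) h1
  simp only [FourierTransform.fourierInv_fourier_eq] at h2
  exact (MemLp.toLp_eq_toLp_iff hf hg).1 h2

/-- The L² transform agrees with the transform of tempered distributions, so it moves onto the test
function. This duality is the means of identifying L² transforms throughout. -/
theorem integral_schwartz_mul_fourierL2 {f : ℝ → ℂ} (hf : MemLp f 2 volume) (φ : 𝓢(ℝ, ℂ)) :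
    ∫ ξ, φ ξ * fourierL2 f ξ = ∫ x, (𝓕 φ) x * f x := by
  have h := congrArg (fun D => D φ) (Lp.fourier_toTemperedDistribution_eq (hf.toLp f))
  simp only [TemperedDistribution.fourier_apply, Lp.toTemperedDistribution_apply,
    smul_eq_mul] at h
  rw [fourierL2_of_memLp hf, ← h]
  apply integral_congr_ae
  filter_upwards [hf.coeFn_toLp] with x h1
  rw [h1]

theorem ae_eq_of_integral_schwartz_mul_eq {f g : ℝ → ℂ} (hf : LocallyIntegrable f volume)
    (hg : LocallyIntegrable g volume)
    (h : ∀ φ : 𝓢(ℝ, ℂ), ∫ x, φ x * f x = ∫ x, φ x * g x) : f =ᵐ[volume] g := by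
  apply ae_eq_of_integral_contDiff_smul_eq hf hg
  intro χ hχ hχc
  have h₁ : HasCompactSupport (Complex.ofRealCLM ∘ χ) := hχc.comp_left rfl
  have h₂ : ContDiff ℝ ∞ (Complex.ofRealCLM ∘ χ) := by fun_prop
  simpa using h (h₁.toSchwartzMap h₂)

theorem integral_schwartz_mul_fourier {f : ℝ → ℂ} (hf : Integrable f volume) (φ : 𝓢(ℝ, ℂ)) :
    ∫ ξ, φ ξ * 𝓕 f ξ = ∫ x, (𝓕 φ) x * f x := by
  have h := VectorFourier.integral_fourierIntegral_smul_eq_flip (L := innerₗ ℝ)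
    Real.continuous_fourierChar continuous_inner φ.integrable hf (μ := volume) (ν := volume)
  simp only [smul_eq_mul, flip_innerₗ] at h
  exact h.symm

theorem continuous_fourier_of_integrable {f : ℝ → ℂ} (hf : Integrable f volume) :
    Continuous (𝓕 f) :=
  VectorFourier.fourierIntegral_continuous Real.continuous_fourierChar
    (by exact continuous_inner) hf

/-- Every Schwartz function is itself the transform of one, so by duality f annihilates all of them.
-/
theorem ae_eq_zero_of_fourier_eq_zero {f : ℝ → ℂ} (hf : Integrable f volume)
    (h : ∀ ξ, 𝓕 f ξ = 0) : f =ᵐ[volume] 0 := by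
  apply ae_eq_of_integral_schwartz_mul_eq hf.locallyIntegrable
    (integrable_zero _ _ _).locallyIntegrable
  intro φ
  have h1 := integral_schwartz_mul_fourier hf (𝓕⁻ φ)
  rw [FourierTransform.fourier_fourierInv_eq] at h1
  simp [← h1, h]

theorem fourierL2_eq_fourier {f : ℝ → ℂ} (hf : MemLp f 2 volume) (hf1 : Integrable f volume) :
    fourierL2 f =ᵐ[volume] 𝓕 f := by
  apply ae_eq_of_integral_schwartz_mul_eq ((memLp_fourierL2 f).locallyIntegrable (by norm_num))
    (continuous_fourier_of_integrable hf1).locallyIntegrable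
  intro φ
  rw [integral_schwartz_mul_fourierL2 hf, integral_schwartz_mul_fourier hf1]

theorem fourierInv_eq_fourier_neg' (f : ℝ → ℂ) (x : ℝ) : 𝓕⁻ f x = 𝓕 f (-x) := by
  rw [Real.fourierInv_eq_fourier_neg]

theorem integral_schwartz_mul_fourierInv {f : ℝ → ℂ} (hf : Integrable f volume) (φ : 𝓢(ℝ, ℂ)) :
    ∫ ξ, φ ξ * 𝓕⁻ f ξ = ∫ x, (𝓕⁻ φ) x * f x := by
  have h := VectorFourier.integral_fourierIntegral_smul_eq_flip (L := -innerₗ ℝ)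
    Real.continuous_fourierChar (by simpa using! continuous_inner.neg) φ.integrable hf
    (μ := volume) (ν := volume)
  have e : (-innerₗ ℝ : ℝ →ₗ[ℝ] ℝ →ₗ[ℝ] ℝ).flip = -innerₗ ℝ := by
    ext; simp
  rw [e] at h
  simp only [smul_eq_mul] at h
  rw [SchwartzMap.fourierInv_coe]
  exact h.symm

theorem exists_fourierL2_eq {g : ℝ → ℂ} (hg : MemLp g 2 volume) :
    ∃ f, MemLp f 2 volume ∧ fourierL2 f =ᵐ[volume] g := by
  refine ⟨(𝓕⁻ (hg.toLp g) : Lp ℂ 2 (volume : Measure ℝ)), Lp.memLp _, ?_⟩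
  rw [fourierL2_of_memLp (Lp.memLp _), Lp.toLp_coeFn, FourierTransform.fourier_fourierInv_eq]
  exact hg.coeFn_toLp

theorem ae_eq_fourierInv {f g : ℝ → ℂ} (hf : MemLp f 2 volume) (hg1 : Integrable g volume)
    (h : fourierL2 f =ᵐ[volume] g) : f =ᵐ[volume] 𝓕⁻ g := by
  have hc : Continuous (𝓕⁻ g) := by
    have : 𝓕⁻ g = fun x => 𝓕 g (-x) := funext (fourierInv_eq_fourier_neg' g)
    rw [this]
    exact (continuous_fourier_of_integrable hg1).comp continuous_neg
  apply ae_eq_of_integral_schwartz_mul_eq (hf.locallyIntegrable (by norm_num))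
    hc.locallyIntegrable
  intro φ
  have h1 := integral_schwartz_mul_fourierL2 hf (𝓕⁻ φ)
  rw [FourierTransform.fourier_fourierInv_eq] at h1
  rw [← h1, integral_schwartz_mul_fourierInv hg1]
  apply integral_congr_ae
  filter_upwards [h] with x hx
  rw [hx]

theorem memLp_fourierInv {g : ℝ → ℂ} (hg : MemLp g 2 volume) (hg1 : Integrable g volume) :
    MemLp (𝓕⁻ g) 2 volume ∧ fourierL2 (𝓕⁻ g) =ᵐ[volume] g := by
  obtain ⟨f, hf, hfg⟩ := exists_fourierL2_eq hg
  have h := ae_eq_fourierInv hf hg1 hfg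
  exact ⟨hf.ae_eq h, by rwa [← fourierL2_congr hf h]⟩

end Whitham

/-! ### Characters, modulations and transforms of products -/

namespace Whitham

open scoped SchwartzMap ContDiff ComplexConjugate
open Filter Topology

/-- The character `x ↦ exp(-2πixy)`. -/
noncomputable def char (y x : ℝ) : ℂ := Complex.exp (↑(-2 * Real.pi * x * y) * Complex.I)

@[simp] theorem norm_char (y x : ℝ) : ‖char y x‖ = 1 := Complex.norm_exp_ofReal_mul_I _

@[simp] theorem enorm_char (y x : ℝ) : ‖char y x‖ₑ = 1 := by
  rw [← ofReal_norm, norm_char, ENNReal.ofReal_one]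

theorem continuous_char : Continuous (fun p : ℝ × ℝ => char p.1 p.2) := by
  unfold char; fun_prop

theorem continuous_char_right (y : ℝ) : Continuous (char y) := by
  unfold char; fun_prop

theorem fourier_eq_integral_char (f : ℝ → ℂ) (ξ : ℝ) : 𝓕 f ξ = ∫ x, char ξ x * f x := by
  rw [Real.fourier_real_eq_integral_exp_smul]; rfl

theorem char_add (y z x : ℝ) : char (y + z) x = char y x * char z x := by
  unfold char; rw [← Complex.exp_add]; congr 1; push_cast; ring

theorem char_add_right (y x z : ℝ) : char y (x + z) = char y x * char y z := by
  unfold char; rw [← Complex.exp_add]; congr 1; push_cast; ring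

theorem conj_char (y x : ℝ) : conj (char y x) = char (-y) x := by
  unfold char; rw [← Complex.exp_conj]; congr 1
  rw [map_mul, Complex.conj_ofReal, Complex.conj_I]; push_cast; ring

theorem char_comm (y x : ℝ) : char y x = char x y := by
  unfold char; congr 1; push_cast; ring

theorem fourierInv_eq_integral_char (f : ℝ → ℂ) (x : ℝ) :
    𝓕⁻ f x = ∫ ξ, char (-x) ξ * f ξ := by
  rw [fourierInv_eq_fourier_neg', fourier_eq_integral_char]

theorem memLp_char_mul {f : ℝ → ℂ} {p : ℝ≥0∞} (hf : MemLp f p volume) (y : ℝ) :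
    MemLp (fun x => char y x * f x) p volume := by
  apply MemLp.of_le hf ((continuous_char_right y).aestronglyMeasurable.mul hf.1)
  exact Eventually.of_forall fun x => by simp

theorem fourierL2_char_mul {f : ℝ → ℂ} (hf : MemLp f 2 volume) (y : ℝ) :
    fourierL2 (fun x => char y x * f x) =ᵐ[volume] fun ξ => fourierL2 f (ξ + y) := by
  have hs : MemLp (fun ξ => fourierL2 f (ξ + y)) 2 volume :=
    (memLp_fourierL2 f).comp_measurePreserving (measurePreserving_add_right volume y)
  apply ae_eq_of_integral_schwartz_mul_eq ((memLp_fourierL2 _).locallyIntegrable (by norm_num))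
    (hs.locallyIntegrable (by norm_num))
  intro φ
  rw [integral_schwartz_mul_fourierL2 (memLp_char_mul hf y)]
  have h1 := integral_schwartz_mul_fourierL2 hf (φ.compSubConstCLM ℂ y)
  have h2 : ∫ ξ, φ ξ * fourierL2 f (ξ + y) = ∫ ξ, φ.compSubConstCLM ℂ y ξ * fourierL2 f ξ := by
    rw [← integral_add_right_eq_self (fun ξ => φ.compSubConstCLM ℂ y ξ * fourierL2 f ξ) y]
    simp
  rw [h2, h1]
  congr 1; ext x
  have h3 : 𝓕 (φ.compSubConstCLM ℂ y) x = char y x * 𝓕 φ x := by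
    rw [SchwartzMap.fourier_coe, SchwartzMap.fourier_coe, fourier_eq_integral_char,
      fourier_eq_integral_char, ← integral_const_mul,
      ← integral_add_right_eq_self (fun z => char x z * (φ.compSubConstCLM ℂ y) z) y]
    congr 1; ext z
    simp [char_add_right, char_comm x y]
    ring
  rw [h3]; ring

/-- The Fourier transform of a product is dominated by the correlation of the transforms. -/
theorem enorm_fourier_mul_le {f g : ℝ → ℝ} (hf : MemLp (fun x => (f x : ℂ)) 2 volume)
    (hg : MemLp (fun x => (g x : ℂ)) 2 volume) (ξ : ℝ) :
    ‖𝓕 (fun x => ((f x * g x : ℝ) : ℂ)) ξ‖ₑ ≤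
      ∫⁻ η, ‖fourierL2 (fun x => (f x : ℂ)) η‖ₑ * ‖fourierL2 (fun x => (g x : ℂ)) (η + ξ)‖ₑ := by
  have h1 := integral_conj_mul_fourierL2 hf (memLp_char_mul hg ξ)
  -- As f is real, the transform of the product at ξ is the inner product of f with g modulated by
  -- ξ. Parseval applies, and the modulation becomes the shift η + ξ.
  have h2 : 𝓕 (fun x => ((f x * g x : ℝ) : ℂ)) ξ =
      ∫ η, conj (fourierL2 (fun x => (f x : ℂ)) η) * fourierL2 (fun x => (g x : ℂ)) (η + ξ) := by
    rw [fourier_eq_integral_char]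
    trans ∫ x, conj (f x : ℂ) * (char ξ x * (g x : ℂ))
    · congr 1; ext x; simp; ring
    · rw [← h1]
      apply integral_congr_ae
      filter_upwards [fourierL2_char_mul hg ξ] with η hη
      rw [hη]
  rw [h2]
  refine (enorm_integral_le_lintegral_enorm _).trans (le_of_eq ?_)
  congr 1; ext η
  rw [enorm_mul]; simp [← ofReal_norm]

/-! ### Joint measurability of the partial Fourier transform -/

/-- For each t the L² transform is only an a.e. class, so a jointly measurable version has to be
built. Mollifying in ξ and using duality writes the mollified transform as an integral of u(t,·)
against the transform of a bump, which is jointly measurable; by Lebesgue differentiation these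
converge a.e. to the transform. -/
theorem exists_stronglyMeasurable_fourierL2 {u : ℝ × ℝ → ℂ} (hu : StronglyMeasurable u) :
    ∃ U : ℝ × ℝ → ℂ, StronglyMeasurable U ∧
      ∀ t, MemLp (fun x => u (t, x)) 2 volume →
        (fun ξ => U (t, ξ)) =ᵐ[volume] fourierL2 (fun x => u (t, x)) := by
  let φ : ℕ → ContDiffBump (0 : ℝ) := fun n =>
    ⟨1 / ((n : ℝ) + 1), 2 / ((n : ℝ) + 1), by positivity, by gcongr; norm_num⟩
  have hφ : Tendsto (fun n => (φ n).rOut) atTop (𝓝 0) := by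
    have := (tendsto_one_div_add_atTop_nhds_zero_nat (𝕜 := ℝ)).const_mul 2
    simpa [φ, div_eq_mul_inv] using this
  -- Comparable inner and outer radii are what the differentiation theorem requires of the bumps.
  have hφ' : ∀ᶠ n in atTop, (φ n).rOut ≤ 2 * (φ n).rIn :=
    Eventually.of_forall fun n => by simp [φ, div_eq_mul_inv]
  -- `K n ξ` is the Fourier transform of the bump centred at ξ.
  let K : ℕ → ℝ → ℝ → ℂ := fun n ξ x => ∫ η, char x η * ((φ n).normed volume (ξ - η) : ℂ)
  let F : ℕ → ℝ × ℝ → ℂ := fun n p => ∫ x, K n p.2 x * u (p.1, x)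
  have hK : ∀ n, StronglyMeasurable (fun q : ℝ × ℝ => K n q.1 q.2) := by
    intro n
    apply StronglyMeasurable.integral_prod_right
      (f := fun (q : ℝ × ℝ) η => char q.2 η * ((φ n).normed volume (q.1 - η) : ℂ))
    apply Continuous.stronglyMeasurable
    have h1 : Continuous ((φ n).normed volume) := (φ n).continuous_normed
    have h2 := continuous_char
    have h3 : Continuous (fun r : (ℝ × ℝ) × ℝ => char r.1.2 r.2) :=
      h2.comp (by fun_prop : Continuous fun r : (ℝ × ℝ) × ℝ => (r.1.2, r.2))
    fun_prop
  have hF : ∀ n, StronglyMeasurable (F n) := by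
    intro n
    apply StronglyMeasurable.integral_prod_right
      (f := fun (p : ℝ × ℝ) x => K n p.2 x * u (p.1, x))
    apply StronglyMeasurable.mul
    · exact (hK n).comp_measurable
        (by fun_prop : Measurable fun r : (ℝ × ℝ) × ℝ => (r.1.2, r.2))
    · exact hu.comp_measurable
        (by fun_prop : Measurable fun r : (ℝ × ℝ) × ℝ => (r.1.1, r.2))
  refine ⟨fun p => limUnder atTop (fun n => F n p), StronglyMeasurable.limUnder hF, ?_⟩
  intro t ht
  have hli : LocallyIntegrable (fourierL2 (fun x => u (t, x))) volume :=
    (memLp_fourierL2 _).locallyIntegrable (by norm_num)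
  filter_upwards [ContDiffBump.ae_convolution_tendsto_right_of_locallyIntegrable hφ hφ' hli]
    with ξ hξ
  apply Tendsto.limUnder_eq
  refine hξ.congr fun n => ?_
  rw [convolution_eq_swap]
  have hc : HasCompactSupport (fun η : ℝ => (((φ n).normed volume (ξ - η) : ℝ) : ℂ)) := by
    have h0 : HasCompactSupport ((φ n).normed volume) := (φ n).hasCompactSupport_normed
    have h1 : HasCompactSupport (fun η : ℝ => (φ n).normed volume (ξ - η)) :=
      h0.comp_homeomorph (Homeomorph.subLeft ξ)
    exact h1.comp_left (g := fun r : ℝ => (r : ℂ)) (by simp)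
  have hd : ContDiff ℝ ∞ (fun η : ℝ => (((φ n).normed volume (ξ - η) : ℝ) : ℂ)) := by
    have h0 : ContDiff ℝ ∞ ((φ n).normed volume) := (φ n).contDiff_normed
    have h1 : ContDiff ℝ ∞ (fun η : ℝ => (φ n).normed volume (ξ - η)) := by fun_prop
    exact Complex.ofRealCLM.contDiff.comp h1
  have h := integral_schwartz_mul_fourierL2 ht (hc.toSchwartzMap hd)
  have e1 : ∫ η, (hc.toSchwartzMap hd) η * fourierL2 (fun x => u (t, x)) η =
    ∫ η, ContinuousLinearMap.lsmul ℝ ℝ ((φ n).normed volume (ξ - η))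
      (fourierL2 (fun x => u (t, x)) η) := by
    congr 1
  rw [← e1, h]
  congr 1; ext x
  congr 1
  rw [SchwartzMap.fourier_coe, fourier_eq_integral_char]
  rfl

end Whitham

namespace Whitham

open scoped ContDiff
open Filter Topology

/-! ### Integration by parts and linear equations in time -/

/-- F is merely integrable, so integration by parts is replaced by Fubini on the triangle s < t. -/
theorem integral_primitive_mul_deriv {𝕜 : Type*} [RCLike 𝕜] {F G G' : ℝ → 𝕜} {T : ℝ} (hT : 0 ≤ T)
    (hF : IntegrableOn F (Ioc 0 T) volume) (hG : ∀ t, HasDerivAt G (G' t) t)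
    (hG' : Continuous G') :
    ∫ t in (0)..T, (∫ s in (0)..t, F s) * G' t =
      (∫ s in (0)..T, F s) * G T - ∫ s in (0)..T, F s * G s := by
  have hFi : IntervalIntegrable F volume 0 T := (intervalIntegrable_iff_integrableOn_Ioc_of_le hT).2 hF
  have hGc : Continuous G := continuous_iff_continuousAt.2 fun t => (hG t).continuousAt
  let k : ℝ → ℝ → 𝕜 := fun t s => (Ioi s).indicator (fun t => F s * G' t) t
  have hk : Integrable (Function.uncurry k)
      ((volume.restrict (Ioc 0 T)).prod (volume.restrict (Ioc 0 T))) := by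
    have h1 : Integrable (fun p : ℝ × ℝ => G' p.1 * F p.2)
        ((volume.restrict (Ioc 0 T)).prod (volume.restrict (Ioc 0 T))) := by
      apply Integrable.mul_prod (f := G') (g := F) _ hF
      exact (hG'.intervalIntegrable 0 T).1
    have h2 : Function.uncurry k =
        {p : ℝ × ℝ | p.2 < p.1}.indicator (fun p : ℝ × ℝ => G' p.1 * F p.2) := by
      ext ⟨t, s⟩
      simp [k, Function.uncurry, indicator, mul_comm]
    rw [h2]
    exact h1.indicator (measurableSet_lt measurable_snd measurable_fst)
  have hsw := integral_integral_swap hk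
  have hl : ∫ t in (0)..T, (∫ s in (0)..t, F s) * G' t =
      ∫ t in Ioc 0 T, ∫ s in Ioc 0 T, k t s := by
    rw [intervalIntegral.integral_of_le hT]
    apply setIntegral_congr_fun measurableSet_Ioc
    intro t ht
    simp only
    rw [intervalIntegral.integral_of_le ht.1.le, ← integral_mul_const, ← integral_indicator measurableSet_Ioc,
      ← integral_indicator measurableSet_Ioc]
    apply integral_congr_ae
    -- The triangle is cut out by s < t and the inner interval is closed at t; they differ only on
    -- the null diagonal.
    have : ∀ᵐ s : ℝ, s ≠ t := by simp [ae_iff]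
    filter_upwards [this] with s hs
    simp only [indicator, k, mem_Ioc, mem_Ioi]
    rcases lt_or_gt_of_ne hs with h | h
    · by_cases h0 : 0 < s
      · simp [h, h0, h.le, h.le.trans ht.2]
      · simp [h0]
    · simp [h.not_ge, h.not_gt]
  have hr : ∫ s in Ioc 0 T, ∫ t in Ioc 0 T, k t s =
      ∫ s in Ioc 0 T, F s * (G T - G s) := by
    apply setIntegral_congr_fun measurableSet_Ioc
    intro s hs
    simp only [k]
    rw [setIntegral_indicator measurableSet_Ioi, integral_const_mul]
    have : Ioc 0 T ∩ Ioi s = Ioc s T := by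
      ext t; simp only [mem_inter_iff, mem_Ioc, mem_Ioi]
      constructor
      · rintro ⟨⟨_, h⟩, h2⟩; exact ⟨h2, h⟩
      · rintro ⟨h, h2⟩; exact ⟨⟨hs.1.trans h, h2⟩, h⟩
    rw [this, ← intervalIntegral.integral_of_le hs.2,
      intervalIntegral.integral_eq_sub_of_hasDerivAt (fun t _ => hG t)
        (hG'.intervalIntegrable _ _)]
  rw [hl, hsw, hr, ← intervalIntegral.integral_of_le hT, ← intervalIntegral.integral_mul_const,
    ← intervalIntegral.integral_sub (hFi.mul_const _) (hFi.mul_continuousOn hGc.continuousOn)]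
  simp only [mul_sub]

/-- The du Bois-Reymond lemma with an initial value: inserting a primitive of an arbitrary η ∈
C_c^∞((0,T)) as test function shows that Y - Y₀ - ∫F is orthogonal to η. -/
theorem eq_integral_of_weak_derivative {Y F : ℝ → ℝ} {Y₀ T : ℝ} (hT : 0 < T)
    (hY : IntegrableOn Y (Ico 0 T) volume) (hF : IntegrableOn F (Ico 0 T) volume)
    (h : ∀ θ : ℝ → ℝ, ContDiff ℝ ∞ θ → HasCompactSupport θ → tsupport θ ⊆ Iio T →
      (∫ t in Ico 0 T, (Y t * deriv θ t + F t * θ t)) + Y₀ * θ 0 = 0) :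
    ∀ᵐ t ∂(volume.restrict (Ioo 0 T)), Y t = Y₀ + ∫ s in (0)..t, F s := by
  have hFi : IntervalIntegrable F volume 0 T :=
    (intervalIntegrable_iff_integrableOn_Ico_of_le hT.le).2 hF
  have hYi : IntervalIntegrable Y volume 0 T :=
    (intervalIntegrable_iff_integrableOn_Ico_of_le hT.le).2 hY
  have hPc : ContinuousOn (fun t => ∫ s in (0)..t, F s) (Icc 0 T) := by
    have := intervalIntegral.continuousOn_primitive_interval (μ := volume) (f := F) (a := 0) (b := T)
      (by rw [uIcc_of_le hT.le]; exact (integrableOn_Icc_iff_integrableOn_Ico).2 hF)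
    rwa [uIcc_of_le hT.le] at this
  have key := isOpen_Ioo.ae_eq_zero_of_integral_contDiff_smul_eq_zero (U := Ioo 0 T) (μ := volume)
    (f := fun t => Y t - Y₀ - ∫ s in (0)..t, F s) ?_ ?_
  · rw [ae_restrict_iff' measurableSet_Ioo]
    filter_upwards [key] with t ht h1
    linarith [ht h1]
  · apply IntegrableOn.locallyIntegrableOn
    apply Integrable.sub
    · exact (hY.mono_set Ioo_subset_Ico_self).sub (integrableOn_const (by simp))
    · exact (hPc.integrableOn_Icc).mono_set Ioo_subset_Icc_self
  · intro η hη hηc hηs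
    obtain ⟨b, hbT, hb⟩ : ∃ b < T, ∀ t, b ≤ t → η t = 0 := by
      rcases (tsupport η).eq_empty_or_nonempty with he | hne
      · exact ⟨0, hT, fun t _ => image_eq_zero_of_notMem_tsupport (by simp [he])⟩
      · obtain ⟨m, hm, hmax⟩ := hηc.isCompact.exists_isMaxOn hne continuousOn_id
        have hmT := (hηs hm).2
        refine ⟨(m + T) / 2, by linarith, fun t ht => image_eq_zero_of_notMem_tsupport fun htt => ?_⟩
        have : t ≤ m := hmax htt
        linarith
    -- Based at T, the primitive vanishes near T as the support condition demands, while Θ(0) = -∫η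
    -- brings in the initial value.
    let Θ : ℝ → ℝ := fun t => ∫ s in T..t, η s
    have hΘd : ∀ t, HasDerivAt Θ (η t) t := fun t =>
      intervalIntegral.integral_hasDerivAt_right (hη.continuous.intervalIntegrable _ _)
        (hη.continuous.stronglyMeasurableAtFilter _ _) hη.continuous.continuousAt
    have hΘ : ContDiff ℝ ∞ Θ := by
      rw [contDiff_infty_iff_deriv]
      refine ⟨fun t => (hΘd t).differentiableAt, ?_⟩
      rwa [show deriv Θ = η from funext fun t => (hΘd t).deriv]
    have hΘ0 : ∀ t, b ≤ t → Θ t = 0 := by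
      intro t ht
      apply intervalIntegral.integral_zero_ae
      refine Eventually.of_forall fun s hs => hb s ?_
      have := hs.1
      exact (le_min hbT.le ht).trans this.le
    have hηz : ∀ t, t ∉ Ioo 0 T → η t = 0 := fun t ht =>
      image_eq_zero_of_notMem_tsupport fun h => ht (hηs h)
    -- Θ is constant for negative times; the cutoff κ, equal to 1 on [0,T), restores compact support
    -- without changing anything on [0,T).
    let κ : ContDiffBump (0 : ℝ) := ⟨T + 1, T + 2, by linarith, by linarith⟩
    have hκ1 : ∀ t ∈ Ico 0 T, κ =ᶠ[𝓝 t] fun _ => (1 : ℝ) := by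
      intro t ht
      apply κ.eventuallyEq_one_of_mem_ball
      simp only [Metric.mem_ball, dist_zero_right, Real.norm_eq_abs, κ]
      rw [abs_of_nonneg ht.1]; linarith [ht.2]
    have hw := h (fun t => κ t * Θ t) (κ.contDiff.mul hΘ) (κ.hasCompactSupport.mul_right) ?_
    · have e1 : ∫ t in Ico 0 T, (Y t * deriv (fun t => κ t * Θ t) t + F t * (κ t * Θ t)) =
          ∫ t in Ico 0 T, (Y t * η t + F t * Θ t) := by
        apply setIntegral_congr_fun measurableSet_Ico
        intro t ht
        have h1 : (fun t => κ t * Θ t) =ᶠ[𝓝 t] Θ := by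
          filter_upwards [hκ1 t ht] with s hs
          rw [hs, one_mul]
        simp only
        rw [h1.deriv_eq, (hΘd t).deriv, (hκ1 t ht).eq_of_nhds, one_mul]
      have hκ0 : κ (0 : ℝ) = 1 := (hκ1 0 ⟨le_rfl, hT⟩).eq_of_nhds
      simp only [e1, hκ0, one_mul] at hw
      rw [integral_Ico_eq_integral_Ioc, ← intervalIntegral.integral_of_le hT.le,
        intervalIntegral.integral_add (hYi.mul_continuousOn hη.continuous.continuousOn)
          (hFi.mul_continuousOn hΘ.continuous.continuousOn)] at hw
      have h2 := integral_primitive_mul_deriv hT.le hFi.1 hΘd hη.continuous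
      rw [hΘ0 T hbT.le, mul_zero, zero_sub] at h2
      have h3 : ∫ t in (0)..T, η t = -Θ 0 := intervalIntegral.integral_symm _ _
      have e4 : ∫ t, η t • (Y t - Y₀ - ∫ s in (0)..t, F s) =
          ∫ t in (0)..T, η t • (Y t - Y₀ - ∫ s in (0)..t, F s) := by
        rw [intervalIntegral.integral_of_le hT.le]
        symm
        apply setIntegral_eq_integral_of_forall_compl_eq_zero
        intro t ht
        rw [hηz t fun h => ht ⟨h.1, h.2.le⟩, zero_smul]
      have i1 : IntervalIntegrable (fun t => Y t * η t) volume 0 T :=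
        hYi.mul_continuousOn hη.continuous.continuousOn
      have i2 : IntervalIntegrable (fun t => Y₀ * η t) volume 0 T :=
        (hη.continuous.intervalIntegrable _ _).const_mul _
      have i3 : IntervalIntegrable (fun t => (∫ s in (0)..t, F s) * η t) volume 0 T := by
        apply ContinuousOn.intervalIntegrable
        rw [uIcc_of_le hT.le]
        exact hPc.mul hη.continuous.continuousOn
      rw [e4]
      have e5 : (fun t => η t • (Y t - Y₀ - ∫ s in (0)..t, F s)) =
          fun t => (Y t * η t - Y₀ * η t) - (∫ s in (0)..t, F s) * η t := by
        ext t; simp only [smul_eq_mul]; ring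
      rw [e5, intervalIntegral.integral_sub (i1.sub i2) i3, intervalIntegral.integral_sub i1 i2,
        intervalIntegral.integral_const_mul, h3, h2]
      linarith
    · have : tsupport (fun t => κ t * Θ t) ⊆ Iic b := by
        apply closure_minimal _ isClosed_Iic
        intro t ht
        by_contra hlt
        exact ht (by simp [hΘ0 t (not_le.1 hlt).le])
      exact this.trans (Iic_subset_Iio.2 hbT)

/-- The integrating factor exp(as), used in integrated form because y satisfies its equation only
for a.e. t. The integration by parts formula with F = -ay + f and G = exp(a·) produces a∫yG on both
sides, and these cancel. -/
theorem duhamel_of_integral_eq {y f : ℝ → ℂ} {y₀ : ℂ} {a T : ℝ} 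
    (hy : IntegrableOn y (Ioo 0 T) volume) (hf : IntegrableOn f (Ioo 0 T) volume)
    (h : ∀ᵐ t ∂(volume.restrict (Ioo 0 T)), y t = y₀ + ∫ s in (0)..t, (-a * y s + f s)) :
    ∀ᵐ t ∂(volume.restrict (Ioo 0 T)), y t = Real.exp (-(t * a)) * y₀ +
      ∫ s in (0)..t, (Real.exp (-((t - s) * a)) : ℂ) * f s := by
  filter_upwards [h, ae_restrict_mem measurableSet_Ioo] with t hyt ht
  have sub : Ioc 0 t ⊆ Ioo 0 T := fun s hs => ⟨hs.1, hs.2.trans_lt ht.2⟩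
  have hg : IntegrableOn (fun s => -a * y s + f s) (Ioc 0 t) volume :=
    ((hy.mono_set sub).const_mul _).add (hf.mono_set sub)
  let G : ℝ → ℂ := fun s => Complex.exp (a * s)
  have hGc : Continuous G := by fun_prop
  have hG : ∀ s, HasDerivAt G (a * G s) s := by
    intro s
    have h1 : HasDerivAt (fun s : ℝ => (a : ℂ) * (s : ℂ)) ((a : ℂ) * 1) s :=
      (Complex.ofRealCLM.hasDerivAt (x := s)).const_mul (a : ℂ)
    have h2 := h1.cexp
    convert h2 using 1
    simp [G]; ring
  have key := integral_primitive_mul_deriv ht.1.le hg hG (by fun_prop)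
  have hfi : IntervalIntegrable f volume 0 t :=
    (intervalIntegrable_iff_integrableOn_Ioc_of_le ht.1.le).2 (hf.mono_set sub)
  have hyi : IntervalIntegrable y volume 0 t :=
    (intervalIntegrable_iff_integrableOn_Ioc_of_le ht.1.le).2 (hy.mono_set sub)
  have e1 : ∫ s in (0)..t, (∫ r in (0)..s, (-a * y r + f r)) * (a * G s) =
      ∫ s in (0)..t, (a * (y s * G s) - y₀ * (a * G s)) := by
    rw [intervalIntegral.integral_of_le ht.1.le, intervalIntegral.integral_of_le ht.1.le]
    apply integral_congr_ae
    have := ae_restrict_of_ae_restrict_of_subset sub h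
    filter_upwards [this] with s hs
    rw [eq_sub_of_add_eq' hs.symm]; ring
  have iG : IntervalIntegrable (fun s => y₀ * (a * G s)) volume 0 t :=
    Continuous.intervalIntegrable (by fun_prop) _ _
  have iy : IntervalIntegrable (fun s => y s * G s) volume 0 t :=
    hyi.mul_continuousOn hGc.continuousOn
  have iff' : IntervalIntegrable (fun s => f s * G s) volume 0 t :=
    hfi.mul_continuousOn hGc.continuousOn
  rw [e1, intervalIntegral.integral_sub (iy.const_mul _) iG,
    intervalIntegral.integral_const_mul, intervalIntegral.integral_const_mul,
    intervalIntegral.integral_eq_sub_of_hasDerivAt (fun s _ => hG s)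
      (Continuous.intervalIntegrable (by fun_prop) _ _)] at key
  have e2 : ∫ s in (0)..t, (-a * y s + f s) * G s =
      -a * (∫ s in (0)..t, y s * G s) + ∫ s in (0)..t, f s * G s := by
    rw [← intervalIntegral.integral_const_mul, ← intervalIntegral.integral_add (iy.const_mul _) iff']
    congr 1; ext s; ring
  rw [e2, eq_sub_of_add_eq' hyt.symm] at key
  have hG0 : G 0 = 1 := by simp [G]
  rw [hG0] at key
  have e3 : ∫ s in (0)..t, (Real.exp (-((t - s) * a)) : ℂ) * f s =
      Complex.exp (-(t * a)) * ∫ s in (0)..t, f s * G s := by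
    rw [← intervalIntegral.integral_const_mul]
    congr 1; ext s
    have : (Real.exp (-((t - s) * a)) : ℂ) = Complex.exp (-(t * a)) * G s := by
      rw [Complex.ofReal_exp, ← Complex.exp_add]
      congr 1; push_cast; ring
    rw [this]; ring
  have hGt : Complex.exp (-(t * a)) * G t = 1 := by
    rw [← Complex.exp_add]; simp [mul_comm]
  rw [e3]
  have e4 : (Real.exp (-(t * a)) : ℂ) = Complex.exp (-(t * a)) := by push_cast; rfl
  rw [e4]
  linear_combination (-Complex.exp (-(t * a))) * key + (-y t) * hGt

end Whitham

namespace Whitham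

/-! ### Bounds for the symbol -/

theorem sinh_le_mul_cosh {x : ℝ} (hx : 0 ≤ x) : Real.sinh x ≤ x * Real.cosh x := by
  have hd : ∀ x : ℝ, HasDerivAt (fun x => x * Real.cosh x - Real.sinh x) (x * Real.sinh x) x := by
    intro x
    exact (((hasDerivAt_id' x).mul (Real.hasDerivAt_cosh x)).sub
      (Real.hasDerivAt_sinh x)).congr_deriv (by ring)
  have hm : MonotoneOn (fun x => x * Real.cosh x - Real.sinh x) (Ici 0) := by
    apply monotoneOn_of_deriv_nonneg (convex_Ici 0)
    · exact fun x _ => (hd x).continuousAt.continuousWithinAt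
    · exact fun x _ => (hd x).differentiableAt.differentiableWithinAt
    · intro x hx
      rw [interior_Ici] at hx
      rw [(hd x).deriv]
      exact mul_nonneg hx.le (Real.sinh_nonneg_iff.2 hx.le)
  have := hm (mem_Ici.2 le_rfl) (mem_Ici.2 hx) hx
  simp at this
  linarith

theorem tanh_nonneg {x : ℝ} (hx : 0 ≤ x) : 0 ≤ Real.tanh x := by
  rw [Real.tanh_eq_sinh_div_cosh]
  exact div_nonneg (Real.sinh_nonneg_iff.2 hx) (Real.cosh_pos x).le

theorem tanh_le_self {x : ℝ} (hx : 0 ≤ x) : Real.tanh x ≤ x := by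
  rw [Real.tanh_eq_sinh_div_cosh, div_le_iff₀ (Real.cosh_pos x)]
  exact sinh_le_mul_cosh hx

/-- After multiplication by cosh x this is x exp(-x) ≤ sinh x. The bound x/(1+x) ≤ tanh x is sharp
in order both at 0 and at infinity. -/
theorem le_mul_tanh {x : ℝ} (hx : 0 ≤ x) : x ≤ (1 + x) * Real.tanh x := by
  rw [Real.tanh_eq_sinh_div_cosh, mul_div_assoc', le_div_iff₀ (Real.cosh_pos x)]
  have h1 : Real.cosh x - Real.sinh x = Real.exp (-x) := Real.cosh_sub_sinh x
  have h2 : x * Real.exp (-x) ≤ Real.sinh x := by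
    have h3 : Real.exp (-x) ≤ 1 := Real.exp_le_one_iff.2 (by linarith)
    nlinarith [Real.self_le_sinh_iff.2 hx, Real.exp_pos (-x)]
  rw [← h1] at h2
  linarith

/-- The derivative of tanh at y is cosh(y)⁻² ≤ (1+y²)⁻¹; the increment is handled exactly through
sinh(x-y)/(cosh x cosh y). The factor 1+y² matches the cubic growth of the squared symbol. -/
theorem tanh_sub_tanh_le {x y : ℝ} (hy : 0 ≤ y) (hxy : y ≤ x) :
    (Real.tanh x - Real.tanh y) * (1 + y ^ 2) ≤ x - y := by
  have hcx := Real.cosh_pos x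
  have hcy := Real.cosh_pos y
  have h1 : Real.sinh (x - y) ≤ (x - y) * Real.cosh (x - y) := sinh_le_mul_cosh (by linarith)
  have h2 : Real.cosh (x - y) * Real.cosh y ≤ Real.cosh x := by
    have : x = (x - y) + y := by ring
    conv_rhs => rw [this]
    rw [Real.cosh_add]
    have := mul_nonneg (Real.sinh_nonneg_iff.2 (sub_nonneg.2 hxy)) (Real.sinh_nonneg_iff.2 hy)
    linarith
  have h3 : 1 + y ^ 2 ≤ Real.cosh y ^ 2 := by
    rw [Real.cosh_sq]
    nlinarith [Real.self_le_sinh_iff.2 hy]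
  have h4 : Real.tanh x - Real.tanh y = Real.sinh (x - y) / (Real.cosh x * Real.cosh y) := by
    rw [Real.tanh_eq_sinh_div_cosh, Real.tanh_eq_sinh_div_cosh, Real.sinh_sub]
    field_simp
  have h5 : 0 ≤ Real.sinh (x - y) := Real.sinh_nonneg_iff.2 (by linarith)
  rw [h4, div_mul_eq_mul_div, div_le_iff₀ (by positivity)]
  calc Real.sinh (x - y) * (1 + y ^ 2) ≤ Real.sinh (x - y) * Real.cosh y ^ 2 := by gcongr
    _ ≤ ((x - y) * Real.cosh (x - y)) * Real.cosh y ^ 2 := by gcongr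
    _ = (x - y) * (Real.cosh (x - y) * Real.cosh y) * Real.cosh y := by ring
    _ ≤ (x - y) * Real.cosh x * Real.cosh y := by
      have : 0 ≤ x - y := by linarith
      gcongr
    _ = _ := by ring

theorem symbolA_eq (ξ : ℝ) :
    symbolA ξ = Real.sqrt ((|ξ| + |ξ| ^ 3) * Real.tanh |ξ|) := by
  unfold symbolA symbolM
  split_ifs with h
  · simp [h]
  · have h1 : Real.tanh ξ / ξ = Real.tanh |ξ| / |ξ| := by
      rcases abs_cases ξ with ⟨h2, _⟩ | ⟨h2, _⟩ <;> rw [h2]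
      rw [Real.tanh_neg, neg_div_neg_eq]
    have h2 : 0 < |ξ| := abs_pos.2 h
    rw [h1, ← Real.sqrt_sq h2.le, ← Real.sqrt_mul (by positivity), Real.sqrt_sq h2.le]
    congr 1
    rw [← sq_abs ξ]
    field_simp

theorem symbolA_nonneg (ξ : ℝ) : 0 ≤ symbolA ξ := by
  rw [symbolA_eq]; positivity

theorem symbolA_abs (ξ : ℝ) : symbolA |ξ| = symbolA ξ := by
  rw [symbolA_eq, symbolA_eq, abs_abs]

theorem symbolA_neg (ξ : ℝ) : symbolA (-ξ) = symbolA ξ := by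
  rw [symbolA_eq, symbolA_eq, abs_neg]

theorem symbolA_sq (ξ : ℝ) : symbolA ξ ^ 2 = (|ξ| + |ξ| ^ 3) * Real.tanh |ξ| := by
  rw [symbolA_eq, Real.sq_sqrt]
  exact mul_nonneg (by positivity) (tanh_nonneg (abs_nonneg _))

/-- Together with `symbolA_sq_le` this makes the symbol comparable to |ξ|√(1+|ξ|): order 1 at low
and 3/2 at high frequency. -/
theorem le_symbolA_sq (ξ : ℝ) : |ξ| ^ 2 * (1 + |ξ|) / 2 ≤ symbolA ξ ^ 2 := by
  rw [symbolA_sq]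
  have h0 := abs_nonneg ξ
  have h := le_mul_tanh h0
  have h1 := tanh_nonneg h0
  set x := |ξ|
  have : x * (x * (1 + x) ^ 2 / 2) ≤ (x + x ^ 3) * ((1 + x) * Real.tanh x) := by
    calc x * (x * (1 + x) ^ 2 / 2) ≤ (x + x ^ 3) * x := by nlinarith [sq_nonneg (x * (x - 1))]
      _ ≤ _ := by gcongr
  have h2 : 0 < 1 + x := by linarith
  nlinarith

theorem symbolA_sq_le (ξ : ℝ) : symbolA ξ ^ 2 ≤ |ξ| ^ 2 * (1 + |ξ|) := by
  rw [symbolA_sq]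
  have h0 := abs_nonneg ξ
  have h1 := tanh_le_self h0
  have h2 := (Real.tanh_lt_one |ξ|).le
  set x := |ξ|
  have h3 : x * Real.tanh x ≤ x * x := by gcongr
  have h4 : x ^ 3 * Real.tanh x ≤ x ^ 3 * 1 := by gcongr
  nlinarith

/-- The squares are compared, since the square root is singular at the origin: the increment of the
symbol is at most the increment of its square divided by `symbolA x`. The square increases by at
most 3(x-y)x(1+x), and the symbol is at least (7/10)x√(1+x) because (7/10)² ≤ 1/2. Then 30/7 ≤ 5. -/
theorem symbolA_sub_le {x y : ℝ} (hy : 0 ≤ y) (hxy : y ≤ x) :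
    |symbolA x - symbolA y| ≤ 5 * (x - y) * Real.sqrt (1 + x) := by
  have hx : 0 ≤ x := hy.trans hxy
  rcases hx.eq_or_lt with rfl | hx0
  · have : y = 0 := le_antisymm hxy hy
    simp [this]
  have ax := symbolA_sq x
  have ay := symbolA_sq y
  rw [abs_of_nonneg hx] at ax
  rw [abs_of_nonneg hy] at ay
  have hb := tanh_sub_tanh_le hy hxy
  have htx := tanh_le_self hx
  have htx1 := (Real.tanh_lt_one x).le
  have htx0 := tanh_nonneg hx
  have hmono : Real.tanh y ≤ Real.tanh x := by
    rw [Real.tanh_eq_sinh_div_cosh, Real.tanh_eq_sinh_div_cosh, div_le_div_iff₀ (Real.cosh_pos _)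
      (Real.cosh_pos _)]
    have : 0 ≤ Real.sinh (x - y) := Real.sinh_nonneg_iff.2 (by linarith)
    rw [Real.sinh_sub] at this
    linarith
  have hd : 0 ≤ x - y := by linarith
  have hdiff : symbolA x ^ 2 - symbolA y ^ 2 ≤ (x - y) * (3 * (x * (1 + x))) := by
    rw [ax, ay]
    -- The product rule for increments: first the polynomial increases with tanh x fixed, then tanh
    -- increases with y + y³ = y(1+y²) in front.
    have e : (x + x ^ 3) * Real.tanh x - (y + y ^ 3) * Real.tanh y =
      (x - y) * ((1 + (x ^ 2 + x * y + y ^ 2)) * Real.tanh x) +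
        y * ((Real.tanh x - Real.tanh y) * (1 + y ^ 2)) := by ring
    rw [e]
    have h1 : (1 + (x ^ 2 + x * y + y ^ 2)) * Real.tanh x ≤ x + 3 * x ^ 2 := by
      have : x ^ 2 + x * y + y ^ 2 ≤ 3 * x ^ 2 := by nlinarith
      have h5 : 0 ≤ x ^ 2 + x * y + y ^ 2 := by positivity
      nlinarith
    have h2 : y * ((Real.tanh x - Real.tanh y) * (1 + y ^ 2)) ≤ x * (x - y) :=
      mul_le_mul hxy hb (mul_nonneg (by linarith) (by positivity)) hx
    nlinarith [mul_le_mul_of_nonneg_left h1 hd]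
  have hge : symbolA y ^ 2 ≤ symbolA x ^ 2 := by
    rw [ax, ay]
    have := tanh_nonneg hy
    gcongr
  have hle : symbolA y ≤ symbolA x := by
    exact (pow_le_pow_iff_left₀ (symbolA_nonneg y) (symbolA_nonneg x) (by norm_num)).1 hge
  rw [abs_of_nonneg (by linarith)]
  set s := Real.sqrt (1 + x) with hs
  have hs2 : s ^ 2 = 1 + x := Real.sq_sqrt (by linarith)
  have hs0 : 0 < s := Real.sqrt_pos.2 (by linarith)
  have hlow : x * s * (7 / 10) ≤ symbolA x := by
    have := le_symbolA_sq x
    rw [abs_of_nonneg hx, ← hs2] at this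
    apply le_of_sq_le_sq _ (symbolA_nonneg x)
    nlinarith [sq_nonneg (x * s)]
  have h6 : (symbolA x - symbolA y) * (x * s * (7 / 10)) ≤ (x - y) * (3 * (x * s ^ 2)) := by
    have h7 : 0 ≤ symbolA x - symbolA y := by linarith
    calc (symbolA x - symbolA y) * (x * s * (7 / 10)) ≤ (symbolA x - symbolA y) * symbolA x := by
          gcongr
      _ ≤ (symbolA x - symbolA y) * (symbolA x + symbolA y) := by
          gcongr; linarith [symbolA_nonneg y]
      _ = symbolA x ^ 2 - symbolA y ^ 2 := by ring
      _ ≤ _ := by rw [hs2]; exact hdiff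
  have h8 : 0 < x * s := by positivity
  have h9 : (symbolA x - symbolA y) * (7 / 10) ≤ (x - y) * (3 * s) := by
    by_contra hcon
    push Not at hcon
    have := mul_lt_mul_of_pos_right hcon h8
    nlinarith
  have : 0 ≤ (x - y) * s := by positivity
  nlinarith

theorem abs_symbolA_sub_le (x y : ℝ) :
    |symbolA x - symbolA y| ≤ 5 * |x - y| * Real.sqrt (1 + |x| + |y|) := by
  wlog h : |y| ≤ |x| generalizing x y
  · have := this y x (le_of_not_ge h)
    rw [abs_sub_comm, abs_sub_comm x y, add_right_comm]; exact this
  have := symbolA_sub_le (abs_nonneg y) h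
  rw [symbolA_abs, symbolA_abs] at this
  refine this.trans ?_
  have h1 : |x| - |y| ≤ |x - y| := abs_sub_abs_le_abs_sub x y
  have h2 : Real.sqrt (1 + |x|) ≤ Real.sqrt (1 + |x| + |y|) :=
    Real.sqrt_le_sqrt (by linarith [abs_nonneg y])
  gcongr

theorem continuous_symbolA : Continuous symbolA := by
  rw [continuous_iff_continuousAt]
  intro x
  rw [ContinuousAt, tendsto_iff_dist_tendsto_zero]
  refine squeeze_zero (fun _ => dist_nonneg) (fun y => abs_symbolA_sub_le y x) ?_
  have : Continuous fun y : ℝ => 5 * |y - x| * Real.sqrt (1 + |y| + |x|) := by fun_prop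
  simpa using this.tendsto x

/-- The symbol of `(-Δ)^{1/2} M` in the frequency variable of Mathlib's Fourier transform. -/
noncomputable def freqA (ξ : ℝ) : ℝ := symbolA (2 * Real.pi * ξ)

theorem freqA_nonneg (ξ : ℝ) : 0 ≤ freqA ξ := symbolA_nonneg _

theorem continuous_freqA : Continuous freqA :=
  continuous_symbolA.comp (by fun_prop)

theorem freqA_neg (ξ : ℝ) : freqA (-ξ) = freqA ξ := by
  unfold freqA; rw [mul_neg, symbolA_neg]

/-- The dissipation of order 3/2 on which every gain of regularity rests. The factor 2π ≥ 6 absorbs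
the constant from `le_symbolA_sq`. -/
theorem rpow_le_freqA (ξ : ℝ) : |ξ| ^ (3 / 2 : ℝ) ≤ freqA ξ := by
  have h := le_symbolA_sq (2 * Real.pi * ξ)
  have h0 := abs_nonneg ξ
  apply le_of_sq_le_sq _ (freqA_nonneg ξ)
  rw [← Real.rpow_natCast, ← Real.rpow_mul h0]
  norm_num
  refine le_trans ?_ h
  rw [abs_mul, abs_of_pos (by positivity : (0 : ℝ) < 2 * Real.pi)]
  have hp := Real.pi_gt_three
  set x := |ξ|
  have h1 : 6 * x ≤ 2 * Real.pi * x := by gcongr; linarith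
  calc x ^ 3 ≤ (6 * x) ^ 2 * (6 * x) / 2 := by nlinarith [pow_nonneg h0 3]
    _ ≤ (2 * Real.pi * x) ^ 2 * (1 + 2 * Real.pi * x) / 2 := by gcongr; linarith

theorem abs_le_freqA (ξ : ℝ) : |ξ| ≤ freqA ξ := by
  have h := le_symbolA_sq (2 * Real.pi * ξ)
  have h0 := abs_nonneg ξ
  apply le_of_sq_le_sq _ (freqA_nonneg ξ)
  refine le_trans ?_ h
  rw [abs_mul, abs_of_pos (by positivity : (0 : ℝ) < 2 * Real.pi)]
  have hp := Real.pi_gt_three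
  set x := |ξ|
  have h1 : 6 * x ≤ 2 * Real.pi * x := by gcongr; linarith
  calc x ^ 2 ≤ (6 * x) ^ 2 * (1 + 0) / 2 := by nlinarith [sq_nonneg x]
    _ ≤ (2 * Real.pi * x) ^ 2 * (1 + 2 * Real.pi * x) / 2 := by gcongr; linarith

theorem freqA_le (ξ : ℝ) : freqA ξ ≤ 50 * (1 + |ξ|) ^ 2 := by
  have h := symbolA_sq_le (2 * Real.pi * ξ)
  have h0 := abs_nonneg ξ
  apply le_of_sq_le_sq _ (by positivity)
  refine h.trans ?_
  rw [abs_mul, abs_of_pos (by positivity : (0 : ℝ) < 2 * Real.pi)]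
  have hp := Real.pi_lt_d2
  set x := |ξ|
  have h1 : 2 * Real.pi * x ≤ 7 * x := by gcongr; linarith
  calc (2 * Real.pi * x) ^ 2 * (1 + 2 * Real.pi * x) ≤ (7 * x) ^ 2 * (1 + 7 * x) := by gcongr
    _ ≤ (7 * (1 + x)) ^ 2 * (7 * (1 + x) ^ 2) := by gcongr <;> nlinarith
    _ ≤ _ := by nlinarith [pow_nonneg (by linarith : 0 ≤ 1 + x) 4]

theorem abs_freqA_sub_le (x y : ℝ) :
    |freqA x - freqA y| ≤ 100 * |x - y| * Real.sqrt (1 + |x| + |y|) := by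
  have h := abs_symbolA_sub_le (2 * Real.pi * x) (2 * Real.pi * y)
  refine h.trans ?_
  have hp := Real.pi_lt_d2
  have hp0 := Real.pi_pos
  have e : ∀ z : ℝ, |2 * Real.pi * z| = 2 * Real.pi * |z| := fun z => by
    rw [abs_mul, abs_of_pos (by positivity : (0 : ℝ) < 2 * Real.pi)]
  rw [← mul_sub, e, e, e]
  -- 2π ≤ 6.3 ≤ 2.6², and 5 · 6.3 · 2.6 ≤ 100 in the last line.
  have h1 : Real.sqrt (1 + 2 * Real.pi * |x| + 2 * Real.pi * |y|) ≤
      Real.sqrt (2.6 ^ 2 * (1 + |x| + |y|)) := by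
    apply Real.sqrt_le_sqrt
    nlinarith [abs_nonneg x, abs_nonneg y]
  rw [Real.sqrt_mul (by norm_num), Real.sqrt_sq (by norm_num)] at h1
  calc 5 * (2 * Real.pi * |x - y|) * Real.sqrt (1 + 2 * Real.pi * |x| + 2 * Real.pi * |y|)
      ≤ 5 * (2 * 3.15 * |x - y|) * (2.6 * Real.sqrt (1 + |x| + |y|)) := by gcongr
    _ ≤ _ := by nlinarith [mul_nonneg (abs_nonneg (x - y)) (Real.sqrt_nonneg (1 + |x| + |y|))]

end Whitham

namespace Whitham

open scoped SchwartzMap ContDiff ComplexConjugate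
open Filter Topology

/-! ### Pairings with test functions on the Fourier side -/

theorem memLp_two_one_add_abs_rpow : MemLp (fun ξ : ℝ => (1 + |ξ|) ^ (-2 : ℝ)) 2 volume := by
  have hm : AEStronglyMeasurable (fun ξ : ℝ => (1 + |ξ|) ^ (-2 : ℝ)) volume :=
    Measurable.aestronglyMeasurable (by fun_prop)
  rw [memLp_two_iff_integrable_sq hm]
  have h := integrable_one_add_norm (E := ℝ) (μ := volume) (r := 4) (by simp)
  apply h.congr
  refine Eventually.of_forall fun ξ => ?_
  simp only [Real.norm_eq_abs]
  rw [← Real.rpow_natCast, ← Real.rpow_mul (by positivity)]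
  norm_num

theorem exists_schwartz_decay (φ : 𝓢(ℝ, ℂ)) (k : ℕ) :
    ∃ C : ℝ, 0 ≤ C ∧ ∀ ξ, (1 + |ξ|) ^ k * ‖φ ξ‖ ≤ C * (1 + |ξ|) ^ (-2 : ℝ) := by
  refine ⟨2 ^ (k + 2) * ((Finset.Iic (k + 2, 0)).sup
    (fun m => SchwartzMap.seminorm ℝ (F := ℂ) (E := ℝ) m.1 m.2)) φ, by positivity, fun ξ => ?_⟩
  have h := SchwartzMap.one_add_le_sup_seminorm_apply (𝕜 := ℝ) (m := (k + 2, 0)) (k := k + 2)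
    (n := 0) le_rfl le_rfl φ ξ
  rw [norm_iteratedFDeriv_zero, Real.norm_eq_abs] at h
  have hp : 0 < 1 + |ξ| := by positivity
  rw [Real.rpow_neg hp.le, ← div_eq_mul_inv, le_div_iff₀ (by positivity)]
  refine le_trans (le_of_eq ?_) h
  rw [show (2 : ℝ) = ((2 : ℕ) : ℝ) by norm_num, Real.rpow_natCast]
  ring

/-- The symbol behaves like |ξ| near 0, so its product with a Schwartz function need not be
Schwartz; membership in L¹ ∩ L² is all that the pairings use. -/
theorem memLp_mul_schwartz {w : ℝ → ℂ} (hw : Continuous w) {C : ℝ} {k : ℕ}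
    (hwb : ∀ ξ, ‖w ξ‖ ≤ C * (1 + |ξ|) ^ k) (φ : 𝓢(ℝ, ℂ)) :
    Integrable (fun ξ => w ξ * φ ξ) volume ∧ MemLp (fun ξ => w ξ * φ ξ) 2 volume := by
  obtain ⟨B, hB, hφ⟩ := exists_schwartz_decay φ k
  have hC : 0 ≤ C := by simpa using (norm_nonneg _).trans (hwb 0)
  have hm : AEStronglyMeasurable (fun ξ => w ξ * φ ξ) volume :=
    (hw.mul φ.continuous).aestronglyMeasurable
  have hle : ∀ ξ, ‖w ξ * φ ξ‖ ≤ ‖(C * B) * (1 + |ξ|) ^ (-2 : ℝ)‖ := by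
    intro ξ
    rw [norm_mul, Real.norm_of_nonneg (by positivity)]
    calc ‖w ξ‖ * ‖φ ξ‖ ≤ (C * (1 + |ξ|) ^ k) * ‖φ ξ‖ := by gcongr; exact hwb ξ
      _ = C * ((1 + |ξ|) ^ k * ‖φ ξ‖) := by ring
      _ ≤ C * (B * (1 + |ξ|) ^ (-2 : ℝ)) := mul_le_mul_of_nonneg_left (hφ ξ) hC
      _ = _ := by ring
  constructor
  · have h := integrable_one_add_norm (E := ℝ) (μ := volume) (r := 2) (by simp)
    exact (h.const_mul (C * B)).mono hm (Eventually.of_forall hle)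
  · exact (memLp_two_one_add_abs_rpow.const_mul (C * B)).of_le hm (Eventually.of_forall hle)

theorem fourier_ofReal_neg (f : ℝ → ℝ) (ξ : ℝ) :
    𝓕 (fun x => (f x : ℂ)) (-ξ) = conj (𝓕 (fun x => (f x : ℂ)) ξ) := by
  rw [fourier_eq_integral_char, fourier_eq_integral_char, ← integral_conj]
  congr 1; ext x
  rw [map_mul, conj_char, Complex.conj_ofReal]

/-- A smooth compactly supported real function as a complex Schwartz function. -/
noncomputable def schwartzOf {χ : ℝ → ℝ} (hχ : ContDiff ℝ ∞ χ) (hc : HasCompactSupport χ) :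
    𝓢(ℝ, ℂ) :=
  (hc.comp_left (g := fun r : ℝ => (r : ℂ)) (by simp)).toSchwartzMap
    (Complex.ofRealCLM.contDiff.comp hχ)

theorem schwartzOf_apply {χ : ℝ → ℝ} (hχ : ContDiff ℝ ∞ χ) (hc : HasCompactSupport χ) (x : ℝ) :
    schwartzOf hχ hc x = χ x := rfl

theorem fourier_schwartzOf {χ : ℝ → ℝ} (hχ : ContDiff ℝ ∞ χ) (hc : HasCompactSupport χ) (ξ : ℝ) :
    (𝓕 (schwartzOf hχ hc)) ξ = 𝓕 (fun x => (χ x : ℂ)) ξ := by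
  rw [SchwartzMap.fourier_coe]; rfl

theorem norm_freqA_le (ξ : ℝ) : ‖(freqA ξ : ℂ)‖ ≤ 50 * (1 + |ξ|) ^ 2 := by
  rw [Complex.norm_real, Real.norm_of_nonneg (freqA_nonneg ξ)]
  exact freqA_le ξ

section
variable {χ : ℝ → ℝ} (hχ : ContDiff ℝ ∞ χ) (hc : HasCompactSupport χ)
include hχ hc

theorem memLp_freqA_mul_fourier :
    Integrable (fun ξ => (freqA ξ : ℂ) * 𝓕 (fun x => (χ x : ℂ)) ξ) volume ∧
      MemLp (fun ξ => (freqA ξ : ℂ) * 𝓕 (fun x => (χ x : ℂ)) ξ) 2 volume := by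
  have h := memLp_mul_schwartz (w := fun ξ => (freqA ξ : ℂ))
    (Complex.continuous_ofReal.comp continuous_freqA) norm_freqA_le (𝓕 (schwartzOf hχ hc))
  simpa only [fourier_schwartzOf] using h

theorem memLp_fourier_test :
    Integrable (𝓕 (fun x => (χ x : ℂ))) volume ∧ MemLp (𝓕 (fun x => (χ x : ℂ))) 2 volume :=
  ⟨(𝓕 (schwartzOf hχ hc)).integrable, (𝓕 (schwartzOf hχ hc)).memLp 2 volume⟩

theorem integrable_mul_fourier_test :
    Integrable (fun ξ : ℝ => (ξ : ℂ) * 𝓕 (fun x => (χ x : ℂ)) ξ) volume := by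
  have h := memLp_mul_schwartz (w := fun ξ : ℝ => (ξ : ℂ)) Complex.continuous_ofReal (C := 1) (k := 1)
    (fun ξ => by simp) (𝓕 (schwartzOf hχ hc))
  simpa only [fourier_schwartzOf] using h.1

theorem memLp_test : MemLp (fun x => (χ x : ℂ)) 2 volume ∧
    Integrable (fun x => (χ x : ℂ)) volume :=
  ⟨(schwartzOf hχ hc).memLp 2 volume, (schwartzOf hχ hc).integrable⟩

omit hχ hc in
theorem ofReal_opA (χ : ℝ → ℝ) (x : ℝ) :
    (opA χ x : ℂ) = 𝓕⁻ (fun ξ => (freqA ξ : ℂ) * 𝓕 (fun x => (χ x : ℂ)) ξ) x := by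
  unfold opA
  change ((𝓕⁻ (fun ξ : ℝ => (freqA ξ : ℂ) * 𝓕 (fun y : ℝ => (χ y : ℂ)) ξ) x).re : ℂ) = _
  apply Complex.conj_eq_iff_re.1
  rw [fourierInv_eq_integral_char, ← integral_conj, ← integral_neg_eq_self]
  congr 1; ext ξ
  rw [map_mul, map_mul, conj_char, Complex.conj_ofReal, freqA_neg, fourier_ofReal_neg,
    Complex.conj_conj]
  congr 1
  unfold char; simp

theorem memLp_opA : MemLp (fun x => (opA χ x : ℂ)) 2 volume ∧
    fourierL2 (fun x => (opA χ x : ℂ)) =ᵐ[volume]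
      fun ξ => (freqA ξ : ℂ) * 𝓕 (fun x => (χ x : ℂ)) ξ := by
  have h := memLp_freqA_mul_fourier hχ hc
  have := memLp_fourierInv h.2 h.1
  rwa [show 𝓕⁻ (fun ξ => (freqA ξ : ℂ) * 𝓕 (fun x => (χ x : ℂ)) ξ) =
    fun x => (opA χ x : ℂ) from funext fun x => (ofReal_opA χ x).symm] at this

theorem integral_mul_test {f : ℝ → ℝ} (hf : MemLp (fun x => (f x : ℂ)) 2 volume) :
    ((∫ x, f x * χ x : ℝ) : ℂ) =
      ∫ ξ, conj (𝓕 (fun x => (χ x : ℂ)) ξ) * fourierL2 (fun x => (f x : ℂ)) ξ := by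
  have ht := memLp_test hχ hc
  have h := integral_conj_mul_fourierL2 ht.1 hf
  rw [← integral_complex_ofReal]
  trans ∫ x, conj (χ x : ℂ) * (f x : ℂ)
  · congr 1; ext x; rw [Complex.conj_ofReal]; push_cast; ring
  · rw [← h]
    apply integral_congr_ae
    filter_upwards [fourierL2_eq_fourier ht.1 ht.2] with ξ hξ
    rw [hξ]

theorem integral_mul_opA {f : ℝ → ℝ} (hf : MemLp (fun x => (f x : ℂ)) 2 volume) :
    ((∫ x, f x * opA χ x : ℝ) : ℂ) =
      ∫ ξ, conj (𝓕 (fun x => (χ x : ℂ)) ξ) * (freqA ξ * fourierL2 (fun x => (f x : ℂ)) ξ) := by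
  have ht := memLp_opA hχ hc
  have h := integral_conj_mul_fourierL2 ht.1 hf
  rw [← integral_complex_ofReal]
  trans ∫ x, conj (opA χ x : ℂ) * (f x : ℂ)
  · congr 1; ext x; rw [Complex.conj_ofReal]; push_cast; ring
  · rw [← h]
    apply integral_congr_ae
    filter_upwards [ht.2] with ξ hξ
    rw [hξ, map_mul, Complex.conj_ofReal]; ring

/-- This is applied to f = u², which is only in L¹; so L¹ duality replaces Parseval, with the
inverse transform of χ' as the Schwartz function. -/
theorem integral_mul_deriv_test {f : ℝ → ℝ} (hf : Integrable (fun x => (f x : ℂ)) volume) :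
    ((∫ x, f x * deriv χ x : ℝ) : ℂ) =
      ∫ ξ, conj (𝓕 (fun x => (χ x : ℂ)) ξ) *
        (-(2 * Real.pi * Complex.I * ξ) * 𝓕 (fun x => (f x : ℂ)) ξ) := by
  have hd : ContDiff ℝ ∞ (deriv χ) := (contDiff_infty_iff_deriv.1 hχ).2
  have hdc : HasCompactSupport (deriv χ) := hc.deriv
  let Ψ : 𝓢(ℝ, ℂ) := 𝓕⁻ (schwartzOf hd hdc)
  have hΨ : 𝓕 Ψ = schwartzOf hd hdc := FourierTransform.fourier_fourierInv_eq _
  have h := integral_schwartz_mul_fourier hf Ψ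
  rw [hΨ] at h
  rw [← integral_complex_ofReal]
  trans ∫ x, (schwartzOf hd hdc) x * (f x : ℂ)
  · congr 1; ext x; rw [schwartzOf_apply]; push_cast; ring
  · rw [← h]
    congr 1; ext ξ
    have hder : deriv (fun x => (χ x : ℂ)) = fun x => ((deriv χ x : ℝ) : ℂ) := by
      ext x
      exact ((hχ.differentiable (by simp)) x).hasDerivAt.ofReal_comp.deriv
    have hF := Real.fourier_deriv (f := fun x => (χ x : ℂ)) (memLp_test hχ hc).2
      (fun x => ((hχ.differentiable (by simp)) x).hasDerivAt.ofReal_comp.differentiableAt)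
      (by rw [hder]; exact (memLp_test hd hdc).2)
    rw [hder] at hF
    have : Ψ ξ = 𝓕 (fun x => ((deriv χ x : ℝ) : ℂ)) (-ξ) := by
      change (𝓕⁻ (schwartzOf hd hdc)) ξ = _
      rw [SchwartzMap.fourierInv_coe, fourierInv_eq_fourier_neg']
      rfl
    rw [this, hF]
    simp only [fourier_ofReal_neg, smul_eq_mul]
    push_cast; ring

omit hχ hc in
theorem fourier_translate (f : ℝ → ℂ) (y ξ : ℝ) :
    𝓕 (fun x => f (x - y)) ξ = char ξ y * 𝓕 f ξ := by
  rw [fourier_eq_integral_char, fourier_eq_integral_char, ← integral_const_mul,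
    ← integral_add_right_eq_self (fun x => char ξ x * f (x - y)) y]
  congr 1; ext z
  simp [char_add_right]; ring

end

end Whitham

/-! ### The weak formulation tested in space, and measurable spectra -/

namespace Whitham

open scoped SchwartzMap ContDiff ComplexConjugate NNReal
open Filter Topology

theorem MemLpTime.exists_ae_le {J : Set ℝ} {N : (ℝ → ℝ) → ℝ≥0∞} {u : ℝ → ℝ → ℝ}
    (h : MemLpTime J ⊤ N u) :
    ∃ C : ℝ≥0, ∀ᵐ t ∂(volume.restrict J), N (u t) ≤ C := by
  unfold MemLpTime at h
  rw [eLpNorm_exponent_top] at h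
  refine ⟨(eLpNormEssSup (fun t => N (u t)) (volume.restrict J)).toNNReal, ?_⟩
  rw [ENNReal.coe_toNNReal h.ne]
  filter_upwards [enorm_ae_le_eLpNormEssSup (fun t => N (u t)) (volume.restrict J)] with t ht
  simpa using ht

theorem memLpTime_top_of_ae_le {J : Set ℝ} {N : (ℝ → ℝ) → ℝ≥0∞} {u : ℝ → ℝ → ℝ} {C : ℝ≥0∞}
    (hC : C < ⊤) (h : ∀ᵐ t ∂(volume.restrict J), N (u t) ≤ C) : MemLpTime J ⊤ N u := by
  unfold MemLpTime
  rw [eLpNorm_exponent_top]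
  refine lt_of_le_of_lt ?_ hC
  apply eLpNormEssSup_le_of_ae_enorm_bound
  filter_upwards [h] with t ht
  simpa using ht

theorem lintegral_enorm_mul_enorm_le {α E F : Type*} [MeasurableSpace α] {μ : Measure α}
    [NormedAddCommGroup E] [NormedAddCommGroup F] {f : α → E} {g : α → F}
    (hf : AEStronglyMeasurable f μ) (hg : AEStronglyMeasurable g μ) :
    ∫⁻ x, ‖f x‖ₑ * ‖g x‖ₑ ∂μ ≤ eLpNorm f 2 μ * eLpNorm g 2 μ := by
  have h := ENNReal.lintegral_mul_le_Lp_mul_Lq μ Real.HolderConjugate.two_two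
    hf.enorm hg.enorm
  rw [eLpNorm_eq_lintegral_rpow_enorm_toReal (by norm_num) (by norm_num),
    eLpNorm_eq_lintegral_rpow_enorm_toReal (by norm_num) (by norm_num)]
  simpa using h

theorem integrable_of_ae_enorm_le {α E : Type*} [MeasurableSpace α] {μ : Measure α}
    [IsFiniteMeasure μ] [NormedAddCommGroup E] {f : α → E} (hf : AEStronglyMeasurable f μ)
    {M : ℝ≥0∞} (hM : M < ⊤) (h : ∀ᵐ x ∂μ, ‖f x‖ₑ ≤ M) : Integrable f μ := by
  refine ⟨hf, ?_⟩
  calc ∫⁻ x, ‖f x‖ₑ ∂μ ≤ ∫⁻ _, M ∂μ := lintegral_mono_ae h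
    _ < ⊤ := by rw [lintegral_const]; exact ENNReal.mul_lt_top hM (measure_lt_top _ _)

theorem opA_const_mul (c : ℝ) (χ : ℝ → ℝ) (x : ℝ) :
    opA (fun y => c * χ y) x = c * opA χ x := by
  apply Complex.ofReal_injective
  rw [ofReal_opA, Complex.ofReal_mul, ofReal_opA, fourierInv_eq_integral_char,
    fourierInv_eq_integral_char, ← integral_const_mul]
  congr 1; ext ξ
  have : 𝓕 (fun y => ((c * χ y : ℝ) : ℂ)) ξ = c * 𝓕 (fun y => (χ y : ℂ)) ξ := by
    rw [fourier_eq_integral_char, fourier_eq_integral_char, ← integral_const_mul]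
    congr 1; ext z; push_cast; ring
  rw [this]; ring

theorem isTestFunction_mul {T : ℝ} {θ χ : ℝ → ℝ} (hθ : ContDiff ℝ ∞ θ) (hθc : HasCompactSupport θ)
    (hθT : tsupport θ ⊆ Iio T) (hχ : ContDiff ℝ ∞ χ) (hc : HasCompactSupport χ) :
    IsTestFunction (Ico 0 T) (fun t x => θ t * χ x) := by
  have hsub : Function.support (Function.uncurry fun t x => θ t * χ x) ⊆
      tsupport θ ×ˢ tsupport χ := by
    rintro ⟨t, x⟩ h
    simp only [Function.uncurry, Function.mem_support, ne_eq, mul_eq_zero, not_or] at h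
    exact ⟨subset_tsupport _ h.1, subset_tsupport _ h.2⟩
  have hcomp : IsCompact (tsupport θ ×ˢ tsupport χ) := hθc.isCompact.prod hc.isCompact
  refine ⟨?_, HasCompactSupport.of_support_subset_isCompact hcomp hsub, ?_⟩
  · exact (hθ.comp contDiff_fst).mul (hχ.comp contDiff_snd)
  · intro p hp h0
    have := closure_minimal hsub hcomp.isClosed hp
    exact ⟨h0, hθT this.1⟩

theorem memLp_ofReal_iff {f : ℝ → ℝ} {p : ℝ≥0∞} :
    MemLp (fun x => (f x : ℂ)) p volume ↔ MemLp f p volume :=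
  ⟨fun h => by simpa using h.re, fun h => h.ofReal⟩

theorem eLpNorm_ofReal (f : ℝ → ℝ) (p : ℝ≥0∞) :
    eLpNorm (fun x => (f x : ℂ)) p volume = eLpNorm f p volume :=
  eLpNorm_congr_norm_ae (Eventually.of_forall fun x => by simp)

/-- The equation tested against a function of space only. -/
theorem IsWeakSolution.integral_mul_test_eq {T : ℝ} (hT : 0 < T) {u₀ : ℝ → ℝ} {u : ℝ → ℝ → ℝ}
    (hu : IsWeakSolution (Ico 0 T) u₀ u) {χ : ℝ → ℝ} (hχ : ContDiff ℝ ∞ χ)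
    (hc : HasCompactSupport χ) :
    ∀ᵐ t ∂(volume.restrict (Ioo 0 T)), ∫ x, u t x * χ x = (∫ x, u₀ x * χ x) +
      ∫ s in (0)..t, (-(∫ x, u s x * opA χ x) - (∫ x, u s x * u s x * deriv χ x) / 2) := by
  obtain ⟨C, hC⟩ := hu.memLinftyL2.exists_ae_le
  have hm := hu.measurable
  have hmt : ∀ᵐ t ∂(volume.restrict (Ico 0 T)), AEStronglyMeasurable (u t) volume := hm.prodMk_left
  have hχ2 : MemLp χ 2 volume := memLp_ofReal_iff.1 (memLp_test hχ hc).1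
  have hA2 : MemLp (opA χ) 2 volume := memLp_ofReal_iff.1 (memLp_opA hχ hc).1
  have hd : Continuous (deriv χ) := (contDiff_infty_iff_deriv.1 hχ).2.continuous
  obtain ⟨D, hD⟩ : ∃ D : ℝ, ∀ x, ‖deriv χ x‖ ≤ D := hd.bounded_above_of_compact_support hc.deriv
  have hg : ∀ᵐ t ∂(volume.restrict (Ico 0 T)), MemLp (u t) 2 volume := by
    filter_upwards [hC, hmt] with t h1 h2
    exact ⟨h2, h1.trans_lt ENNReal.coe_lt_top⟩
  have hI : ∀ g : ℝ → ℝ, MemLp g 2 volume →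
      IntegrableOn (fun t => ∫ x, u t x * g x) (Ico 0 T) volume := by
    intro g hg2
    apply integrable_of_ae_enorm_le (M := C * eLpNorm g 2 volume)
    · exact (hm.mul hg2.1.comp_snd).integral_prod_right'
    · exact ENNReal.mul_lt_top ENNReal.coe_lt_top hg2.2
    · filter_upwards [hC, hg] with t h1 h2
      refine (enorm_integral_le_lintegral_enorm _).trans ?_
      simp only [enorm_mul]
      refine (lintegral_enorm_mul_enorm_le h2.1 hg2.1).trans ?_
      gcongr
  have hQ : IntegrableOn (fun t => ∫ x, u t x * u t x * deriv χ x) (Ico 0 T) volume := by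
    apply integrable_of_ae_enorm_le (M := C * C * ENNReal.ofReal D)
    · exact ((hm.mul hm).mul hd.aestronglyMeasurable.comp_snd).integral_prod_right'
    · exact ENNReal.mul_lt_top (ENNReal.mul_lt_top ENNReal.coe_lt_top ENNReal.coe_lt_top)
        ENNReal.ofReal_lt_top
    · filter_upwards [hC, hg] with t h1 h2
      refine (enorm_integral_le_lintegral_enorm _).trans ?_
      calc ∫⁻ x, ‖u t x * u t x * deriv χ x‖ₑ
          ≤ ∫⁻ x, (‖u t x‖ₑ * ‖u t x‖ₑ) * ENNReal.ofReal D := by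
            apply lintegral_mono
            intro x
            simp only [enorm_mul]
            gcongr
            rw [← ofReal_norm]
            exact ENNReal.ofReal_le_ofReal (hD x)
        _ = (∫⁻ x, ‖u t x‖ₑ * ‖u t x‖ₑ) * ENNReal.ofReal D :=
            lintegral_mul_const' _ _ ENNReal.ofReal_ne_top
        _ ≤ _ := by
            gcongr
            refine (lintegral_enorm_mul_enorm_le h2.1 h2.1).trans ?_
            gcongr
  -- Test functions of the form θ(t)χ(x) turn the weak formulation into a scalar weak equation for
  -- the pairing of u(t) with χ.
  apply eq_integral_of_weak_derivative hT (hI χ hχ2) ((hI _ hA2).neg.sub (hQ.div_const 2))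
  intro θ hθ hθc hθT
  have hw := hu.weak _ (isTestFunction_mul hθ hθc hθT hχ hc)
  have e0 : ∫ x, u₀ x * (θ 0 * χ x) = (∫ x, u₀ x * χ x) * θ 0 := by
    rw [← integral_mul_const]; congr 1; ext x; ring
  rw [e0] at hw
  refine Eq.trans ?_ hw
  congr 1
  apply integral_congr_ae
  filter_upwards [hg] with t h2
  have i1 : Integrable (fun x => u t x * χ x) volume := h2.integrable_mul hχ2
  have i2 : Integrable (fun x => u t x * opA χ x) volume := h2.integrable_mul hA2
  have i3 : Integrable (fun x => u t x * u t x * deriv χ x) volume :=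
    (h2.integrable_mul h2).mul_bdd hd.aestronglyMeasurable (Eventually.of_forall hD)
  have e : ∀ x, u t x * (deriv (fun τ => θ τ * χ x) t - opA (fun y => θ t * χ y) x) -
      u t x ^ 2 / 2 * deriv (fun y => θ t * χ y) x =
      deriv θ t * (u t x * χ x) - θ t * (u t x * opA χ x) -
        θ t / 2 * (u t x * u t x * deriv χ x) := by
    intro x
    rw [opA_const_mul, deriv_mul_const_field, deriv_const_mul_field]
    ring
  simp only [e]
  have i12 : Integrable (fun x => deriv θ t * (u t x * χ x) - θ t * (u t x * opA χ x)) volume :=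
    (i1.const_mul _).sub (i2.const_mul _)
  rw [integral_sub i12 (i3.const_mul _),
    integral_sub (i1.const_mul _) (i2.const_mul _), integral_const_mul, integral_const_mul,
    integral_const_mul]
  simp only [Pi.sub_apply, Pi.neg_apply]
  ring

/-- `U` and `G` are jointly measurable versions of the spatial Fourier transforms of `u` and
`u²` on `(0, T)`, where `‖u(t)‖₂ ≤ C`. -/
structure HasSpectrum (T : ℝ) (u : ℝ → ℝ → ℝ) (U G : ℝ × ℝ → ℂ) (C : ℝ≥0) : Prop where
  measU : StronglyMeasurable U
  measG : StronglyMeasurable G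
  ae : ∀ᵐ t ∂(volume.restrict (Ioo 0 T)), MemLp (fun x => (u t x : ℂ)) 2 volume ∧
    eLpNorm (u t) 2 volume ≤ C ∧
    (fun ξ => U (t, ξ)) =ᵐ[volume] fourierL2 (fun x => (u t x : ℂ)) ∧
    ∀ ξ, G (t, ξ) = 𝓕 (fun x => ((u t x * u t x : ℝ) : ℂ)) ξ

theorem IsWeakSolution.exists_hasSpectrum {T : ℝ} {u₀ : ℝ → ℝ} {u : ℝ → ℝ → ℝ}
    (hu : IsWeakSolution (Ico 0 T) u₀ u) : ∃ U G C, HasSpectrum T u U G C := by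
  obtain ⟨C, hC⟩ := hu.memLinftyL2.exists_ae_le
  have hm := hu.measurable
  have hmt : ∀ᵐ t ∂(volume.restrict (Ico 0 T)), AEStronglyMeasurable (u t) volume := hm.prodMk_left
  obtain ⟨v, hv, huv⟩ := hm
  have huv' := Measure.ae_ae_of_ae_prod huv
  have hvc : StronglyMeasurable (fun p => (v p : ℂ)) :=
    Complex.continuous_ofReal.comp_stronglyMeasurable hv
  obtain ⟨U, hU, hUv⟩ := exists_stronglyMeasurable_fourierL2 hvc
  -- As u² is in L¹, its transform is an honest integral: measurability follows from Fubini, and the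
  -- identity holds at every ξ rather than almost every one.
  let G : ℝ × ℝ → ℂ := fun p => ∫ x, char p.2 x * ((v (p.1, x) * v (p.1, x) : ℝ) : ℂ)
  have hG : StronglyMeasurable G := by
    apply StronglyMeasurable.integral_prod_right
      (f := fun (p : ℝ × ℝ) x => char p.2 x * ((v (p.1, x) * v (p.1, x) : ℝ) : ℂ))
    apply StronglyMeasurable.mul
    · exact (continuous_char.comp
        (by fun_prop : Continuous fun r : (ℝ × ℝ) × ℝ => (r.1.2, r.2))).stronglyMeasurable
    · have : StronglyMeasurable fun r : (ℝ × ℝ) × ℝ => v (r.1.1, r.2) :=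
        hv.comp_measurable (by fun_prop)
      exact Complex.continuous_ofReal.comp_stronglyMeasurable (this.mul this)
  refine ⟨U, G, C, hU, hG, ?_⟩
  apply ae_restrict_of_ae_restrict_of_subset Ioo_subset_Ico_self
  filter_upwards [hC, hmt, huv'] with t h1 h2 h3
  have h3' : (fun x => (u t x : ℂ)) =ᵐ[volume] fun x => (v (t, x) : ℂ) := by
    filter_upwards [h3] with x hx
    rw [← hx]; rfl
  have h4 : MemLp (fun x => (u t x : ℂ)) 2 volume :=
    memLp_ofReal_iff.2 ⟨h2, h1.trans_lt ENNReal.coe_lt_top⟩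
  refine ⟨h4, h1, ?_, ?_⟩
  · rw [fourierL2_congr h4 h3']
    exact hUv t (h4.ae_eq h3')
  · intro ξ
    rw [fourier_eq_integral_char]
    apply integral_congr_ae
    filter_upwards [h3] with x hx
    rw [← hx]; rfl

end Whitham

/-! ### The integrated equation at almost every frequency -/

namespace Whitham

open scoped SchwartzMap ContDiff ComplexConjugate NNReal
open Filter Topology

theorem stronglyMeasurable_fourierL2 (f : ℝ → ℂ) : StronglyMeasurable (fourierL2 f) := by
  by_cases h : MemLp f 2 volume
  · rw [fourierL2_of_memLp h]; exact Lp.stronglyMeasurable _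
  · have : fourierL2 f = 0 := by simp [fourierL2, h]
    rw [this]; exact stronglyMeasurable_zero

/-- The transform of a single test function may vanish somewhere. That of a bump is nonzero near 0,
having positive integral there, and concentrating the bump by n+1 replaces ξ by ξ/(n+1) → 0. -/
theorem exists_test_fourier_ne_zero : ∃ χ : ℕ → ℝ → ℝ,
    (∀ n, ContDiff ℝ ∞ (χ n) ∧ HasCompactSupport (χ n)) ∧
      ∀ ξ, ∃ n, 𝓕 (fun x => (χ n x : ℂ)) ξ ≠ 0 := by
  let φ : ContDiffBump (0 : ℝ) := ⟨1, 2, by norm_num, by norm_num⟩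
  refine ⟨fun n x => φ (((n : ℝ) + 1) * x), fun n => ⟨?_, ?_⟩, fun ξ => ?_⟩
  · exact φ.contDiff.comp (by fun_prop)
  · exact φ.hasCompactSupport.comp_homeomorph
      (Homeomorph.mulLeft₀ ((n : ℝ) + 1) (by positivity))
  · have hc := memLp_test φ.contDiff φ.hasCompactSupport
    have hcont := continuous_fourier_of_integrable hc.2
    have h0 : 𝓕 (fun x => (φ x : ℂ)) 0 ≠ 0 := by
      rw [fourier_eq_integral_char]
      have : ∀ x, char 0 x * (φ x : ℂ) = (φ x : ℂ) := fun x => by simp [char]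
      simp only [this]
      rw [integral_complex_ofReal]
      exact_mod_cast φ.integral_pos.ne'
    have hlim : Tendsto (fun n : ℕ => 𝓕 (fun x => (φ x : ℂ)) (ξ * (1 / ((n : ℝ) + 1)))) atTop
        (𝓝 (𝓕 (fun x => (φ x : ℂ)) 0)) := by
      have h1 : Tendsto (fun n : ℕ => ξ * (1 / ((n : ℝ) + 1))) atTop (𝓝 0) := by
        simpa using (tendsto_one_div_add_atTop_nhds_zero_nat (𝕜 := ℝ)).const_mul ξ
      exact (hcont.tendsto 0).comp h1
    obtain ⟨n, hn⟩ := (hlim.eventually_ne h0).exists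
    refine ⟨n, ?_⟩
    have hp : (0 : ℝ) < (n : ℝ) + 1 := by positivity
    have : 𝓕 (fun x => ((φ (((n : ℝ) + 1) * x) : ℝ) : ℂ)) ξ =
        |((n : ℝ) + 1)⁻¹| • 𝓕 (fun x => (φ x : ℂ)) (ξ * (1 / ((n : ℝ) + 1))) := by
      rw [fourier_eq_integral_char, fourier_eq_integral_char, ← Measure.integral_comp_mul_left]
      congr 1; ext x
      congr 1
      unfold char
      congr 2
      field_simp
    rw [this]
    exact smul_ne_zero (by positivity) hn

/-- The Fourier transform of the right-hand side of the equation. -/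
noncomputable def rhs (U G : ℝ × ℝ → ℂ) (s ξ : ℝ) : ℂ :=
  -(freqA ξ : ℂ) * U (s, ξ) + Real.pi * Complex.I * ξ * G (s, ξ)

theorem eLpNorm_two_sq {α E : Type*} [MeasurableSpace α] {μ : Measure α} [NormedAddCommGroup E]
    (f : α → E) : eLpNorm f 2 μ ^ 2 = ∫⁻ x, ‖f x‖ₑ ^ 2 ∂μ := by
  rw [eLpNorm_eq_lintegral_rpow_enorm_toReal (by norm_num) (by norm_num)]
  simp only [ENNReal.toReal_ofNat, ENNReal.rpow_ofNat]
  rw [← ENNReal.rpow_natCast, ← ENNReal.rpow_mul]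
  norm_num

variable {T : ℝ} {u : ℝ → ℝ → ℝ} {U G : ℝ × ℝ → ℂ} {C : ℝ≥0}

theorem HasSpectrum.stronglyMeasurable_rhs (h : HasSpectrum T u U G C) :
    StronglyMeasurable (fun p : ℝ × ℝ => rhs U G p.1 p.2) := by
  unfold rhs
  have h1 : StronglyMeasurable (fun p : ℝ × ℝ => -(freqA p.2 : ℂ)) :=
    ((Complex.continuous_ofReal.comp (continuous_freqA.comp continuous_snd)).neg).stronglyMeasurable
  have h2 : StronglyMeasurable (fun p : ℝ × ℝ => (Real.pi : ℂ) * Complex.I * (p.2 : ℂ)) :=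
    Continuous.stronglyMeasurable (by fun_prop)
  exact (h1.mul h.measU).add (h2.mul h.measG)

theorem HasSpectrum.ae_enorm_G_le (h : HasSpectrum T u U G C) :
    ∀ᵐ t ∂(volume.restrict (Ioo 0 T)), ∀ ξ, ‖G (t, ξ)‖ₑ ≤ (C : ℝ≥0∞) * C := by
  filter_upwards [h.ae] with t ⟨h1, h2, _, h4⟩ ξ
  rw [h4, fourier_eq_integral_char]
  refine (enorm_integral_le_lintegral_enorm _).trans ?_
  have h1' := memLp_ofReal_iff.1 h1
  have : ∀ x, ‖char ξ x * ((u t x * u t x : ℝ) : ℂ)‖ₑ = ‖u t x‖ₑ * ‖u t x‖ₑ := by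
    intro x
    rw [enorm_mul, enorm_char, one_mul, ← enorm_mul, ← ofReal_norm, ← ofReal_norm,
      Complex.norm_real]
  simp only [this]
  refine (lintegral_enorm_mul_enorm_le h1'.1 h1'.1).trans ?_
  gcongr

theorem HasSpectrum.ae_eLpNorm_U_le (h : HasSpectrum T u U G C) :
    ∀ᵐ t ∂(volume.restrict (Ioo 0 T)), MemLp (fun ξ => U (t, ξ)) 2 volume ∧
      eLpNorm (fun ξ => U (t, ξ)) 2 volume ≤ C := by
  filter_upwards [h.ae] with t ⟨h1, h2, h3, _⟩
  refine ⟨(memLp_fourierL2 _).ae_eq h3.symm, ?_⟩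
  rw [eLpNorm_congr_ae h3, eLpNorm_fourierL2 h1, eLpNorm_ofReal]
  exact h2

section
variable {χ : ℝ → ℝ} (hχ : ContDiff ℝ ∞ χ) (hc : HasCompactSupport χ)
include hχ hc

/-- The absolute integrability needed for Fubini. Both growing factors, a and ξ, go onto the rapidly
decaying transform of χ, leaving U bounded in L² and G bounded pointwise. -/
theorem HasSpectrum.integrable_test_mul_rhs (h : HasSpectrum T u U G C) :
    Integrable (fun p : ℝ × ℝ => conj (𝓕 (fun x => (χ x : ℂ)) p.2) * rhs U G p.1 p.2)
      ((volume.restrict (Ioo 0 T)).prod volume) := by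
  have hF := memLp_freqA_mul_fourier hχ hc
  have hX := integrable_mul_fourier_test hχ hc
  have hcont : Continuous (𝓕 (fun x => (χ x : ℂ))) :=
    continuous_fourier_of_integrable (memLp_test hχ hc).2
  have hm : StronglyMeasurable
      (fun p : ℝ × ℝ => conj (𝓕 (fun x => (χ x : ℂ)) p.2) * rhs U G p.1 p.2) :=
    (Complex.continuous_conj.comp (hcont.comp continuous_snd)).stronglyMeasurable.mul
      h.stronglyMeasurable_rhs
  refine ⟨hm.aestronglyMeasurable, ?_⟩
  unfold HasFiniteIntegral
  rw [lintegral_prod _ hm.aestronglyMeasurable.enorm]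
  set M : ℝ≥0∞ := eLpNorm (fun ξ => (freqA ξ : ℂ) * 𝓕 (fun x => (χ x : ℂ)) ξ) 2 volume * C +
    ENNReal.ofReal Real.pi * (C * C) * ∫⁻ ξ : ℝ, ‖(ξ : ℂ) * 𝓕 (fun x => (χ x : ℂ)) ξ‖ₑ
  have hM : M < ⊤ := by
    refine ENNReal.add_lt_top.2 ⟨ENNReal.mul_lt_top hF.2.2 ENNReal.coe_lt_top, ?_⟩
    exact ENNReal.mul_lt_top (ENNReal.mul_lt_top ENNReal.ofReal_lt_top
      (ENNReal.mul_lt_top ENNReal.coe_lt_top ENNReal.coe_lt_top)) hX.2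
  calc _ ≤ ∫⁻ _ in Ioo 0 T, M := by
        apply lintegral_mono_ae
        filter_upwards [h.ae_enorm_G_le, h.ae_eLpNorm_U_le] with t hG hU
        calc ∫⁻ ξ, ‖conj (𝓕 (fun x => (χ x : ℂ)) ξ) * rhs U G t ξ‖ₑ
            ≤ ∫⁻ ξ : ℝ, (‖(freqA ξ : ℂ) * 𝓕 (fun x => (χ x : ℂ)) ξ‖ₑ * ‖U (t, ξ)‖ₑ +
              ENNReal.ofReal Real.pi * (C * C) * ‖(ξ : ℂ) * 𝓕 (fun x => (χ x : ℂ)) ξ‖ₑ) := by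
              apply lintegral_mono
              intro ξ
              have hconj : ‖conj (𝓕 (fun x => (χ x : ℂ)) ξ)‖ₑ = ‖𝓕 (fun x => (χ x : ℂ)) ξ‖ₑ := by
                rw [← ofReal_norm, ← ofReal_norm, RCLike.norm_conj]
              have hpi : ‖(Real.pi : ℂ)‖ₑ = ENNReal.ofReal Real.pi := by
                rw [← ofReal_norm, Complex.norm_real, Real.norm_of_nonneg Real.pi_pos.le]
              have hI : ‖Complex.I‖ₑ = 1 := by rw [← ofReal_norm]; simp
              simp only [rhs]
              rw [enorm_mul, hconj]
              calc _ ≤ ‖𝓕 (fun x => (χ x : ℂ)) ξ‖ₑ * (‖-(freqA ξ : ℂ) * U (t, ξ)‖ₑ +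
                    ‖Real.pi * Complex.I * ξ * G (t, ξ)‖ₑ) := by
                    gcongr; exact enorm_add_le _ _
                _ ≤ ‖𝓕 (fun x => (χ x : ℂ)) ξ‖ₑ * (‖(freqA ξ : ℂ)‖ₑ * ‖U (t, ξ)‖ₑ +
                    ENNReal.ofReal Real.pi * ‖(ξ : ℂ)‖ₑ * (C * C)) := by
                    rw [enorm_mul, enorm_neg, enorm_mul, enorm_mul, enorm_mul, hpi, hI, mul_one]
                    gcongr; exact hG ξ
                _ = _ := by rw [enorm_mul, enorm_mul]; ring
          _ ≤ M := by
              rw [lintegral_add_right' _ (hX.1.enorm.const_mul _),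
                lintegral_const_mul'' _ hX.1.enorm]
              refine add_le_add ?_ le_rfl
              refine (lintegral_enorm_mul_enorm_le hF.2.1 hU.1.1).trans ?_
              gcongr; exact hU.2
    _ < ⊤ := by
        rw [lintegral_const]
        exact ENNReal.mul_lt_top hM (measure_lt_top _ _)

theorem HasSpectrum.tested_rhs (h : HasSpectrum T u U G C) :
    ∀ᵐ s ∂(volume.restrict (Ioo 0 T)),
      ((-(∫ x, u s x * opA χ x) - (∫ x, u s x * u s x * deriv χ x) / 2 : ℝ) : ℂ) =
        ∫ ξ, conj (𝓕 (fun x => (χ x : ℂ)) ξ) * rhs U G s ξ := by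
  have hF := memLp_freqA_mul_fourier hχ hc
  have hX := integrable_mul_fourier_test hχ hc
  filter_upwards [h.ae, h.ae_enorm_G_le, h.ae_eLpNorm_U_le] with s ⟨h1, h2, h3, h4⟩ hG hU
  have h1' := memLp_ofReal_iff.1 h1
  have hsq : Integrable (fun x => ((u s x * u s x : ℝ) : ℂ)) volume :=
    (h1'.integrable_mul h1').ofReal
  have e1 := integral_mul_opA hχ hc h1
  have e2 := integral_mul_deriv_test hχ hc hsq
  push_cast
  push_cast at e1 e2
  rw [e1, e2]
  have e1' : ∫ ξ, conj (𝓕 (fun x => (χ x : ℂ)) ξ) * (freqA ξ * fourierL2 (fun x => (u s x : ℂ)) ξ) =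
      ∫ ξ, conj (𝓕 (fun x => (χ x : ℂ)) ξ) * (freqA ξ * U (s, ξ)) := by
    apply integral_congr_ae
    filter_upwards [h3] with ξ hξ
    rw [hξ]
  have i1 : Integrable (fun ξ => conj (𝓕 (fun x => (χ x : ℂ)) ξ) * (freqA ξ * U (s, ξ))) volume := by
    have := hF.2.star.integrable_mul hU.1
    refine this.congr (Eventually.of_forall fun ξ => ?_)
    simp only [Pi.mul_apply, Pi.star_apply, RCLike.star_def, map_mul, Complex.conj_ofReal]
    ring
  have hGc : Continuous (fun ξ => G (s, ξ)) := by
    have : (fun ξ => G (s, ξ)) = 𝓕 (fun x => ((u s x * u s x : ℝ) : ℂ)) := funext h4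
    rw [this]; exact continuous_fourier_of_integrable hsq
  have i2 : Integrable (fun ξ : ℝ => conj (𝓕 (fun x => (χ x : ℂ)) ξ) *
      (-(2 * Real.pi * Complex.I * ξ) * G (s, ξ))) volume := by
    have hX' : Integrable (fun ξ : ℝ => conj ((ξ : ℂ) * 𝓕 (fun x => (χ x : ℂ)) ξ)) volume :=
      (Complex.conjLIE.toContinuousLinearEquiv.toContinuousLinearMap).integrable_comp hX
    have := (hX'.mul_bdd (g := fun ξ => G (s, ξ)) (c := (C * C : ℝ)) hGc.aestronglyMeasurable
      (Eventually.of_forall fun ξ => ?_)).const_mul (-(2 * Real.pi * Complex.I))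
    · refine this.congr (Eventually.of_forall fun ξ => ?_)
      simp only [map_mul, Complex.conj_ofReal]
      ring
    · have := hG ξ
      rw [← ofReal_norm, ← ENNReal.coe_mul] at this
      have h5 := ENNReal.toReal_mono ENNReal.coe_ne_top this
      rwa [ENNReal.toReal_ofReal (norm_nonneg _), ENNReal.coe_toReal, NNReal.coe_mul] at h5
  have e2' : ∫ ξ : ℝ, conj (𝓕 (fun x => (χ x : ℂ)) ξ) * (-(2 * Real.pi * Complex.I * ξ) *
      𝓕 (fun x => ((u s x : ℂ) * (u s x : ℂ))) ξ) =
      ∫ ξ : ℝ, conj (𝓕 (fun x => (χ x : ℂ)) ξ) * (-(2 * Real.pi * Complex.I * ξ) * G (s, ξ)) := by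
    congr 1; ext ξ
    rw [h4]; push_cast; rfl
  have i1n : Integrable (fun ξ => -(conj (𝓕 (fun x => (χ x : ℂ)) ξ) *
      (freqA ξ * U (s, ξ)))) volume := i1.neg
  rw [e1', e2', ← integral_neg, ← integral_div, ← integral_sub i1n (i2.div_const 2)]
  congr 1; ext ξ
  simp only [rhs]
  ring

/-- Fubini moves the time integral inside the frequency pairing, so the defect of the integrated
equation pairs to zero with χ. Integrability is recorded because the defect times the transform of χ
will itself be Fourier transformed. -/
theorem HasSpectrum.tested_eq (h : HasSpectrum T u U G C) (hT : 0 < T) {u₀ : ℝ → ℝ}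
    (hu₀ : MemLp (fun x => (u₀ x : ℂ)) 2 volume) (hu : IsWeakSolution (Ico 0 T) u₀ u) :
    ∀ᵐ t ∂(volume.restrict (Ioo 0 T)),
      ∫ ξ, conj (𝓕 (fun x => (χ x : ℂ)) ξ) * (U (t, ξ) - fourierL2 (fun x => (u₀ x : ℂ)) ξ -
        ∫ s in (0)..t, rhs U G s ξ) = 0 ∧
      Integrable (fun ξ => conj (𝓕 (fun x => (χ x : ℂ)) ξ) *
        (U (t, ξ) - fourierL2 (fun x => (u₀ x : ℂ)) ξ - ∫ s in (0)..t, rhs U G s ξ)) volume := by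
  have hint := h.integrable_test_mul_rhs hχ hc
  have hrhs := h.tested_rhs hχ hc
  filter_upwards [hu.integral_mul_test_eq hT hχ hc, h.ae, h.ae_eLpNorm_U_le,
    ae_restrict_mem measurableSet_Ioo] with t ht ⟨h1, _, h3, _⟩ hU htT
  have sub : Ioc 0 t ⊆ Ioo 0 T := fun s hs => ⟨hs.1, hs.2.trans_lt htT.2⟩
  have hint' : Integrable (fun p : ℝ × ℝ => conj (𝓕 (fun x => (χ x : ℂ)) p.2) * rhs U G p.1 p.2)
      ((volume.restrict (Ioc 0 t)).prod volume) :=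
    hint.mono_measure (Measure.prod_mono (Measure.restrict_mono sub le_rfl) le_rfl)
  have hχ2 := (memLp_fourier_test hχ hc).2
  have i1 : Integrable (fun ξ => conj (𝓕 (fun x => (χ x : ℂ)) ξ) * U (t, ξ)) volume :=
    hχ2.star.integrable_mul hU.1
  have i0 : Integrable (fun ξ => conj (𝓕 (fun x => (χ x : ℂ)) ξ) *
      fourierL2 (fun x => (u₀ x : ℂ)) ξ) volume :=
    hχ2.star.integrable_mul (memLp_fourierL2 _)
  have eP : ∀ ξ, conj (𝓕 (fun x => (χ x : ℂ)) ξ) * ∫ s in (0)..t, rhs U G s ξ =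
      ∫ s in Ioc 0 t, conj (𝓕 (fun x => (χ x : ℂ)) ξ) * rhs U G s ξ := by
    intro ξ
    rw [intervalIntegral.integral_of_le htT.1.le, integral_const_mul]
  have iP : Integrable (fun ξ => conj (𝓕 (fun x => (χ x : ℂ)) ξ) *
      ∫ s in (0)..t, rhs U G s ξ) volume := by
    simp only [eP]
    exact hint'.integral_prod_right
  have i01 : Integrable (fun ξ => conj (𝓕 (fun x => (χ x : ℂ)) ξ) * U (t, ξ) -
      conj (𝓕 (fun x => (χ x : ℂ)) ξ) * fourierL2 (fun x => (u₀ x : ℂ)) ξ) volume := i1.sub i0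
  simp only [mul_sub]
  refine ⟨?_, i01.sub iP⟩
  rw [integral_sub i01 iP, integral_sub i1 i0]
  have e1 : ∫ ξ, conj (𝓕 (fun x => (χ x : ℂ)) ξ) * U (t, ξ) = ((∫ x, u t x * χ x : ℝ) : ℂ) := by
    rw [integral_mul_test hχ hc h1]
    apply integral_congr_ae
    filter_upwards [h3] with ξ hξ
    rw [hξ]
  have e2 : ∫ ξ, conj (𝓕 (fun x => (χ x : ℂ)) ξ) * (∫ s in (0)..t, rhs U G s ξ) =
      ((∫ s in (0)..t, (-(∫ x, u s x * opA χ x) - (∫ x, u s x * u s x * deriv χ x) / 2) : ℝ) : ℂ) := by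
    simp only [eP]
    rw [← integral_integral_swap hint', ← intervalIntegral.integral_ofReal,
      intervalIntegral.integral_of_le htT.1.le]
    apply integral_congr_ae
    filter_upwards [ae_restrict_of_ae_restrict_of_subset sub hrhs] with s hs
    rw [hs]
  rw [e1, e2, ← integral_mul_test hχ hc hu₀, ht]
  push_cast; ring

end

/-- The null set of times depends on the test function, so only countably many may be used.
Translating χₙ by rationals shows that the transform of the defect times conj(χ̂ₙ) vanishes at all
rationals, hence everywhere by continuity; the product is then zero a.e. Since the χ̂ₙ have no
common zero, the defect vanishes. -/
theorem HasSpectrum.integral_eq (h : HasSpectrum T u U G C) (hT : 0 < T) {u₀ : ℝ → ℝ}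
    (hu₀ : MemLp (fun x => (u₀ x : ℂ)) 2 volume) (hu : IsWeakSolution (Ico 0 T) u₀ u) :
    ∀ᵐ t ∂(volume.restrict (Ioo 0 T)), ∀ᵐ ξ : ℝ,
      U (t, ξ) = fourierL2 (fun x => (u₀ x : ℂ)) ξ + ∫ s in (0)..t, rhs U G s ξ := by
  obtain ⟨χ, hχ, hne⟩ := exists_test_fourier_ne_zero
  have key : ∀ n, ∀ᵐ t ∂(volume.restrict (Ioo 0 T)), ∀ᵐ ξ : ℝ,
      conj (𝓕 (fun x => (χ n x : ℂ)) ξ) * (U (t, ξ) - fourierL2 (fun x => (u₀ x : ℂ)) ξ -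
        ∫ s in (0)..t, rhs U G s ξ) = 0 := by
    intro n
    obtain ⟨hs, hcs⟩ := hχ n
    have hy : ∀ᵐ t ∂(volume.restrict (Ioo 0 T)), ∀ y : ℚ,
        ∫ ξ, conj (𝓕 (fun x => (χ n (x - y) : ℂ)) ξ) *
          (U (t, ξ) - fourierL2 (fun x => (u₀ x : ℂ)) ξ - ∫ s in (0)..t, rhs U G s ξ) = 0 := by
      rw [ae_all_iff]
      intro y
      have h1 : ContDiff ℝ ∞ (fun x => χ n (x - y)) := hs.comp (by fun_prop)
      have h2 : HasCompactSupport (fun x => χ n (x - y)) :=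
        hcs.comp_homeomorph (Homeomorph.subRight (y : ℝ))
      filter_upwards [h.tested_eq h1 h2 hT hu₀ hu] with t ht using ht.1
    filter_upwards [hy, h.tested_eq hs hcs hT hu₀ hu] with t h1 h2
    apply ae_eq_zero_of_fourier_eq_zero h2.2
    have hcont := continuous_fourier_of_integrable h2.2
    have hz : ∀ y : ℚ, 𝓕 (fun ξ => conj (𝓕 (fun x => (χ n x : ℂ)) ξ) *
        (U (t, ξ) - fourierL2 (fun x => (u₀ x : ℂ)) ξ - ∫ s in (0)..t, rhs U G s ξ)) (y : ℝ) = 0 := by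
      intro y
      -- The sign changes because the character of the translate appears conjugated.
      have := h1 (-y)
      rw [fourier_eq_integral_char, ← this]
      congr 1; ext ξ
      rw [fourier_translate (fun x => (χ n x : ℂ)), map_mul, conj_char, mul_assoc]
      congr 1
      unfold char; push_cast; congr 1; ring
    have : 𝓕 (fun ξ => conj (𝓕 (fun x => (χ n x : ℂ)) ξ) *
        (U (t, ξ) - fourierL2 (fun x => (u₀ x : ℂ)) ξ - ∫ s in (0)..t, rhs U G s ξ)) = 0 :=
      hcont.ext_on Rat.denseRange_cast continuous_zero (by rintro _ ⟨y, rfl⟩; exact hz y)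
    exact fun ξ => congrFun this ξ
  filter_upwards [ae_all_iff.2 key] with t ht
  filter_upwards [ae_all_iff.2 ht] with ξ hξ
  obtain ⟨n, hn⟩ := hne ξ
  have h1 := (mul_eq_zero.1 (hξ n)).resolve_left (by simpa using hn)
  linear_combination h1

end Whitham

/-! ### Duhamel's formula and restriction to bounded time intervals -/

namespace Whitham

open scoped NNReal
open Filter Topology

theorem stronglyMeasurable_integral_from_zero {K : ℝ × ℝ → ℝ → ℂ}
    (hK : StronglyMeasurable (Function.uncurry K)) :
    StronglyMeasurable (fun p : ℝ × ℝ => ∫ s in (0)..p.1, K p s) := by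
  have h : ∀ A : Set ((ℝ × ℝ) × ℝ), MeasurableSet A →
      StronglyMeasurable (fun p : ℝ × ℝ => ∫ s, A.indicator (Function.uncurry K) (p, s)) :=
    fun A hA => (hK.indicator hA).integral_prod_right'
  have h1 := h {q | 0 < q.2 ∧ q.2 ≤ q.1.1}
    ((measurableSet_lt measurable_const measurable_snd).inter
      (measurableSet_le measurable_snd (measurable_fst.comp measurable_fst)))
  have h2 := h {q | q.1.1 < q.2 ∧ q.2 ≤ 0}
    ((measurableSet_lt (measurable_fst.comp measurable_fst) measurable_snd).inter
      (measurableSet_le measurable_snd measurable_const))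
  convert h1.sub h2 using 1
  ext p
  simp only [intervalIntegral, Pi.sub_apply]
  rw [← integral_indicator measurableSet_Ioc, ← integral_indicator measurableSet_Ioc]
  rfl

variable {T : ℝ} {u : ℝ → ℝ → ℝ} {U G : ℝ × ℝ → ℂ} {C : ℝ≥0}

theorem HasSpectrum.lintegral_U_sq_le (h : HasSpectrum T u U G C) :
    ∀ᵐ t ∂(volume.restrict (Ioo 0 T)), ∫⁻ ξ, ‖U (t, ξ)‖ₑ ^ 2 ≤ (C : ℝ≥0∞) ^ 2 := by
  filter_upwards [h.ae_eLpNorm_U_le] with t ht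
  rw [← eLpNorm_two_sq]
  gcongr
  exact ht.2

/-- By Tonelli, the uniform L² bound in ξ gives square integrability in time for a.e. ξ, and the
interval is bounded. -/
theorem HasSpectrum.ae_integrableOn_U (h : HasSpectrum T u U G C) :
    ∀ᵐ ξ : ℝ, IntegrableOn (fun t => U (t, ξ)) (Ioo 0 T) volume := by
  have hm : Measurable (fun p : ℝ × ℝ => ‖U p‖ₑ ^ 2) := h.measU.enorm.pow_const 2
  have h1 : ∫⁻ ξ, ∫⁻ t in Ioo 0 T, ‖U (t, ξ)‖ₑ ^ 2 < ⊤ := by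
    rw [← lintegral_lintegral_swap (f := fun t ξ => ‖U (t, ξ)‖ₑ ^ 2) hm.aemeasurable]
    calc _ ≤ ∫⁻ _ in Ioo 0 T, (C : ℝ≥0∞) ^ 2 := lintegral_mono_ae h.lintegral_U_sq_le
      _ < ⊤ := by
        rw [lintegral_const]
        exact ENNReal.mul_lt_top (ENNReal.pow_lt_top ENNReal.coe_lt_top) (measure_lt_top _ _)
  have h2 : Measurable (fun ξ => ∫⁻ t in Ioo 0 T, ‖U (t, ξ)‖ₑ ^ 2) :=
    Measurable.lintegral_prod_left' hm
  filter_upwards [ae_lt_top h2 h1.ne] with ξ hξ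
  have hsm : StronglyMeasurable (fun t => U (t, ξ)) :=
    h.measU.comp_measurable (by fun_prop : Measurable fun t : ℝ => (t, ξ))
  have : MemLp (fun t => U (t, ξ)) 2 (volume.restrict (Ioo 0 T)) := by
    refine ⟨hsm.aestronglyMeasurable, ?_⟩
    have := eLpNorm_two_sq (μ := volume.restrict (Ioo 0 T)) (fun t => U (t, ξ))
    rw [← this] at hξ
    by_contra hcon
    rw [not_lt, top_le_iff] at hcon
    rw [hcon] at hξ
    simp at hξ
  exact this.integrable (by norm_num)

theorem HasSpectrum.integrableOn_G (h : HasSpectrum T u U G C) (ξ : ℝ) :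
    IntegrableOn (fun t => G (t, ξ)) (Ioo 0 T) volume := by
  have hsm : StronglyMeasurable (fun t => G (t, ξ)) :=
    h.measG.comp_measurable (by fun_prop : Measurable fun t : ℝ => (t, ξ))
  apply integrable_of_ae_enorm_le hsm.aestronglyMeasurable
    (M := (C : ℝ≥0∞) * C) (ENNReal.mul_lt_top ENNReal.coe_lt_top ENNReal.coe_lt_top)
  filter_upwards [h.ae_enorm_G_le] with t ht using ht ξ

/-- Duhamel's formula on the Fourier side. -/
theorem HasSpectrum.duhamel (h : HasSpectrum T u U G C) (hT : 0 < T) {u₀ : ℝ → ℝ}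
    (hu₀ : MemLp (fun x => (u₀ x : ℂ)) 2 volume) (hu : IsWeakSolution (Ico 0 T) u₀ u) :
    ∀ᵐ t ∂(volume.restrict (Ioo 0 T)), ∀ᵐ ξ : ℝ,
      U (t, ξ) = Real.exp (-(t * freqA ξ)) * fourierL2 (fun x => (u₀ x : ℂ)) ξ +
        ∫ s in (0)..t, (Real.exp (-((t - s) * freqA ξ)) : ℂ) *
          (Real.pi * Complex.I * ξ * G (s, ξ)) := by
  have h0 : StronglyMeasurable (fun p : ℝ × ℝ => fourierL2 (fun x => (u₀ x : ℂ)) p.2) :=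
    (stronglyMeasurable_fourierL2 _).comp_measurable measurable_snd
  have hR : StronglyMeasurable (Function.uncurry fun (p : ℝ × ℝ) s => rhs U G s p.2) :=
    h.stronglyMeasurable_rhs.comp_measurable
      (by fun_prop : Measurable fun q : (ℝ × ℝ) × ℝ => (q.2, q.1.2))
  have hexp : StronglyMeasurable (fun p : ℝ × ℝ => (Real.exp (-(p.1 * freqA p.2)) : ℂ)) := by
    apply Continuous.stronglyMeasurable
    have := continuous_freqA
    fun_prop
  have hE : StronglyMeasurable (Function.uncurry fun (p : ℝ × ℝ) s =>
      (Real.exp (-((p.1 - s) * freqA p.2)) : ℂ) * (Real.pi * Complex.I * p.2 * G (s, p.2))) := by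
    apply StronglyMeasurable.mul
    · exact hexp.comp_measurable
        (by fun_prop : Measurable fun q : (ℝ × ℝ) × ℝ => (q.1.1 - q.2, q.1.2))
    · apply StronglyMeasurable.mul
      · exact Continuous.stronglyMeasurable (by fun_prop)
      · exact h.measG.comp_measurable
          (by fun_prop : Measurable fun q : (ℝ × ℝ) × ℝ => (q.2, q.1.2))
  -- The integrated equation is known for a.e. t and then a.e. ξ, whereas the integrating factor
  -- works at fixed ξ. Swapping the quantifiers, and swapping back afterwards, requires both
  -- equality sets to be measurable.
  have m1 := measurableSet_eq_fun h.measU.measurable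
    (h0.add (stronglyMeasurable_integral_from_zero hR)).measurable
  have m2 := measurableSet_eq_fun h.measU.measurable
    ((hexp.mul h0).add (stronglyMeasurable_integral_from_zero hE)).measurable
  have key := (Measure.ae_ae_comm (p := fun t ξ => U (t, ξ) =
    fourierL2 (fun x => (u₀ x : ℂ)) ξ + ∫ s in (0)..t, rhs U G s ξ) m1).1 (h.integral_eq hT hu₀ hu)
  refine (Measure.ae_ae_comm (p := fun t ξ => U (t, ξ) = Real.exp (-(t * freqA ξ)) *
    fourierL2 (fun x => (u₀ x : ℂ)) ξ + ∫ s in (0)..t, (Real.exp (-((t - s) * freqA ξ)) : ℂ) *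
          (Real.pi * Complex.I * ξ * G (s, ξ))) m2).2 ?_
  filter_upwards [key, h.ae_integrableOn_U] with ξ h1 h2
  exact duhamel_of_integral_eq h2 ((h.integrableOn_G ξ).const_mul _) h1

/-- A test function on [0,T) × ℝ is one on [0,∞) × ℝ, and every term vanishes for t ≥ T. The
nonlocal operator does no harm, as it acts at fixed time on the zero function. -/
theorem IsWeakSolution.restrict {T : ℝ} {u₀ : ℝ → ℝ} {u : ℝ → ℝ → ℝ}
    (hu : IsWeakSolution (Ici 0) u₀ u) : IsWeakSolution (Ico 0 T) u₀ u := by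
  have hsub : Ico 0 T ⊆ Ici (0 : ℝ) := Ico_subset_Ici_self
  have hle := Measure.restrict_mono hsub (le_refl (volume : Measure ℝ))
  refine ⟨hu.measurable.mono_measure (Measure.prod_mono hle le_rfl),
    (eLpNorm_mono_measure _ hle).trans_lt hu.memLinftyL2,
    (eLpNorm_mono_measure _ hle).trans_lt hu.memL2N, fun φ hφ => ?_⟩
  refine Eq.trans ?_ (hu.weak φ ⟨hφ.smooth, hφ.compact, fun p hp h0 => h0⟩)
  congr 1
  symm
  apply setIntegral_eq_of_subset_of_forall_sdiff_eq_zero measurableSet_Ici hsub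
  intro t ht
  have htT : T ≤ t := by
    by_contra hcon
    exact ht.2 ⟨ht.1, not_le.1 hcon⟩
  have hz : ∀ x, (t, x) ∉ tsupport (Function.uncurry φ) := fun x hx =>
    (hφ.support _ hx ht.1).2.not_ge htT
  have hφ0 : φ t = fun _ => 0 := by
    ext x
    exact image_eq_zero_of_notMem_tsupport (f := Function.uncurry φ) (hz x)
  have hder : ∀ x, deriv (fun τ => φ τ x) t = 0 := by
    intro x
    have h1 : Function.uncurry φ =ᶠ[𝓝 (t, x)] 0 := notMem_tsupport_iff_eventuallyEq.1 (hz x)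
    have h2 : Tendsto (fun τ : ℝ => (τ, x)) (𝓝 t) (𝓝 (t, x)) :=
      (Continuous.prodMk_left x).tendsto t
    have h3 : (fun τ => φ τ x) =ᶠ[𝓝 t] fun _ => 0 := h2.eventually h1
    rw [h3.deriv_eq, deriv_const]
  have hop : ∀ x, opA (φ t) x = 0 := by
    intro x
    have := opA_const_mul 0 (fun _ => 0) x
    simp only [mul_zero, zero_mul] at this
    rw [hφ0, this]
  simp only [hder, hop]
  simp [hφ0]

end Whitham

namespace Whitham

open Filter Topology

/-! ### Estimates for the Duhamel integral -/

theorem sq_lintegral_mul_le {α : Type*} [MeasurableSpace α] {μ : Measure α} {f g : α → ℝ≥0∞}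
    (hf : AEMeasurable f μ) (hg : AEMeasurable g μ) :
    (∫⁻ x, f x * g x ∂μ) ^ 2 ≤ (∫⁻ x, f x ^ 2 ∂μ) * ∫⁻ x, g x ^ 2 ∂μ := by
  have h := ENNReal.lintegral_mul_le_Lp_mul_Lq μ Real.HolderConjugate.two_two hf hg
  have h2 := ENNReal.pow_le_pow_left (n := 2) h
  rw [mul_pow, ← ENNReal.rpow_natCast, ← ENNReal.rpow_natCast, ← ENNReal.rpow_natCast,
    ← ENNReal.rpow_mul, ← ENNReal.rpow_mul] at h2
  simpa using h2

theorem lintegral_exp_left_le {a : ℝ} (ha : 0 < a) (t : ℝ) :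
    ∫⁻ s in Iic t, ENNReal.ofReal (Real.exp (-((t - s) * a))) ≤ ENNReal.ofReal a⁻¹ := by
  have e : ∀ s, Real.exp (-((t - s) * a)) = Real.exp (-(t * a)) * Real.exp (a * s) := by
    intro s; rw [← Real.exp_add]; congr 1; ring
  simp only [e]
  rw [← ofReal_integral_eq_lintegral_ofReal ((integrableOn_exp_mul_Iic ha t).const_mul _)
    (Eventually.of_forall fun s => by positivity), integral_const_mul, integral_exp_mul_Iic ha]
  apply ENNReal.ofReal_le_ofReal
  rw [mul_div_assoc', ← Real.exp_add]
  simp [mul_comm a t]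

theorem lintegral_exp_right_le {a : ℝ} (ha : 0 < a) (s : ℝ) :
    ∫⁻ t in Ioi s, ENNReal.ofReal (Real.exp (-((t - s) * a))) ≤ ENNReal.ofReal a⁻¹ := by
  have e : ∀ t, Real.exp (-((t - s) * a)) = Real.exp (s * a) * Real.exp (-a * t) := by
    intro s; rw [← Real.exp_add]; congr 1; ring
  simp only [e]
  rw [← ofReal_integral_eq_lintegral_ofReal
    ((integrableOn_exp_mul_Ioi (neg_lt_zero.2 ha) s).const_mul _)
    (Eventually.of_forall fun s => by positivity), integral_const_mul,
    integral_exp_mul_Ioi (neg_lt_zero.2 ha)]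
  apply ENNReal.ofReal_le_ofReal
  rw [neg_div_neg_eq, mul_div_assoc', ← Real.exp_add]
  simp [mul_comm s a]

/-- Convolution in time with a decaying exponential. -/
noncomputable def expConv (a : ℝ) (q : ℝ → ℝ≥0∞) (t : ℝ) : ℝ≥0∞ :=
  ∫⁻ s in Ioc 0 t, ENNReal.ofReal (Real.exp (-((t - s) * a))) * q s

/-- Cauchy–Schwarz with the exponential split into two equal halves; the total mass of the kernel is
at most 1/a. -/
theorem expConv_sq_le {a : ℝ} (ha : 0 < a) {q : ℝ → ℝ≥0∞} (hq : Measurable q) (t : ℝ) :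
    expConv a q t ^ 2 ≤ ENNReal.ofReal a⁻¹ * expConv a (fun s => q s ^ 2) t := by
  have e : ∀ s, ENNReal.ofReal (Real.exp (-((t - s) * a))) =
      ENNReal.ofReal (Real.exp (-((t - s) * a) / 2)) ^ 2 := by
    intro s
    rw [← ENNReal.ofReal_pow (by positivity), ← Real.exp_nat_mul]
    congr 2; push_cast; ring
  have h := sq_lintegral_mul_le (μ := volume.restrict (Ioc 0 t))
    (f := fun s => ENNReal.ofReal (Real.exp (-((t - s) * a) / 2)))
    (g := fun s => ENNReal.ofReal (Real.exp (-((t - s) * a) / 2)) * q s)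
    (by fun_prop) (by fun_prop)
  unfold expConv
  simp only [mul_pow, ← e] at h
  have e2 : ∀ s, ENNReal.ofReal (Real.exp (-((t - s) * a) / 2)) *
      (ENNReal.ofReal (Real.exp (-((t - s) * a) / 2)) * q s) =
      ENNReal.ofReal (Real.exp (-((t - s) * a))) * q s := by
    intro s; rw [e]; ring
  simp only [e2] at h
  refine h.trans ?_
  gcongr
  exact (lintegral_mono_set (fun s hs => hs.2)).trans (lintegral_exp_left_le ha t)

theorem expConv_le {a : ℝ} (ha : 0 ≤ a) (q : ℝ → ℝ≥0∞) {t T : ℝ} (ht : t < T) :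
    expConv a q t ≤ ∫⁻ s in Ioo 0 T, q s := by
  calc expConv a q t ≤ ∫⁻ s in Ioc 0 t, q s := by
        apply setLIntegral_mono' measurableSet_Ioc
        intro s hs
        calc _ ≤ 1 * q s := by
              gcongr
              rw [← ENNReal.ofReal_one]
              apply ENNReal.ofReal_le_ofReal
              apply Real.exp_le_one_iff.2
              have : 0 ≤ (t - s) * a := mul_nonneg (by linarith [hs.2]) ha
              linarith
          _ = _ := one_mul _
    _ ≤ _ := lintegral_mono_set (show Ioc 0 t ⊆ Ioo 0 T from
        fun s hs => ⟨hs.1, hs.2.trans_lt ht⟩)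

/-- Young's inequality: Tonelli puts the integral in t on the exponential, giving a further factor
1/a. -/
theorem lintegral_expConv_le {a : ℝ} (ha : 0 < a) {q : ℝ → ℝ≥0∞} (hq : Measurable q) (T : ℝ) :
    ∫⁻ t in Ioo 0 T, expConv a q t ≤ ENNReal.ofReal a⁻¹ * ∫⁻ s in Ioo 0 T, q s := by
  let k : ℝ → ℝ → ℝ≥0∞ := fun t s =>
    {p : ℝ × ℝ | p.2 ≤ p.1}.indicator
      (fun p => ENNReal.ofReal (Real.exp (-((p.1 - p.2) * a))) * q p.2) (t, s)
  have hk : Measurable (Function.uncurry k) := by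
    apply Measurable.indicator
    · fun_prop
    · exact measurableSet_le measurable_snd measurable_fst
  have h1 : ∀ t ∈ Ioo 0 T, expConv a q t ≤ ∫⁻ s in Ioo 0 T, k t s := by
    intro t ht
    unfold expConv
    calc _ ≤ ∫⁻ s in Ioc 0 t, k t s := by
          apply setLIntegral_mono' measurableSet_Ioc
          intro s hs
          simp [k, indicator, hs.2]
      _ ≤ _ := lintegral_mono_set (show Ioc 0 t ⊆ Ioo 0 T from
          fun s hs => ⟨hs.1, hs.2.trans_lt ht.2⟩)
  calc _ ≤ ∫⁻ t in Ioo 0 T, ∫⁻ s in Ioo 0 T, k t s := setLIntegral_mono' measurableSet_Ioo h1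
    _ = ∫⁻ s in Ioo 0 T, ∫⁻ t in Ioo 0 T, k t s := lintegral_lintegral_swap hk.aemeasurable
    _ ≤ ∫⁻ s in Ioo 0 T, ENNReal.ofReal a⁻¹ * q s := by
        apply lintegral_mono
        intro s
        calc ∫⁻ t in Ioo 0 T, k t s ≤ ∫⁻ t, k t s := setLIntegral_le_lintegral _ _
          _ = ∫⁻ t in Ici s, ENNReal.ofReal (Real.exp (-((t - s) * a))) * q s := by
              rw [← lintegral_indicator measurableSet_Ici]
              rfl
          _ = (∫⁻ t in Ioi s, ENNReal.ofReal (Real.exp (-((t - s) * a)))) * q s := by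
              rw [lintegral_mul_const _ (by fun_prop), setLIntegral_congr Ioi_ae_eq_Ici.symm]
          _ ≤ _ := mul_le_mul' (lintegral_exp_right_le ha s) le_rfl
    _ = _ := lintegral_const_mul _ hq

/-- The modulus of the Duhamel integral with source `∂ₓ g / 2`, on the Fourier side. -/
noncomputable def duh (g : ℝ × ℝ → ℝ≥0∞) (t ξ : ℝ) : ℝ≥0∞ :=
  expConv (freqA ξ) (fun s => ENNReal.ofReal (Real.pi * |ξ|) * g (s, ξ)) t

theorem freqA_pos {ξ : ℝ} (h : ξ ≠ 0) : 0 < freqA ξ :=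
  (abs_pos.2 h).trans_le (abs_le_freqA ξ)

/-- The balance behind all the exponents: the squared derivative against one factor 1/a ≤ |ξ|^{-3/2}
leaves |ξ|^{1/2}, a loss of a quarter of a derivative. The constant is π² ≤ 10. -/
theorem sq_mul_inv_freqA_le {ξ : ℝ} (h : ξ ≠ 0) :
    (Real.pi * |ξ|) ^ 2 * (freqA ξ)⁻¹ ≤ 10 * |ξ| ^ (1 / 2 : ℝ) := by
  have h0 := abs_pos.2 h
  rw [← div_eq_mul_inv, div_le_iff₀ (freqA_pos h)]
  have h1 := rpow_le_freqA ξ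
  have h2 : |ξ| ^ 2 = |ξ| ^ (1 / 2 : ℝ) * |ξ| ^ (3 / 2 : ℝ) := by
    rw [← Real.rpow_add h0, ← Real.rpow_natCast]; norm_num
  have hpi : Real.pi ^ 2 ≤ 10 := by
    have := Real.pi_lt_d2
    nlinarith [Real.pi_pos]
  calc (Real.pi * |ξ|) ^ 2 = Real.pi ^ 2 * (|ξ| ^ (1 / 2 : ℝ) * |ξ| ^ (3 / 2 : ℝ)) := by
        rw [mul_pow, h2]
    _ ≤ 10 * (|ξ| ^ (1 / 2 : ℝ) * freqA ξ) := by gcongr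
    _ = _ := by ring

variable {g : ℝ × ℝ → ℝ≥0∞}

theorem measurable_section_left (hg : Measurable g) (ξ : ℝ) : Measurable (fun s => g (s, ξ)) :=
  hg.comp (by fun_prop)

theorem ofReal_inv_mul_lintegral_sq_le (hg : Measurable g) {ξ : ℝ} (h : ξ ≠ 0) (T : ℝ) :
    ENNReal.ofReal (freqA ξ)⁻¹ *
      (∫⁻ s in Ioo 0 T, (ENNReal.ofReal (Real.pi * |ξ|) * g (s, ξ)) ^ 2) ≤
      10 * (ENNReal.ofReal (|ξ| ^ (1 / 2 : ℝ)) * ∫⁻ s in Ioo 0 T, g (s, ξ) ^ 2) := by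
  have hgm := measurable_section_left hg ξ
  simp only [mul_pow]
  rw [lintegral_const_mul _ (by fun_prop), ← mul_assoc, ← mul_assoc]
  refine mul_le_mul' ?_ le_rfl
  rw [← ENNReal.ofReal_pow (by positivity),
    ← ENNReal.ofReal_mul (inv_nonneg.2 (freqA_nonneg ξ)), mul_comm]
  refine (ENNReal.ofReal_le_ofReal (sq_mul_inv_freqA_le h)).trans ?_
  rw [ENNReal.ofReal_mul (by norm_num)]
  simp

theorem duh_sq_le (hg : Measurable g) {ξ : ℝ} (h : ξ ≠ 0) {t T : ℝ} (ht : t < T) :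
    duh g t ξ ^ 2 ≤ 10 * (ENNReal.ofReal (|ξ| ^ (1 / 2 : ℝ)) * ∫⁻ s in Ioo 0 T, g (s, ξ) ^ 2) := by
  have hgm := measurable_section_left hg ξ
  refine (expConv_sq_le (freqA_pos h) (by fun_prop) t).trans ?_
  refine le_trans ?_ (ofReal_inv_mul_lintegral_sq_le hg h T)
  gcongr
  exact expConv_le (freqA_nonneg ξ) _ ht

/-- Integration in time yields a second factor 1/a, which pays for the weight a on the left; the
right-hand side is the same as in the pointwise bound `duh_sq_le`. -/
theorem lintegral_duh_sq_le (hg : Measurable g) {ξ : ℝ} (h : ξ ≠ 0) (T : ℝ) :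
    ENNReal.ofReal (freqA ξ) * ∫⁻ t in Ioo 0 T, duh g t ξ ^ 2 ≤
      10 * (ENNReal.ofReal (|ξ| ^ (1 / 2 : ℝ)) * ∫⁻ s in Ioo 0 T, g (s, ξ) ^ 2) := by
  have hgm := measurable_section_left hg ξ
  have ha := freqA_pos h
  refine le_trans ?_ (ofReal_inv_mul_lintegral_sq_le hg h T)
  have hq : Measurable fun s => (ENNReal.ofReal (Real.pi * |ξ|) * g (s, ξ)) ^ 2 := by fun_prop
  calc _ ≤ ENNReal.ofReal (freqA ξ) * (ENNReal.ofReal (freqA ξ)⁻¹ * (ENNReal.ofReal (freqA ξ)⁻¹ *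
        ∫⁻ s in Ioo 0 T, (ENNReal.ofReal (Real.pi * |ξ|) * g (s, ξ)) ^ 2)) := by
        gcongr
        calc _ ≤ ∫⁻ t in Ioo 0 T, ENNReal.ofReal (freqA ξ)⁻¹ * expConv (freqA ξ)
              (fun s => (ENNReal.ofReal (Real.pi * |ξ|) * g (s, ξ)) ^ 2) t :=
              lintegral_mono fun t => expConv_sq_le ha (by fun_prop) t
          _ = ENNReal.ofReal (freqA ξ)⁻¹ * ∫⁻ t in Ioo 0 T, expConv (freqA ξ)
              (fun s => (ENNReal.ofReal (Real.pi * |ξ|) * g (s, ξ)) ^ 2) t :=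
              lintegral_const_mul' _ _ ENNReal.ofReal_ne_top
          _ ≤ _ := by gcongr; exact lintegral_expConv_le ha hq T
    _ = _ := by
        rw [← mul_assoc, ← ENNReal.ofReal_mul ha.le, mul_inv_cancel₀ ha.ne']
        simp

theorem measurable_duh (hg : Measurable g) : Measurable (Function.uncurry (duh g)) := by
  have hA := continuous_freqA.measurable
  have hk : Measurable (fun q : (ℝ × ℝ) × ℝ => {q : (ℝ × ℝ) × ℝ | 0 < q.2 ∧ q.2 ≤ q.1.1}.indicator
      (fun q => ENNReal.ofReal (Real.exp (-((q.1.1 - q.2) * freqA q.1.2))) *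
        (ENNReal.ofReal (Real.pi * |q.1.2|) * g (q.2, q.1.2))) q) := by
    apply Measurable.indicator
    · fun_prop
    · exact (measurableSet_lt measurable_const measurable_snd).inter
        (measurableSet_le measurable_snd (measurable_fst.comp measurable_fst))
  have h := hk.lintegral_prod_right' (ν := volume)
  convert h using 1
  ext ⟨t, ξ⟩
  simp only [Function.uncurry, duh, expConv]
  rw [← lintegral_indicator measurableSet_Ioc]
  rfl

theorem ae_ne_zero : ∀ᵐ ξ : ℝ, ξ ≠ 0 := by simp [ae_iff]

variable {w : ℝ → ℝ≥0∞}

/-- The space-time norm of the source that controls the Duhamel integral. -/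
noncomputable def sourceNorm (w : ℝ → ℝ≥0∞) (g : ℝ × ℝ → ℝ≥0∞) (T : ℝ) : ℝ≥0∞ :=
  ∫⁻ s in Ioo 0 T, ∫⁻ ξ, w ξ * (ENNReal.ofReal (|ξ| ^ (1 / 2 : ℝ)) * g (s, ξ) ^ 2)

theorem sourceNorm_eq (hg : Measurable g) (hw : Measurable w) (T : ℝ) : sourceNorm w g T =
    ∫⁻ ξ, w ξ * (ENNReal.ofReal (|ξ| ^ (1 / 2 : ℝ)) * ∫⁻ s in Ioo 0 T, g (s, ξ) ^ 2) := by
  unfold sourceNorm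
  rw [lintegral_lintegral_swap]
  · congr 1; ext ξ
    have hgm := measurable_section_left hg ξ
    rw [lintegral_const_mul _ (by fun_prop), lintegral_const_mul _ (by fun_prop)]
  · apply Measurable.aemeasurable
    have : Measurable fun ξ : ℝ => |ξ| ^ (1 / 2 : ℝ) := by fun_prop
    fun_prop

theorem lintegral_mul_duh_sq_le (hg : Measurable g) (hw : Measurable w) {t T : ℝ} (ht : t < T) :
    ∫⁻ ξ, w ξ * duh g t ξ ^ 2 ≤ 10 * sourceNorm w g T := by
  rw [sourceNorm_eq hg hw, ← lintegral_const_mul' _ _ (by norm_num)]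
  apply lintegral_mono_ae
  filter_upwards [ae_ne_zero] with ξ hξ
  calc _ ≤ w ξ * (10 * (ENNReal.ofReal (|ξ| ^ (1 / 2 : ℝ)) * ∫⁻ s in Ioo 0 T, g (s, ξ) ^ 2)) := by
        exact mul_le_mul' le_rfl (duh_sq_le hg hξ ht)
    _ = _ := by ring

theorem lintegral_lintegral_freqA_mul_duh_sq_le (hg : Measurable g) (hw : Measurable w) (T : ℝ) :
    ∫⁻ t in Ioo 0 T, ∫⁻ ξ, w ξ * (ENNReal.ofReal (freqA ξ) * duh g t ξ ^ 2) ≤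
      10 * sourceNorm w g T := by
  have hd := measurable_duh hg
  have hA := continuous_freqA.measurable
  have hm : Measurable (Function.uncurry fun t ξ => duh g t ξ ^ 2) := hd.pow_const 2
  have hm2 : Measurable (Function.uncurry fun (t : ℝ) ξ =>
      w ξ * (ENNReal.ofReal (freqA ξ) * duh g t ξ ^ 2)) :=
    (hw.comp measurable_snd).mul
      ((ENNReal.measurable_ofReal.comp (hA.comp measurable_snd)).mul hm)
  rw [lintegral_lintegral_swap hm2.aemeasurable, sourceNorm_eq hg hw,
    ← lintegral_const_mul' _ _ (by norm_num)]
  apply lintegral_mono_ae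
  filter_upwards [ae_ne_zero] with ξ hξ
  have hms : Measurable fun t => duh g t ξ ^ 2 := hm.comp (by fun_prop : Measurable fun t : ℝ => (t, ξ))
  rw [lintegral_const_mul _ (hms.const_mul _), lintegral_const_mul _ hms]
  calc _ ≤ w ξ * (10 * (ENNReal.ofReal (|ξ| ^ (1 / 2 : ℝ)) * ∫⁻ s in Ioo 0 T, g (s, ξ) ^ 2)) := by
        exact mul_le_mul' le_rfl (lintegral_duh_sq_le hg hξ T)
    _ = _ := by ring

end Whitham

namespace Whitham

open Filter Topology

/-! ### Weighted bounds for correlations -/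

/-- Inserting v·v⁻¹ and applying Cauchy–Schwarz in η leaves an integral of inverse weights, bounded
by hypothesis, and a double integral that factors by translation invariance. Since v may vanish at
0, homogeneous weights are covered too. -/
theorem lintegral_mul_correlation_sq_le {v w f h : ℝ → ℝ≥0∞} (hv : Measurable v)
    (hf : Measurable f) (hh : Measurable h) (hv0 : ∀ ξ, ξ ≠ 0 → v ξ ≠ 0) (hvt : ∀ ξ, v ξ ≠ ⊤)
    {C : ℝ≥0∞} (hC : C ≠ ⊤)
    (hw : ∀ᵐ ξ : ℝ, w ξ * ∫⁻ η, ((v η * v (η + ξ))⁻¹) ^ 2 ≤ C) :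
    ∫⁻ ξ, w ξ * (∫⁻ η, f η * h (η + ξ)) ^ 2 ≤
      C * ((∫⁻ η, (v η * f η) ^ 2) * ∫⁻ η, (v η * h η) ^ 2) := by
  have hpt : ∀ᵐ ξ : ℝ, w ξ * (∫⁻ η, f η * h (η + ξ)) ^ 2 ≤
      C * ∫⁻ η, (v η * f η) ^ 2 * (v (η + ξ) * h (η + ξ)) ^ 2 := by
    filter_upwards [hw] with ξ hξ
    have h1 : ∫⁻ η, f η * h (η + ξ) =
        ∫⁻ η, ((v η * f η) * (v (η + ξ) * h (η + ξ))) * (v η * v (η + ξ))⁻¹ := by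
      apply lintegral_congr_ae
      have : ∀ᵐ η : ℝ, η ≠ -ξ := by simp [ae_iff]
      filter_upwards [ae_ne_zero, this] with η h0 h1
      have h2 : v η * v (η + ξ) ≠ 0 :=
        mul_ne_zero (hv0 _ h0) (hv0 _ fun h => h1 (eq_neg_of_add_eq_zero_left h))
      have h3 : v η * v (η + ξ) ≠ ⊤ := ENNReal.mul_ne_top (hvt _) (hvt _)
      calc f η * h (η + ξ) = f η * h (η + ξ) * ((v η * v (η + ξ)) * (v η * v (η + ξ))⁻¹) := by
            rw [ENNReal.mul_inv_cancel h2 h3, mul_one]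
        _ = _ := by ring
    have h2 := sq_lintegral_mul_le (μ := volume)
      (f := fun η => (v η * f η) * (v (η + ξ) * h (η + ξ)))
      (g := fun η => (v η * v (η + ξ))⁻¹) (by fun_prop) (by fun_prop)
    rw [h1]
    calc _ ≤ w ξ * ((∫⁻ η, ((v η * f η) * (v (η + ξ) * h (η + ξ))) ^ 2) *
          ∫⁻ η, ((v η * v (η + ξ))⁻¹) ^ 2) := mul_le_mul' le_rfl h2
      _ = (w ξ * ∫⁻ η, ((v η * v (η + ξ))⁻¹) ^ 2) *
          ∫⁻ η, ((v η * f η) * (v (η + ξ) * h (η + ξ))) ^ 2 := by ring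
      _ ≤ C * ∫⁻ η, ((v η * f η) * (v (η + ξ) * h (η + ξ))) ^ 2 := mul_le_mul' hξ le_rfl
      _ = _ := by simp only [mul_pow]
  refine (lintegral_mono_ae hpt).trans (le_of_eq ?_)
  rw [lintegral_const_mul' _ _ hC]
  congr 1
  rw [lintegral_lintegral_swap (Measurable.aemeasurable (by fun_prop))]
  rw [← lintegral_mul_const _ (by fun_prop)]
  congr 1; ext η
  rw [lintegral_const_mul _ (by fun_prop)]
  congr 1
  have := lintegral_add_left_eq_self (μ := volume) (fun ξ => (v ξ * h ξ) ^ 2) η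
  rw [← this]

/-- The weight `(1 + (2πξ)²)^{r/2}`. -/
noncomputable def bessel (r ξ : ℝ) : ℝ≥0∞ :=
  ENNReal.ofReal ((1 + (2 * Real.pi * ξ) ^ 2) ^ (r / 2))

theorem measurable_bessel (r : ℝ) : Measurable (bessel r) := by unfold bessel; fun_prop

theorem bessel_ne_top (r ξ : ℝ) : bessel r ξ ≠ ⊤ := ENNReal.ofReal_ne_top

theorem bessel_ne_zero (r ξ : ℝ) : bessel r ξ ≠ 0 := by
  unfold bessel
  have : 0 < (1 + (2 * Real.pi * ξ) ^ 2) ^ (r / 2) := by positivity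
  simpa using this

theorem bessel_mul (r s ξ : ℝ) : bessel r ξ * bessel s ξ = bessel (r + s) ξ := by
  unfold bessel
  rw [← ENNReal.ofReal_mul (by positivity), ← Real.rpow_add (by positivity)]
  congr 2; ring

theorem bessel_sq (r ξ : ℝ) : bessel r ξ ^ 2 = bessel (2 * r) ξ := by
  rw [sq, bessel_mul, two_mul]

theorem bessel_inv (r ξ : ℝ) : (bessel r ξ)⁻¹ = bessel (-r) ξ := by
  unfold bessel
  rw [← ENNReal.ofReal_inv_of_pos (by positivity), ← Real.rpow_neg (by positivity)]
  congr 2; ring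

theorem bessel_mono {r s : ℝ} (h : r ≤ s) (ξ : ℝ) : bessel r ξ ≤ bessel s ξ := by
  unfold bessel
  apply ENNReal.ofReal_le_ofReal
  apply Real.rpow_le_rpow_of_exponent_le
  · nlinarith [sq_nonneg (2 * Real.pi * ξ)]
  · linarith

theorem lintegral_bessel_lt_top {r : ℝ} (hr : 1 < r) : ∫⁻ ξ, bessel (-r) ξ < ⊤ := by
  have h := integrable_rpow_neg_one_add_norm_sq (E := ℝ) (μ := volume) (r := r) (by simpa using hr)
  have h2 := h.lintegral_lt_top
  refine lt_of_le_of_lt (lintegral_mono fun ξ => ?_) h2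
  unfold bessel
  apply ENNReal.ofReal_le_ofReal
  apply Real.rpow_le_rpow_of_nonpos (by positivity)
  · have h1 : 1 ≤ 2 * Real.pi := by linarith [Real.pi_gt_three]
    rw [Real.norm_eq_abs, sq_abs]
    nlinarith [sq_nonneg ξ, mul_nonneg (sq_nonneg ξ) (by nlinarith : 0 ≤ (2 * Real.pi) ^ 2 - 1)]
  · linarith

/-- As ξ = (η+ξ) - η, the bracket of ξ is at most 2A + 2B ≤ 4 max(A,B), with A and B the brackets of
η and η+ξ. -/
theorem bessel_two_mul_le {r : ℝ} (hr : 0 ≤ r) (η ξ : ℝ) :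
    bessel (2 * r) ξ ≤ ENNReal.ofReal (4 ^ r) * (bessel (2 * r) η + bessel (2 * r) (η + ξ)) := by
  unfold bessel
  rw [← ENNReal.ofReal_add (by positivity) (by positivity), ← ENNReal.ofReal_mul (by positivity)]
  apply ENNReal.ofReal_le_ofReal
  rw [mul_div_cancel_left₀ _ (two_ne_zero)]
  set A := 1 + (2 * Real.pi * η) ^ 2 with hA
  set B := 1 + (2 * Real.pi * (η + ξ)) ^ 2 with hB
  have hA0 : 0 < A := by positivity
  have hB0 : 0 < B := by positivity
  have h1 : 1 + (2 * Real.pi * ξ) ^ 2 ≤ 4 * max A B := by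
    have h2 : 1 + (2 * Real.pi * ξ) ^ 2 ≤ 2 * A + 2 * B := by
      rw [hA, hB]
      nlinarith [sq_nonneg (2 * Real.pi * η + 2 * Real.pi * (η + ξ))]
    linarith [le_max_left A B, le_max_right A B]
  calc (1 + (2 * Real.pi * ξ) ^ 2) ^ r ≤ (4 * max A B) ^ r :=
        Real.rpow_le_rpow (by positivity) h1 hr
    _ = 4 ^ r * (max A B) ^ r := Real.mul_rpow (by norm_num) (by positivity)
    _ ≤ 4 ^ r * (A ^ r + B ^ r) := by
        gcongr
        rcases max_choice A B with h | h <;> rw [h]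
        · have : 0 ≤ B ^ r := by positivity
          linarith
        · have : 0 ≤ A ^ r := by positivity
          linarith

/-- The algebra property of `H^r`, `r > 1/2`, on the Fourier side. -/
theorem exists_lintegral_bessel_correlation_le {r : ℝ} (hr : 1 / 2 < r) :
    ∃ C : ℝ≥0∞, C ≠ ⊤ ∧ ∀ f h : ℝ → ℝ≥0∞, Measurable f → Measurable h →
      ∫⁻ ξ, bessel r ξ ^ 2 * (∫⁻ η, f η * h (η + ξ)) ^ 2 ≤
        C * ((∫⁻ η, (bessel r η * f η) ^ 2) * ∫⁻ η, (bessel r η * h η) ^ 2) := by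
  have hI := lintegral_bessel_lt_top (r := 2 * r) (by linarith)
  set I := ∫⁻ ξ, bessel (-(2 * r)) ξ with hIdef
  have hC : ENNReal.ofReal (4 ^ r) * (I + I) ≠ ⊤ :=
    ENNReal.mul_ne_top ENNReal.ofReal_ne_top (ENNReal.add_ne_top.2 ⟨hI.ne, hI.ne⟩)
  refine ⟨ENNReal.ofReal (4 ^ r) * (I + I), hC, fun f h hf hh => ?_⟩
  apply lintegral_mul_correlation_sq_le (measurable_bessel r) hf hh
    (fun ξ _ => bessel_ne_zero r ξ) (bessel_ne_top r) hC
  refine Eventually.of_forall fun ξ => ?_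
  have hm := measurable_bessel (-(2 * r))
  rw [bessel_sq, ← lintegral_const_mul' _ _ (bessel_ne_top _ _)]
  calc _ ≤ ∫⁻ η, ENNReal.ofReal (4 ^ r) * (bessel (-(2 * r)) (η + ξ) + bessel (-(2 * r)) η) := by
        apply lintegral_mono
        intro η
        have e1 : ((bessel r η * bessel r (η + ξ))⁻¹) ^ 2 =
            bessel (-(2 * r)) η * bessel (-(2 * r)) (η + ξ) := by
          rw [ENNReal.mul_inv (Or.inl (bessel_ne_zero _ _)) (Or.inl (bessel_ne_top _ _)), mul_pow,
            bessel_inv, bessel_inv, bessel_sq, bessel_sq, mul_neg]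
        have c : ∀ z, bessel (2 * r) z * bessel (-(2 * r)) z = 1 := by
          intro z
          rw [bessel_mul, add_neg_cancel]
          simp [bessel]
        simp only [e1]
        calc _ ≤ (ENNReal.ofReal (4 ^ r) * (bessel (2 * r) η + bessel (2 * r) (η + ξ))) *
              (bessel (-(2 * r)) η * bessel (-(2 * r)) (η + ξ)) :=
              mul_le_mul' (bessel_two_mul_le (by linarith) η ξ) le_rfl
          _ = ENNReal.ofReal (4 ^ r) *
              ((bessel (2 * r) η * bessel (-(2 * r)) η) * bessel (-(2 * r)) (η + ξ) +
              (bessel (2 * r) (η + ξ) * bessel (-(2 * r)) (η + ξ)) * bessel (-(2 * r)) η) := by ring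
          _ = _ := by rw [c, c, one_mul, one_mul]
    _ = ENNReal.ofReal (4 ^ r) * (I + I) := by
        rw [lintegral_const_mul _ (by fun_prop), lintegral_add_left (by fun_prop),
          lintegral_add_right_eq_self (fun η => bessel (-(2 * r)) η) ξ]

/-! ### Homogeneous weights -/

theorem lintegral_comp_abs {F : ℝ → ℝ≥0∞} :
    ∫⁻ x, F |x| = 2 * ∫⁻ x in Ioi 0, F x := by
  have h1 : ∫⁻ x, F |x| = (∫⁻ x in Iic 0, F |x|) + ∫⁻ x in Ioi 0, F |x| := by
    have := lintegral_add_compl (μ := volume) (fun x => F |x|) (measurableSet_Iic (a := (0 : ℝ)))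
    rw [compl_Iic] at this
    exact this.symm
  have h2 : ∫⁻ x in Ioi 0, F |x| = ∫⁻ x in Ioi 0, F x :=
    setLIntegral_congr_fun measurableSet_Ioi fun x hx => by simp only [abs_of_pos (mem_Ioi.1 hx)]
  have h3 : ∫⁻ x in Iic 0, F |x| = ∫⁻ x in Ioi 0, F |x| := by
    rw [setLIntegral_congr Iio_ae_eq_Iic.symm]
    have := (Measure.measurePreserving_neg (volume : Measure ℝ)).setLIntegral_comp_emb
      (MeasurableEquiv.neg ℝ).measurableEmbedding (fun x => F |x|) (Iio 0)
    simpa using this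
  rw [h1, h3, h2, two_mul]

theorem lintegral_Ioc_rpow {R : ℝ} (hR : 0 ≤ R) :
    ∫⁻ x in Ioc 0 R, ENNReal.ofReal (x ^ (-(3 / 4) : ℝ)) = ENNReal.ofReal (4 * R ^ (1 / 4 : ℝ)) := by
  have hi : IntervalIntegrable (fun x : ℝ => x ^ (-(3 / 4) : ℝ)) volume 0 R :=
    intervalIntegral.intervalIntegrable_rpow' (by norm_num)
  have hpos : 0 ≤ᵐ[volume.restrict (Ioc 0 R)] fun x : ℝ => x ^ (-(3 / 4) : ℝ) := by
    filter_upwards [ae_restrict_mem measurableSet_Ioc] with x hx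
    exact Real.rpow_nonneg hx.1.le _
  rw [← ofReal_integral_eq_lintegral_ofReal hi.1 hpos, ← intervalIntegral.integral_of_le hR,
    integral_rpow (Or.inl (by norm_num)), show (-(3 / 4) : ℝ) + 1 = 1 / 4 by norm_num,
    Real.zero_rpow (by norm_num)]
  congr 1; ring

theorem lintegral_Ioi_rpow {R : ℝ} (hR : 0 < R) :
    ∫⁻ x in Ioi R, ENNReal.ofReal (x ^ (-(3 / 2) : ℝ)) =
      ENNReal.ofReal (2 * R ^ (-(1 / 2) : ℝ)) := by
  have hpos : 0 ≤ᵐ[volume.restrict (Ioi R)] fun x : ℝ => x ^ (-(3 / 2) : ℝ) := by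
    filter_upwards [ae_restrict_mem measurableSet_Ioi] with x hx
    exact Real.rpow_nonneg (hR.trans hx).le _
  rw [← ofReal_integral_eq_lintegral_ofReal
    (integrableOn_Ioi_rpow_of_lt (by norm_num) hR) hpos, integral_Ioi_rpow_of_lt (by norm_num) hR]
  congr 1
  norm_num
  ring

/-- The truncated kernel `|x|^{-3/4} max(|x|, R)^{-3/4}`, as a function of `|x|`. -/
noncomputable def truncKernel (R x : ℝ) : ℝ≥0∞ :=
  ENNReal.ofReal (x ^ (-(3 / 4) : ℝ) * (max x R) ^ (-(3 / 4) : ℝ))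

theorem lintegral_truncKernel {R : ℝ} (hR : 0 < R) :
    ∫⁻ x, truncKernel R |x| = ENNReal.ofReal (12 * R ^ (-(1 / 2) : ℝ)) := by
  rw [lintegral_comp_abs (F := truncKernel R)]
  have h1 : ∫⁻ x in Ioi 0, truncKernel R x =
      (∫⁻ x in Ioc 0 R, truncKernel R x) + ∫⁻ x in Ioi R, truncKernel R x := by
    rw [← Ioc_union_Ioi_eq_Ioi hR.le, lintegral_union measurableSet_Ioi]
    exact Set.disjoint_left.2 fun x hx hx2 => (not_lt.2 hx.2) hx2
  -- The inner part contributes 4R^{1/4}·R^{-3/4} and the outer part 2R^{-1/2}; the two half-lines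
  -- double the sum 6R^{-1/2}.
  have h2 : ∫⁻ x in Ioc 0 R, truncKernel R x = ENNReal.ofReal (4 * R ^ (-(1 / 2) : ℝ)) := by
    have : ∫⁻ x in Ioc 0 R, truncKernel R x = ∫⁻ x in Ioc 0 R,
        ENNReal.ofReal (x ^ (-(3 / 4) : ℝ)) * ENNReal.ofReal (R ^ (-(3 / 4) : ℝ)) := by
      apply setLIntegral_congr_fun measurableSet_Ioc
      intro x hx
      simp only [truncKernel]
      rw [max_eq_right hx.2, ENNReal.ofReal_mul (Real.rpow_nonneg hx.1.le _)]
    rw [this, lintegral_mul_const' _ _ ENNReal.ofReal_ne_top, lintegral_Ioc_rpow hR.le,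
      ← ENNReal.ofReal_mul (by positivity), mul_assoc, ← Real.rpow_add hR]
    norm_num
  have h3 : ∫⁻ x in Ioi R, truncKernel R x = ENNReal.ofReal (2 * R ^ (-(1 / 2) : ℝ)) := by
    rw [← lintegral_Ioi_rpow hR]
    apply setLIntegral_congr_fun measurableSet_Ioi
    intro x hx
    simp only [truncKernel]
    rw [max_eq_left (mem_Ioi.1 hx).le, ← Real.rpow_add (hR.trans hx)]
    norm_num
  rw [h1, h2, h3, ← ENNReal.ofReal_add (by positivity) (by positivity)]
  rw [show (2 : ℝ≥0∞) = ENNReal.ofReal 2 by simp, ← ENNReal.ofReal_mul (by norm_num)]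
  congr 1; ring

/-- The weight `|ξ|^{3/8}`. -/
noncomputable def riesz (ξ : ℝ) : ℝ≥0∞ := ENNReal.ofReal (|ξ| ^ (3 / 8 : ℝ))

theorem measurable_riesz : Measurable riesz := by unfold riesz; fun_prop

theorem riesz_ne_top (ξ : ℝ) : riesz ξ ≠ ⊤ := ENNReal.ofReal_ne_top

theorem riesz_ne_zero {ξ : ℝ} (h : ξ ≠ 0) : riesz ξ ≠ 0 := by
  unfold riesz
  have : 0 < |ξ| ^ (3 / 8 : ℝ) := Real.rpow_pos_of_pos (abs_pos.2 h) _
  simpa using this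

/-- The larger of |η| and |η+ξ| is at least |ξ|/2, so its negative power may be truncated there, and
only the singularity of the smaller one remains. -/
theorem riesz_inv_sq_le {η ξ : ℝ} (h0 : η ≠ 0) (h1 : η + ξ ≠ 0) :
    ((riesz η * riesz (η + ξ))⁻¹) ^ 2 ≤
      truncKernel (|ξ| / 2) |η| + truncKernel (|ξ| / 2) |η + ξ| := by
  have p0 := abs_pos.2 h0
  have p1 := abs_pos.2 h1
  have e : ((riesz η * riesz (η + ξ))⁻¹) ^ 2 =
      ENNReal.ofReal (|η| ^ (-(3 / 4) : ℝ) * |η + ξ| ^ (-(3 / 4) : ℝ)) := by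
    unfold riesz
    rw [← ENNReal.ofReal_mul (by positivity), ← ENNReal.ofReal_inv_of_pos (by positivity),
      ← ENNReal.ofReal_pow (by positivity)]
    congr 1
    rw [mul_inv, mul_pow, ← Real.rpow_neg p0.le, ← Real.rpow_neg p1.le, ← Real.rpow_natCast,
      ← Real.rpow_natCast, ← Real.rpow_mul p0.le, ← Real.rpow_mul p1.le]
    norm_num
  have hsum : |ξ| ≤ |η| + |η + ξ| := by
    calc |ξ| = |(η + ξ) - η| := by ring_nf
      _ ≤ |η + ξ| + |η| := abs_sub _ _
      _ = _ := add_comm _ _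
  have key : ∀ a b : ℝ, 0 < a → a ≤ b → |ξ| ≤ a + b →
      ENNReal.ofReal (a ^ (-(3 / 4) : ℝ) * b ^ (-(3 / 4) : ℝ)) ≤ truncKernel (|ξ| / 2) a := by
    intro a b ha hab hs
    unfold truncKernel
    apply ENNReal.ofReal_le_ofReal
    gcongr ?_ * ?_
    apply Real.rpow_le_rpow_of_nonpos (by positivity) _ (by norm_num)
    exact max_le hab (by linarith)
  rw [e]
  rcases le_total |η| |η + ξ| with h | h
  · exact (key _ _ p0 h hsum).trans le_self_add
  · rw [mul_comm]
    exact (key _ _ p1 h (by linarith)).trans le_add_self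

/-- The product estimate Ḣ^{3/8} × Ḣ^{3/8} → Ḣ^{1/4}, scale invariant since 3/8 + 3/8 - 1/2 = 1/4:
the integral of inverse weights is of order |ξ|^{-1/2}. The constant is 24√2 ≤ 48. -/
theorem lintegral_riesz_correlation_le {f h : ℝ → ℝ≥0∞} (hf : Measurable f) (hh : Measurable h) :
    ∫⁻ ξ, ENNReal.ofReal (|ξ| ^ (1 / 2 : ℝ)) * (∫⁻ η, f η * h (η + ξ)) ^ 2 ≤
      48 * ((∫⁻ η, (riesz η * f η) ^ 2) * ∫⁻ η, (riesz η * h η) ^ 2) := by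
  apply lintegral_mul_correlation_sq_le measurable_riesz hf hh
    (fun ξ h => riesz_ne_zero h) riesz_ne_top (by norm_num)
  filter_upwards [ae_ne_zero] with ξ hξ
  have hp := abs_pos.2 hξ
  have hb : ∫⁻ η, ((riesz η * riesz (η + ξ))⁻¹) ^ 2 ≤
      ENNReal.ofReal (24 * (|ξ| / 2) ^ (-(1 / 2) : ℝ)) := by
    have hm : Measurable (fun η : ℝ => truncKernel (|ξ| / 2) |η|) := by
      unfold truncKernel; fun_prop
    calc _ ≤ ∫⁻ η, (truncKernel (|ξ| / 2) |η| + truncKernel (|ξ| / 2) |η + ξ|) := by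
          apply lintegral_mono_ae
          have : ∀ᵐ η : ℝ, η ≠ -ξ := by simp [ae_iff]
          filter_upwards [ae_ne_zero, this] with η h0 h1
          exact riesz_inv_sq_le h0 fun h => h1 (eq_neg_of_add_eq_zero_left h)
      _ = ENNReal.ofReal (24 * (|ξ| / 2) ^ (-(1 / 2) : ℝ)) := by
          rw [lintegral_add_left hm,
            lintegral_add_right_eq_self (fun η => truncKernel (|ξ| / 2) |η|) ξ,
            lintegral_truncKernel (by positivity), ← ENNReal.ofReal_add (by positivity)
              (by positivity)]
          congr 1; ring
  calc _ ≤ ENNReal.ofReal (|ξ| ^ (1 / 2 : ℝ)) *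
        ENNReal.ofReal (24 * (|ξ| / 2) ^ (-(1 / 2) : ℝ)) := mul_le_mul' le_rfl hb
    _ ≤ ENNReal.ofReal 48 := by
        rw [← ENNReal.ofReal_mul (by positivity)]
        apply ENNReal.ofReal_le_ofReal
        rw [Real.div_rpow hp.le (by norm_num), Real.rpow_neg hp.le, Real.rpow_neg (by norm_num)]
        have h2 : (2 : ℝ) ^ (1 / 2 : ℝ) ≤ 2 := by
          calc (2 : ℝ) ^ (1 / 2 : ℝ) ≤ 2 ^ (1 : ℝ) :=
                Real.rpow_le_rpow_of_exponent_le (by norm_num) (by norm_num)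
            _ = 2 := Real.rpow_one 2
        have h3 : (0 : ℝ) < |ξ| ^ (1 / 2 : ℝ) := by positivity
        field_simp
        linarith
    _ = 48 := by norm_num

end Whitham

namespace Whitham

open scoped NNReal
open Filter Topology

/-! ### Uniqueness of weak solutions -/

theorem multiplierNorm_sq (w : ℝ → ℝ) {f : ℝ → ℝ} (hf : MemLp (fun x => (f x : ℂ)) 2 volume) :
    multiplierNorm w f ^ 2 = ∫⁻ ξ : ℝ, (ENNReal.ofReal |w (2 * Real.pi * ξ)| *
      ‖fourierL2 (fun x => (f x : ℂ)) ξ‖ₑ) ^ 2 := by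
  have h := memLp_ofReal_iff.1 hf
  unfold multiplierNorm
  rw [dif_pos h, fourierL2_of_memLp hf, ← ENNReal.rpow_natCast, ← ENNReal.rpow_mul]
  norm_num

theorem enorm_add_sq_le {E : Type*} [NormedAddCommGroup E] (a b : E) :
    ‖a + b‖ₑ ^ 2 ≤ 2 * ‖a‖ₑ ^ 2 + 2 * ‖b‖ₑ ^ 2 := by
  refine (ENNReal.pow_le_pow_left (enorm_add_le a b)).trans ?_
  have := ENNReal.rpow_add_le_mul_rpow_add_rpow ‖a‖ₑ ‖b‖ₑ (p := 2) (by norm_num)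
  norm_num at this
  rw [mul_add] at this
  exact this

/-- The squared `Ḣ^{3/8}` norm on the Fourier side. -/
noncomputable def rieszEnergy (X : ℝ × ℝ → ℝ≥0∞) (t : ℝ) : ℝ≥0∞ :=
  ∫⁻ ξ, (riesz ξ * X (t, ξ)) ^ 2

theorem measurable_rieszEnergy {X : ℝ × ℝ → ℝ≥0∞} (hX : Measurable X) :
    Measurable (rieszEnergy X) := by
  apply Measurable.lintegral_prod_right' (f := fun p : ℝ × ℝ => (riesz p.2 * X p) ^ 2)
  have := measurable_riesz
  fun_prop

theorem riesz_sq_sq_le (ξ : ℝ) : (riesz ξ ^ 2) ^ 2 ≤ ENNReal.ofReal (freqA ξ) := by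
  unfold riesz
  rw [← ENNReal.ofReal_pow (by positivity), ← ENNReal.ofReal_pow (by positivity)]
  apply ENNReal.ofReal_le_ofReal
  rw [← pow_mul, ← Real.rpow_natCast, ← Real.rpow_mul (abs_nonneg _)]
  refine le_trans (le_of_eq ?_) (rpow_le_freqA ξ)
  norm_num

/-- Interpolation: |ξ|^{3/4} is the geometric mean of 1 and |ξ|^{3/2} ≤ a, so Ḣ^{3/8} lies halfway
between L² and the energy space. -/
theorem rieszEnergy_sq_le {X : ℝ × ℝ → ℝ≥0∞} (hX : Measurable X) (t : ℝ) :
    rieszEnergy X t ^ 2 ≤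
      (∫⁻ ξ, X (t, ξ) ^ 2) * ∫⁻ ξ, ENNReal.ofReal (freqA ξ) * X (t, ξ) ^ 2 := by
  have hm := measurable_riesz
  have hXt : Measurable fun ξ => X (t, ξ) := by fun_prop
  have h := sq_lintegral_mul_le (μ := volume) (f := fun ξ => X (t, ξ))
    (g := fun ξ => riesz ξ ^ 2 * X (t, ξ)) hXt.aemeasurable
    ((hm.pow_const 2).mul hXt).aemeasurable
  have e : rieszEnergy X t = ∫⁻ ξ, X (t, ξ) * (riesz ξ ^ 2 * X (t, ξ)) := by
    unfold rieszEnergy; congr 1; ext ξ; ring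
  rw [e]
  refine h.trans ?_
  gcongr with ξ
  rw [mul_pow]
  exact mul_le_mul' (riesz_sq_sq_le ξ) le_rfl

variable {T : ℝ} {u v : ℝ → ℝ → ℝ} {U G V H : ℝ × ℝ → ℂ} {C C' : ℝ≥0}

theorem measurable_freqA_energy {X : ℝ × ℝ → ℝ≥0∞} (hX : Measurable X) :
    Measurable (fun t => ∫⁻ ξ, ENNReal.ofReal (freqA ξ) * X (t, ξ) ^ 2) := by
  have hA := continuous_freqA.measurable
  apply Measurable.lintegral_prod_right'
    (f := fun p : ℝ × ℝ => ENNReal.ofReal (freqA p.2) * X p ^ 2)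
  fun_prop

theorem HasSpectrum.lintegral_freqA_lt_top (h : HasSpectrum T u U G C)
    (hN : MemLpTime (Ico 0 T) 2 normN u) :
    ∫⁻ t in Ioo 0 T, ∫⁻ ξ, ENNReal.ofReal (freqA ξ) * ‖U (t, ξ)‖ₑ ^ 2 < ⊤ := by
  have h1 : ∫⁻ t in Ioo 0 T, normN (u t) ^ 2 < ⊤ := by
    have h2 : eLpNorm (fun t => normN (u t)) 2 (volume.restrict (Ioo 0 T)) < ⊤ :=
      (eLpNorm_mono_measure _ (Measure.restrict_mono Ioo_subset_Ico_self le_rfl)).trans_lt hN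
    rw [eLpNorm_eq_lintegral_rpow_enorm_toReal (by norm_num) (by norm_num)] at h2
    have h3 := (ENNReal.rpow_lt_top_iff_of_pos (by norm_num)).1 h2
    simpa using h3
  refine lt_of_eq_of_lt ?_ h1
  apply lintegral_congr_ae
  filter_upwards [h.ae] with t ⟨h1, _, h3, _⟩
  unfold normN
  rw [multiplierNorm_sq _ h1]
  apply lintegral_congr_ae
  filter_upwards [h3] with ξ hξ
  rw [hξ, mul_pow, abs_of_nonneg (Real.sqrt_nonneg _), ← ENNReal.ofReal_pow (Real.sqrt_nonneg _),
    Real.sq_sqrt (symbolA_nonneg _)]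
  rfl

/-- If `‖X‖` is bounded in `L^∞ L²` and in the energy space, then it lies in `L⁴ Ḣ^{3/8}`. -/
theorem lintegral_rieszEnergy_sq_lt_top {X : ℝ × ℝ → ℝ≥0∞} (hX : Measurable X) {M : ℝ≥0∞}
    (hM : M < ⊤) (h1 : ∀ᵐ t ∂(volume.restrict (Ioo 0 T)), ∫⁻ ξ, X (t, ξ) ^ 2 ≤ M)
    (h2 : ∫⁻ t in Ioo 0 T, ∫⁻ ξ, ENNReal.ofReal (freqA ξ) * X (t, ξ) ^ 2 < ⊤) :
    ∫⁻ t in Ioo 0 T, rieszEnergy X t ^ 2 < ⊤ := by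
  calc _ ≤ ∫⁻ t in Ioo 0 T, M * ∫⁻ ξ, ENNReal.ofReal (freqA ξ) * X (t, ξ) ^ 2 := by
        apply lintegral_mono_ae
        filter_upwards [h1] with t ht
        exact (rieszEnergy_sq_le hX t).trans (mul_le_mul' ht le_rfl)
    _ = M * _ := lintegral_const_mul' _ _ hM.ne
    _ < ⊤ := ENNReal.mul_lt_top hM h2

/-- Stated for a general X so that it serves both U - V and U + V. -/
theorem HasSpectrum.lintegral_rieszEnergy_add_lt_top (h : HasSpectrum T u U G C)
    (h' : HasSpectrum T v V H C') (hN : MemLpTime (Ico 0 T) 2 normN u)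
    (hN' : MemLpTime (Ico 0 T) 2 normN v) {X : ℝ × ℝ → ℝ≥0∞} (hX : Measurable X)
    (hle : ∀ p, X p ^ 2 ≤ 2 * ‖U p‖ₑ ^ 2 + 2 * ‖V p‖ₑ ^ 2) :
    ∫⁻ t in Ioo 0 T, rieszEnergy X t ^ 2 < ⊤ := by
  have hUm : Measurable fun p => ‖U p‖ₑ := h.measU.enorm
  have hVm : Measurable fun p => ‖V p‖ₑ := h'.measU.enorm
  have hA := continuous_freqA.measurable
  apply lintegral_rieszEnergy_sq_lt_top hX
    (M := 2 * (C : ℝ≥0∞) ^ 2 + 2 * (C' : ℝ≥0∞) ^ 2)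
  · exact ENNReal.add_lt_top.2 ⟨ENNReal.mul_lt_top (by norm_num)
      (ENNReal.pow_lt_top ENNReal.coe_lt_top), ENNReal.mul_lt_top (by norm_num)
      (ENNReal.pow_lt_top ENNReal.coe_lt_top)⟩
  · filter_upwards [h.lintegral_U_sq_le, h'.lintegral_U_sq_le] with t h1 h2
    calc _ ≤ ∫⁻ ξ, (2 * ‖U (t, ξ)‖ₑ ^ 2 + 2 * ‖V (t, ξ)‖ₑ ^ 2) := lintegral_mono fun ξ => hle _
      _ = 2 * (∫⁻ ξ, ‖U (t, ξ)‖ₑ ^ 2) + 2 * ∫⁻ ξ, ‖V (t, ξ)‖ₑ ^ 2 := by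
        have hUt : Measurable fun ξ => ‖U (t, ξ)‖ₑ :=
          hUm.comp (by fun_prop : Measurable fun ξ : ℝ => (t, ξ))
        have hVt : Measurable fun ξ => ‖V (t, ξ)‖ₑ :=
          hVm.comp (by fun_prop : Measurable fun ξ : ℝ => (t, ξ))
        rw [lintegral_add_left ((hUt.pow_const 2).const_mul _),
          lintegral_const_mul _ (hUt.pow_const 2), lintegral_const_mul _ (hVt.pow_const 2)]
      _ ≤ _ := by gcongr
  · have h1 := h.lintegral_freqA_lt_top hN
    have h2 := h'.lintegral_freqA_lt_top hN'
    calc _ ≤ ∫⁻ t in Ioo 0 T, (2 * (∫⁻ ξ, ENNReal.ofReal (freqA ξ) * ‖U (t, ξ)‖ₑ ^ 2) +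
          2 * ∫⁻ ξ, ENNReal.ofReal (freqA ξ) * ‖V (t, ξ)‖ₑ ^ 2) := by
          apply lintegral_mono
          intro t
          have hUt : Measurable fun ξ => ‖U (t, ξ)‖ₑ :=
            hUm.comp (by fun_prop : Measurable fun ξ : ℝ => (t, ξ))
          simp only
          rw [← lintegral_const_mul' _ _ (by norm_num), ← lintegral_const_mul' _ _ (by norm_num),
            ← lintegral_add_left (f := fun ξ => 2 * (ENNReal.ofReal (freqA ξ) * ‖U (t, ξ)‖ₑ ^ 2))
              ((hA.ennreal_ofReal.mul (hUt.pow_const 2)).const_mul 2)]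
          apply lintegral_mono
          intro ξ
          calc _ ≤ ENNReal.ofReal (freqA ξ) * (2 * ‖U (t, ξ)‖ₑ ^ 2 + 2 * ‖V (t, ξ)‖ₑ ^ 2) :=
                mul_le_mul' le_rfl (hle _)
            _ = _ := by ring
      _ = 2 * _ + 2 * _ := by
          rw [lintegral_add_left ((measurable_freqA_energy hUm).const_mul 2),
            lintegral_const_mul _ (measurable_freqA_energy hUm),
            lintegral_const_mul _ (measurable_freqA_energy hVm)]
      _ < ⊤ := ENNReal.add_lt_top.2 ⟨ENNReal.mul_lt_top (by norm_num) h1,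
          ENNReal.mul_lt_top (by norm_num) h2⟩

theorem HasSpectrum.intervalIntegrable_duhamel (h : HasSpectrum T u U G C) {t : ℝ}
    (ht : t ∈ Ioo 0 T) (ξ : ℝ) :
    IntervalIntegrable (fun s => (Real.exp (-((t - s) * freqA ξ)) : ℂ) *
      (Real.pi * Complex.I * ξ * G (s, ξ))) volume 0 t := by
  have sub : Ioc 0 t ⊆ Ioo 0 T := fun s hs => ⟨hs.1, hs.2.trans_lt ht.2⟩
  have hi : IntervalIntegrable (fun s => Real.pi * Complex.I * ξ * G (s, ξ)) volume 0 t :=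
    ((intervalIntegrable_iff_integrableOn_Ioc_of_le ht.1.le).2
      ((h.integrableOn_G ξ).mono_set sub)).const_mul _
  apply hi.continuousOn_mul
  fun_prop

theorem enorm_integral_duhamel_le (K : ℝ × ℝ → ℂ) {t : ℝ} (ht : 0 ≤ t) (ξ : ℝ) :
    ‖∫ s in (0)..t, (Real.exp (-((t - s) * freqA ξ)) : ℂ) *
      (Real.pi * Complex.I * ξ * K (s, ξ))‖ₑ ≤ duh (fun p => ‖K p‖ₑ) t ξ := by
  rw [intervalIntegral.integral_of_le ht]
  refine (enorm_integral_le_lintegral_enorm _).trans (le_of_eq ?_)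
  unfold duh expConv
  congr 1; ext s
  have h1 : ‖(Real.exp (-((t - s) * freqA ξ)) : ℂ)‖ₑ =
      ENNReal.ofReal (Real.exp (-((t - s) * freqA ξ))) := by
    rw [← ofReal_norm, Complex.norm_real, Real.norm_of_nonneg (Real.exp_pos _).le]
  have h2 : ‖(Real.pi : ℂ) * Complex.I * ξ‖ₑ = ENNReal.ofReal (Real.pi * |ξ|) := by
    rw [← ofReal_norm, norm_mul, norm_mul, Complex.norm_I, Complex.norm_real, Complex.norm_real,
      Real.norm_of_nonneg Real.pi_pos.le, mul_one, Real.norm_eq_abs]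
  rw [enorm_mul, enorm_mul, h1, h2]

/-- The common initial datum makes the linear parts cancel. -/
theorem HasSpectrum.enorm_sub_le_duh (h : HasSpectrum T u U G C) (h' : HasSpectrum T v V H C')
    (hT : 0 < T) {u₀ : ℝ → ℝ} (hu₀ : MemLp (fun x => (u₀ x : ℂ)) 2 volume)
    (hu : IsWeakSolution (Ico 0 T) u₀ u) (hv : IsWeakSolution (Ico 0 T) u₀ v) :
    ∀ᵐ t ∂(volume.restrict (Ioo 0 T)), ∀ᵐ ξ : ℝ,
      ‖U (t, ξ) - V (t, ξ)‖ₑ ≤ duh (fun p => ‖G p - H p‖ₑ) t ξ := by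
  filter_upwards [h.duhamel hT hu₀ hu, h'.duhamel hT hu₀ hv, ae_restrict_mem measurableSet_Ioo]
    with t h1 h2 ht
  filter_upwards [h1, h2] with ξ e1 e2
  rw [e1, e2, add_sub_add_left_eq_sub, ← intervalIntegral.integral_sub
    (h.intervalIntegrable_duhamel ht ξ) (h'.intervalIntegrable_duhamel ht ξ)]
  simp only [← mul_sub]
  exact enorm_integral_duhamel_le (fun p => G p - H p) ht.1.le ξ

/-- The factorization u² - v² = (u-v)(u+v), followed by the correlation bound for transforms of
products. -/
theorem HasSpectrum.enorm_G_sub_le (h : HasSpectrum T u U G C) (h' : HasSpectrum T v V H C') :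
    ∀ᵐ t ∂(volume.restrict (Ioo 0 T)), ∀ ξ, ‖G (t, ξ) - H (t, ξ)‖ₑ ≤
      ∫⁻ η, ‖U (t, η) - V (t, η)‖ₑ * ‖U (t, η + ξ) + V (t, η + ξ)‖ₑ := by
  filter_upwards [h.ae, h'.ae] with t ⟨u1, _, u3, u4⟩ ⟨v1, _, v3, v4⟩ ξ
  have hu := memLp_ofReal_iff.1 u1
  have hv := memLp_ofReal_iff.1 v1
  have e1 : (fun x => ((u t x - v t x : ℝ) : ℂ)) = (fun x => (u t x : ℂ)) - fun x => (v t x : ℂ) := by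
    ext x; simp
  have e2 : (fun x => ((u t x + v t x : ℝ) : ℂ)) = (fun x => (u t x : ℂ)) + fun x => (v t x : ℂ) := by
    ext x; simp
  have hd : MemLp (fun x => ((u t x - v t x : ℝ) : ℂ)) 2 volume := by rw [e1]; exact u1.sub v1
  have hs : MemLp (fun x => ((u t x + v t x : ℝ) : ℂ)) 2 volume := by rw [e2]; exact u1.add v1
  have hF := enorm_fourier_mul_le hd hs ξ
  have hG : G (t, ξ) - H (t, ξ) =
      𝓕 (fun x => (((u t x - v t x) * (u t x + v t x) : ℝ) : ℂ)) ξ := by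
    have iu : Integrable (fun x => char ξ x * ((u t x * u t x : ℝ) : ℂ)) volume :=
      memLp_one_iff_integrable.1
        (memLp_char_mul (memLp_one_iff_integrable.2 (hu.integrable_mul hu).ofReal) ξ)
    have iv : Integrable (fun x => char ξ x * ((v t x * v t x : ℝ) : ℂ)) volume :=
      memLp_one_iff_integrable.1
        (memLp_char_mul (memLp_one_iff_integrable.2 (hv.integrable_mul hv).ofReal) ξ)
    rw [u4, v4, fourier_eq_integral_char, fourier_eq_integral_char, fourier_eq_integral_char,
      ← integral_sub iu iv]
    congr 1; ext x; push_cast; ring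
  rw [hG]
  refine hF.trans (le_of_eq ?_)
  have hdiff : fourierL2 (fun x => ((u t x - v t x : ℝ) : ℂ)) =ᵐ[volume]
      fun η => U (t, η) - V (t, η) := by
    rw [e1]
    filter_upwards [fourierL2_sub u1 v1, u3, v3] with η a b c
    rw [a, Pi.sub_apply, b, c]
  have hsum : fourierL2 (fun x => ((u t x + v t x : ℝ) : ℂ)) =ᵐ[volume]
      fun η => U (t, η) + V (t, η) := by
    rw [e2]
    filter_upwards [fourierL2_add u1 v1, u3, v3] with η a b c
    rw [a, Pi.add_apply, b, c]
  have hshift := (measurePreserving_add_right (volume : Measure ℝ) ξ).quasiMeasurePreserving.ae_eq_comp hsum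
  apply lintegral_congr_ae
  filter_upwards [hdiff, hshift] with η a b
  simp only [Function.comp_apply] at b
  rw [a, b]

/-- A nonnegative function controlled by a small multiple of its own history vanishes. -/
theorem lintegral_eq_zero_of_local_contraction {X S : ℝ → ℝ≥0∞}
    (hT : 0 < T) (hXf : ∫⁻ t in Ioo 0 T, X t < ⊤)
    (hSf : ∫⁻ t in Ioo 0 T, S t < ⊤) {M : ℝ≥0∞} (hM : M ≠ ⊤)
    (h : ∀ τ₀ τ, 0 ≤ τ₀ → τ₀ ≤ τ → τ ≤ T → ∫⁻ t in Ioo 0 τ₀, X t = 0 →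
      ∫⁻ t in Ioo 0 τ, X t ≤ M * (∫⁻ t in Ioo 0 τ, X t) * ∫⁻ t in Ico τ₀ τ ∩ Ioo 0 T, S t) :
    ∫⁻ t in Ioo 0 T, X t = 0 := by
  have hε : (M + 1)⁻¹ ≠ 0 := by
    simp [hM]
  -- Absolute continuity of the integral of S: on any window shorter than δ it is below 1/(M+1), so
  -- the factor M∫S is below 1. The length of the window does not depend on its position, so
  -- finitely many suffice.
  obtain ⟨δ, hδ, hδS⟩ := exists_pos_setLIntegral_lt_of_measure_lt hSf.ne hε
  obtain ⟨δ', hδ', hδ'2⟩ : ∃ δ' : ℝ, 0 < δ' ∧ ENNReal.ofReal δ' < δ := by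
    obtain ⟨r, hr0, hr⟩ := ENNReal.lt_iff_exists_nnreal_btwn.1 hδ
    refine ⟨r, by exact_mod_cast hr0, by simpa using hr⟩
  have step : ∀ n : ℕ, ∫⁻ t in Ioo 0 (min (n * δ') T), X t = 0 := by
    intro n
    induction n with
    | zero => simp [hT.le]
    | succ n ih =>
      have h1 := h (min (n * δ') T) (min ((n + 1 : ℕ) * δ') T) (by positivity)
        (min_le_min_right _ (by push_cast; nlinarith)) (min_le_right _ _) ih
      set A := Ico (min (n * δ') T) (min ((n + 1 : ℕ) * δ') T) with hA
      have hmeas : (volume.restrict (Ioo 0 T)) A < δ := by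
        refine (Measure.restrict_apply_le _ _).trans_lt (lt_of_le_of_lt ?_ hδ'2)
        rw [hA, Real.volume_Ico]
        apply ENNReal.ofReal_le_ofReal
        push_cast
        rcases min_cases ((n : ℝ) * δ') T with ⟨e, h⟩ | ⟨e, h⟩ <;>
        rcases min_cases (((n : ℝ) + 1) * δ') T with ⟨e', h'⟩ | ⟨e', h'⟩ <;>
        rw [e, e'] <;> nlinarith
      have h2 := hδS A hmeas
      rw [Measure.restrict_restrict measurableSet_Ico] at h2
      set x := ∫⁻ t in Ioo 0 (min ((n + 1 : ℕ) * δ') T), X t with hx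
      have hxf : x ≠ ⊤ := ((lintegral_mono_set (Ioo_subset_Ioo_right (min_le_right _ _))).trans_lt hXf).ne
      by_contra hx0
      have h3 : M * ∫⁻ t in A ∩ Ioo 0 T, S t < 1 := by
        calc M * ∫⁻ t in A ∩ Ioo 0 T, S t ≤ M * (M + 1)⁻¹ := mul_le_mul' le_rfl h2.le
          _ < (M + 1) * (M + 1)⁻¹ := by
              rw [ENNReal.mul_lt_mul_iff_left hε (by simp)]
              exact ENNReal.lt_add_right hM one_ne_zero
          _ = 1 := ENNReal.mul_inv_cancel (by simp) (by simp [hM])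
      have h4 : x < x := by
        calc x ≤ M * x * ∫⁻ t in A ∩ Ioo 0 T, S t := h1
          _ = x * (M * ∫⁻ t in A ∩ Ioo 0 T, S t) := by ring
          _ < x * 1 := by
              rw [ENNReal.mul_lt_mul_iff_right hx0 hxf]
              exact h3
          _ = x := mul_one x
      exact lt_irrefl _ h4
  obtain ⟨n, hn⟩ := exists_nat_gt (T / δ')
  have := step n
  rwa [min_eq_right ((div_lt_iff₀ hδ').1 hn).le] at this

theorem IsWeakSolution.unique (hT : 0 < T) {u₀ : ℝ → ℝ} (hu₀ : MemLp u₀ 2 volume)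
    (hu : IsWeakSolution (Ico 0 T) u₀ u) (hv : IsWeakSolution (Ico 0 T) u₀ v) :
    ∀ᵐ t ∂(volume.restrict (Ioo 0 T)), v t =ᵐ[volume] u t := by
  obtain ⟨U, G, C, h⟩ := hu.exists_hasSpectrum
  obtain ⟨V, H, C', h'⟩ := hv.exists_hasSpectrum
  have hu₀' := memLp_ofReal_iff.2 hu₀
  let W : ℝ × ℝ → ℝ≥0∞ := fun p => ‖U p - V p‖ₑ
  let S : ℝ × ℝ → ℝ≥0∞ := fun p => ‖U p + V p‖ₑ
  let g : ℝ × ℝ → ℝ≥0∞ := fun p => ‖G p - H p‖ₑ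
  have hW : Measurable W := (h.measU.sub h'.measU).enorm
  have hS : Measurable S := (h.measU.add h'.measU).enorm
  have hg : Measurable g := (h.measG.sub h'.measG).enorm
  have hWf := h.lintegral_rieszEnergy_add_lt_top h' hu.memL2N hv.memL2N hW fun p => by
    have := enorm_add_sq_le (U p) (-V p)
    simpa [W, sub_eq_add_neg] using this
  have hSf := h.lintegral_rieszEnergy_add_lt_top h' hu.memL2N hv.memL2N hS fun p =>
    enorm_add_sq_le (U p) (V p)
  have hWd := h.enorm_sub_le_duh h' hT hu₀' hu hv
  have hgle := h.enorm_G_sub_le h'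
  have hA := continuous_freqA.measurable
  have mW := measurable_rieszEnergy hW
  have mS := measurable_rieszEnergy hS
  have key : ∫⁻ t in Ioo 0 T, rieszEnergy W t ^ 2 = 0 := by
    apply lintegral_eq_zero_of_local_contraction (S := fun t => rieszEnergy S t ^ 2)
      (M := 100 * 48 ^ 2) hT hWf hSf (by norm_num)
    intro τ₀ τ h0 h1 h2 hz
    have subτ : Ioo 0 τ ⊆ Ioo 0 T := Ioo_subset_Ioo_right h2
    set K := sourceNorm (fun _ => 1) g τ with hK
    -- Interpolation between the two Duhamel bounds; each contributes a factor 10K.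
    have hXK : ∫⁻ t in Ioo 0 τ, rieszEnergy W t ^ 2 ≤ 100 * K ^ 2 := by
      calc ∫⁻ t in Ioo 0 τ, rieszEnergy W t ^ 2
          ≤ ∫⁻ t in Ioo 0 τ, (10 * K) * ∫⁻ ξ, 1 * (ENNReal.ofReal (freqA ξ) * duh g t ξ ^ 2) := by
            apply lintegral_mono_ae
            filter_upwards [ae_restrict_of_ae_restrict_of_subset subτ hWd,
              ae_restrict_mem measurableSet_Ioo] with t ht htτ
            refine (rieszEnergy_sq_le hW t).trans (mul_le_mul' ?_ ?_)
            · refine le_trans ?_ (lintegral_mul_duh_sq_le (w := fun _ => 1) hg measurable_const htτ.2)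
              apply lintegral_mono_ae
              filter_upwards [ht] with ξ hξ
              rw [one_mul]
              exact ENNReal.pow_le_pow_left hξ
            · apply lintegral_mono_ae
              filter_upwards [ht] with ξ hξ
              rw [one_mul]
              exact mul_le_mul' le_rfl (ENNReal.pow_le_pow_left hξ)
        _ ≤ (10 * K) * (10 * K) := by
            have hd := measurable_duh hg
            have hm : Measurable (Function.uncurry fun (t : ℝ) ξ =>
                1 * (ENNReal.ofReal (freqA ξ) * duh g t ξ ^ 2)) :=
              measurable_const.mul ((hA.comp measurable_snd).ennreal_ofReal.mul (hd.pow_const 2))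
            refine (lintegral_const_mul _ hm.lintegral_prod_right').le.trans ?_
            exact mul_le_mul' le_rfl
              (lintegral_lintegral_freqA_mul_duh_sq_le (w := fun _ => 1) hg measurable_const τ)
        _ = 100 * K ^ 2 := by ring
    have hKle : K ≤ 48 * ∫⁻ t in Ioo 0 τ, rieszEnergy W t * rieszEnergy S t := by
      rw [hK, sourceNorm, ← lintegral_const_mul' _ _ (by norm_num)]
      apply lintegral_mono_ae
      filter_upwards [ae_restrict_of_ae_restrict_of_subset subτ hgle] with t ht
      have hWt : Measurable fun ξ => W (t, ξ) := by fun_prop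
      have hSt : Measurable fun ξ => S (t, ξ) := by fun_prop
      refine le_trans ?_ (lintegral_riesz_correlation_le hWt hSt)
      apply lintegral_mono
      intro ξ
      simp only [one_mul]
      exact mul_le_mul' le_rfl (ENNReal.pow_le_pow_left (ht ξ))
    -- W vanishes before τ₀, so only the mass of S on [τ₀,τ) enters; this mass is small on a short
    -- window.
    have hvan : ∫⁻ t in Ioo 0 τ, rieszEnergy W t * rieszEnergy S t ≤
        ∫⁻ t in Ioo 0 τ, rieszEnergy W t * (Ico τ₀ τ ∩ Ioo 0 T).indicator (rieszEnergy S) t := by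
      have hz' := (lintegral_eq_zero_iff (mW.pow_const 2)).1 hz
      rw [EventuallyEq, ae_restrict_iff' measurableSet_Ioo] at hz'
      apply lintegral_mono_ae
      rw [ae_restrict_iff' measurableSet_Ioo] at *
      filter_upwards [hz'] with t ht htτ
      by_cases hlt : t < τ₀
      · have : rieszEnergy W t = 0 := by simpa using ht ⟨htτ.1, hlt⟩
        simp [this]
      · have hmem : t ∈ Ico τ₀ τ ∩ Ioo 0 T := ⟨⟨not_lt.1 hlt, htτ.2⟩, subτ htτ⟩
        rw [indicator_of_mem hmem]
    have hCS := sq_lintegral_mul_le (μ := volume.restrict (Ioo 0 τ)) (f := rieszEnergy W)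
      (g := (Ico τ₀ τ ∩ Ioo 0 T).indicator (rieszEnergy S)) mW.aemeasurable
      (mS.indicator (measurableSet_Ico.inter measurableSet_Ioo)).aemeasurable
    have hind : ∫⁻ t in Ioo 0 τ, (Ico τ₀ τ ∩ Ioo 0 T).indicator (rieszEnergy S) t ^ 2 ≤
        ∫⁻ t in Ico τ₀ τ ∩ Ioo 0 T, rieszEnergy S t ^ 2 := by
      refine (setLIntegral_le_lintegral _ _).trans (le_of_eq ?_)
      rw [← lintegral_indicator (measurableSet_Ico.inter measurableSet_Ioo)]
      congr 1; ext t
      by_cases ht : t ∈ Ico τ₀ τ ∩ Ioo 0 T <;> simp [ht]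
    calc _ ≤ 100 * K ^ 2 := hXK
      _ ≤ 100 * (48 * ∫⁻ t in Ioo 0 τ,
          rieszEnergy W t * (Ico τ₀ τ ∩ Ioo 0 T).indicator (rieszEnergy S) t) ^ 2 := by
          refine mul_le_mul' le_rfl (ENNReal.pow_le_pow_left ?_)
          exact hKle.trans (mul_le_mul' le_rfl hvan)
      _ = 100 * 48 ^ 2 * (∫⁻ t in Ioo 0 τ,
          rieszEnergy W t * (Ico τ₀ τ ∩ Ioo 0 T).indicator (rieszEnergy S) t) ^ 2 := by ring
      _ ≤ 100 * 48 ^ 2 * ((∫⁻ t in Ioo 0 τ, rieszEnergy W t ^ 2) *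
          ∫⁻ t in Ico τ₀ τ ∩ Ioo 0 T, rieszEnergy S t ^ 2) :=
          mul_le_mul' le_rfl (hCS.trans (mul_le_mul' le_rfl hind))
      _ = _ := by ring
  have hzero := (lintegral_eq_zero_iff (mW.pow_const 2)).1 key
  filter_upwards [hzero, h.ae, h'.ae] with t hz ⟨u1, _, u3, _⟩ ⟨v1, _, v3, _⟩
  have hz' : rieszEnergy W t = 0 := by simpa using hz
  have hWt : Measurable fun ξ => (riesz ξ * W (t, ξ)) ^ 2 := by
    have := measurable_riesz
    fun_prop
  have hae := (lintegral_eq_zero_iff hWt).1 hz'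
  have hUV : fourierL2 (fun x => (v t x : ℂ)) =ᵐ[volume] fourierL2 (fun x => (u t x : ℂ)) := by
    filter_upwards [hae, u3, v3, ae_ne_zero] with ξ a b c d
    have h1 : riesz ξ * W (t, ξ) = 0 := by simpa using a
    have h2 : W (t, ξ) = 0 := (mul_eq_zero.1 h1).resolve_left (riesz_ne_zero d)
    have h3 : U (t, ξ) - V (t, ξ) = 0 := by simpa [W] using h2
    rw [← b, ← c]
    exact (sub_eq_zero.1 h3).symm
  filter_upwards [fourierL2_injective v1 u1 hUV] with x hx
  exact_mod_cast hx

end Whitham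

namespace Whitham

open scoped NNReal
open Filter Topology

/-! ### Propagation of Sobolev regularity -/

variable {T : ℝ} {u : ℝ → ℝ → ℝ} {U G : ℝ × ℝ → ℂ} {C : ℝ≥0}

theorem HasSpectrum.enorm_G_le (h : HasSpectrum T u U G C) :
    ∀ᵐ t ∂(volume.restrict (Ioo 0 T)), ∀ ξ, ‖G (t, ξ)‖ₑ ≤
      ∫⁻ η, ‖U (t, η)‖ₑ * ‖U (t, η + ξ)‖ₑ := by
  filter_upwards [h.ae] with t ⟨u1, _, u3, u4⟩ ξ
  rw [u4]
  refine (enorm_fourier_mul_le u1 u1 ξ).trans (le_of_eq ?_)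
  have hs := (measurePreserving_add_right (volume : Measure ℝ) ξ).quasiMeasurePreserving.ae_eq_comp u3
  apply lintegral_congr_ae
  filter_upwards [u3, hs] with η a b
  simp only [Function.comp_apply] at b
  rw [a, b]

/-- The squared `H^r` norm on the Fourier side. -/
noncomputable def besselEnergy (r : ℝ) (X : ℝ × ℝ → ℂ) (t : ℝ) : ℝ≥0∞ :=
  ∫⁻ ξ, (bessel r ξ * ‖X (t, ξ)‖ₑ) ^ 2

theorem measurable_enorm_section {X : ℝ × ℝ → ℂ} (hX : StronglyMeasurable X) (t : ℝ) :
    Measurable fun ξ => ‖X (t, ξ)‖ₑ :=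
  hX.enorm.comp (by fun_prop : Measurable fun ξ : ℝ => (t, ξ))

theorem besselEnergy_mono {r s : ℝ} (h : r ≤ s) (X : ℝ × ℝ → ℂ) (t : ℝ) :
    besselEnergy r X t ≤ besselEnergy s X t :=
  lintegral_mono fun ξ => ENNReal.pow_le_pow_left (mul_le_mul' (bessel_mono h ξ) le_rfl)

theorem HasSpectrum.exists_lintegral_bessel_G_le (h : HasSpectrum T u U G C) {r : ℝ}
    (hr : 1 / 2 < r) : ∃ K : ℝ≥0∞, K ≠ ⊤ ∧ ∀ᵐ t ∂(volume.restrict (Ioo 0 T)),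
      ∫⁻ ξ, bessel r ξ ^ 2 * ‖G (t, ξ)‖ₑ ^ 2 ≤ K * besselEnergy r U t ^ 2 := by
  obtain ⟨K, hK, hb⟩ := exists_lintegral_bessel_correlation_le hr
  refine ⟨K, hK, ?_⟩
  filter_upwards [h.enorm_G_le] with t ht
  have hm := measurable_enorm_section h.measU t
  rw [sq (besselEnergy r U t)]
  refine le_trans (lintegral_mono fun ξ => ?_) (hb _ _ hm hm)
  exact mul_le_mul' le_rfl (ENNReal.pow_le_pow_left (ht ξ))

theorem ofReal_sqrt_abs_le_bessel (ξ : ℝ) :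
    ENNReal.ofReal (|ξ| ^ (1 / 2 : ℝ)) ≤ bessel (1 / 2) ξ := by
  unfold bessel
  apply ENNReal.ofReal_le_ofReal
  have h1 : |ξ| ^ (1 / 2 : ℝ) = (|ξ| ^ 2) ^ (1 / 2 / 2 : ℝ) := by
    rw [← Real.rpow_natCast, ← Real.rpow_mul (abs_nonneg _)]; norm_num
  rw [h1]
  apply Real.rpow_le_rpow (by positivity) _ (by norm_num)
  rw [sq_abs]
  have : 1 ≤ 2 * Real.pi := by linarith [Real.pi_gt_three]
  nlinarith [sq_nonneg ξ, mul_nonneg (sq_nonneg ξ) (by nlinarith : 0 ≤ (2 * Real.pi) ^ 2 - 1)]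

/-- By the algebra property u ∈ L⁴H^r gives u² ∈ L²H^r, and the source norm at order ρ asks for u²
only at order ρ + 1/4. -/
theorem HasSpectrum.sourceNorm_lt_top (h : HasSpectrum T u U G C) {r ρ : ℝ} (hr : 1 / 2 < r)
    (hρ : ρ + 1 / 4 ≤ r) (hP : ∫⁻ t in Ioo 0 T, besselEnergy r U t ^ 2 < ⊤) :
    sourceNorm (fun ξ => bessel ρ ξ ^ 2) (fun p => ‖G p‖ₑ) T < ⊤ := by
  obtain ⟨K, hK, hb⟩ := h.exists_lintegral_bessel_G_le hr
  refine lt_of_le_of_lt ?_ (ENNReal.mul_lt_top hK.lt_top hP)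
  rw [← lintegral_const_mul' _ _ hK, sourceNorm]
  apply lintegral_mono_ae
  filter_upwards [hb] with t ht
  refine le_trans (lintegral_mono fun ξ => ?_) ht
  rw [← mul_assoc]
  refine mul_le_mul' ?_ le_rfl
  rw [bessel_sq, bessel_sq]
  refine (mul_le_mul' le_rfl (ofReal_sqrt_abs_le_bessel ξ)).trans ?_
  rw [bessel_mul]
  exact bessel_mono (by linarith) ξ

/-- One exponential is kept on the linear part: its time integral against a is at most 1, which is
the smoothing used in `HasSpectrum.lintegral_freqA_bessel_lt_top`. -/
theorem HasSpectrum.enorm_sq_le (h : HasSpectrum T u U G C) (hT : 0 < T) {u₀ : ℝ → ℝ}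
    (hu₀ : MemLp (fun x => (u₀ x : ℂ)) 2 volume) (hu : IsWeakSolution (Ico 0 T) u₀ u) :
    ∀ᵐ t ∂(volume.restrict (Ioo 0 T)), ∀ᵐ ξ : ℝ, ‖U (t, ξ)‖ₑ ^ 2 ≤
      2 * (ENNReal.ofReal (Real.exp (-(t * freqA ξ))) *
        ‖fourierL2 (fun x => (u₀ x : ℂ)) ξ‖ₑ ^ 2) + 2 * duh (fun p => ‖G p‖ₑ) t ξ ^ 2 := by
  filter_upwards [h.duhamel hT hu₀ hu, ae_restrict_mem measurableSet_Ioo] with t h1 ht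
  filter_upwards [h1] with ξ e
  rw [e]
  refine (enorm_add_sq_le _ _).trans ?_
  gcongr
  · rw [enorm_mul, mul_pow]
    refine mul_le_mul' ?_ le_rfl
    rw [← ofReal_norm, Complex.norm_real, Real.norm_of_nonneg (Real.exp_pos _).le]
    have : Real.exp (-(t * freqA ξ)) ≤ 1 := by
      apply Real.exp_le_one_iff.2
      have := mul_nonneg ht.1.le (freqA_nonneg ξ)
      linarith
    calc _ ≤ ENNReal.ofReal (Real.exp (-(t * freqA ξ))) * 1 := by
          rw [sq]
          gcongr
          exact ENNReal.ofReal_le_one.2 this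
      _ = _ := mul_one _
  · exact enorm_integral_duhamel_le G ht.1.le ξ

section

variable {u₀ : ℝ → ℝ} {r ρ : ℝ}

theorem HasSpectrum.exists_besselEnergy_le (h : HasSpectrum T u U G C) (hT : 0 < T)
    (hu₀ : MemLp (fun x => (u₀ x : ℂ)) 2 volume) (hu : IsWeakSolution (Ico 0 T) u₀ u)
    (hS : sourceNorm (fun ξ => bessel ρ ξ ^ 2) (fun p => ‖G p‖ₑ) T < ⊤)
    (h0 : ∫⁻ ξ, bessel ρ ξ ^ 2 * ‖fourierL2 (fun x => (u₀ x : ℂ)) ξ‖ₑ ^ 2 < ⊤) :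
    ∃ M : ℝ≥0∞, M < ⊤ ∧ ∀ᵐ t ∂(volume.restrict (Ioo 0 T)), besselEnergy ρ U t ≤ M := by
  have hbm := (measurable_bessel ρ).pow_const 2
  have hgm : Measurable fun p => ‖G p‖ₑ := h.measG.enorm
  refine ⟨_, ENNReal.add_lt_top.2 ⟨ENNReal.mul_lt_top (by norm_num : (2 : ℝ≥0∞) < ⊤) h0,
    ENNReal.mul_lt_top (by norm_num : (2 : ℝ≥0∞) < ⊤)
      (ENNReal.mul_lt_top (by norm_num : (10 : ℝ≥0∞) < ⊤) hS)⟩, ?_⟩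
  filter_upwards [h.enorm_sq_le hT hu₀ hu, ae_restrict_mem measurableSet_Ioo] with t ht htT
  have hfm := (stronglyMeasurable_fourierL2 (fun x => (u₀ x : ℂ))).enorm
  calc besselEnergy ρ U t ≤ ∫⁻ ξ, (2 * (bessel ρ ξ ^ 2 * ‖fourierL2 (fun x => (u₀ x : ℂ)) ξ‖ₑ ^ 2) +
        2 * (bessel ρ ξ ^ 2 * duh (fun p => ‖G p‖ₑ) t ξ ^ 2)) := by
        apply lintegral_mono_ae
        filter_upwards [ht] with ξ hξ
        rw [mul_pow]
        refine (mul_le_mul' le_rfl hξ).trans ?_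
        have : ENNReal.ofReal (Real.exp (-(t * freqA ξ))) ≤ 1 := by
          apply ENNReal.ofReal_le_one.2
          apply Real.exp_le_one_iff.2
          have := mul_nonneg htT.1.le (freqA_nonneg ξ)
          linarith
        calc _ ≤ bessel ρ ξ ^ 2 * (2 * (1 * ‖fourierL2 (fun x => (u₀ x : ℂ)) ξ‖ₑ ^ 2) +
              2 * duh (fun p => ‖G p‖ₑ) t ξ ^ 2) := by gcongr
          _ = _ := by ring
    _ = 2 * (∫⁻ ξ, bessel ρ ξ ^ 2 * ‖fourierL2 (fun x => (u₀ x : ℂ)) ξ‖ₑ ^ 2) +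
        2 * ∫⁻ ξ, bessel ρ ξ ^ 2 * duh (fun p => ‖G p‖ₑ) t ξ ^ 2 := by
        rw [lintegral_add_left (f := fun ξ => 2 * (bessel ρ ξ ^ 2 *
            ‖fourierL2 (fun x => (u₀ x : ℂ)) ξ‖ₑ ^ 2)) ((hbm.mul (hfm.pow_const 2)).const_mul 2),
          lintegral_const_mul' _ _ (by norm_num), lintegral_const_mul' _ _ (by norm_num)]
    _ ≤ _ := by
        gcongr
        exact lintegral_mul_duh_sq_le hgm hbm htT.2

theorem lintegral_freqA_mul_exp_le (ξ T : ℝ) :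
    ∫⁻ t in Ioo 0 T, ENNReal.ofReal (freqA ξ) * ENNReal.ofReal (Real.exp (-(t * freqA ξ))) ≤ 1 := by
  rcases (freqA_nonneg ξ).eq_or_lt with h | h
  · simp [← h]
  · rw [lintegral_const_mul' _ _ ENNReal.ofReal_ne_top]
    have h1 := lintegral_exp_right_le h 0
    simp only [sub_zero] at h1
    calc _ ≤ ENNReal.ofReal (freqA ξ) * ENNReal.ofReal (freqA ξ)⁻¹ :=
          mul_le_mul' le_rfl ((lintegral_mono_set Ioo_subset_Ioi_self).trans h1)
      _ = 1 := by
          rw [← ENNReal.ofReal_mul h.le, mul_inv_cancel₀ h.ne', ENNReal.ofReal_one]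

theorem measurable_freqA_mul_exp {F : ℝ → ℝ≥0∞} (hF : Measurable F) :
    Measurable (Function.uncurry fun t ξ => F ξ *
      (ENNReal.ofReal (freqA ξ) * ENNReal.ofReal (Real.exp (-(t * freqA ξ))))) := by
  have h1 : Measurable fun p : ℝ × ℝ => F p.2 := hF.comp measurable_snd
  have h2 : Measurable fun p : ℝ × ℝ => freqA p.2 :=
    continuous_freqA.measurable.comp measurable_snd
  exact h1.mul (h2.ennreal_ofReal.mul
    (Real.measurable_exp.comp (measurable_fst.mul h2).neg).ennreal_ofReal)

theorem lintegral_lintegral_freqA_mul_exp_le {F : ℝ → ℝ≥0∞} (hF : Measurable F) (T : ℝ) :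
    ∫⁻ t in Ioo 0 T, ∫⁻ ξ, F ξ *
      (ENNReal.ofReal (freqA ξ) * ENNReal.ofReal (Real.exp (-(t * freqA ξ)))) ≤ ∫⁻ ξ, F ξ := by
  rw [lintegral_lintegral_swap (measurable_freqA_mul_exp hF).aemeasurable]
  apply lintegral_mono
  intro ξ
  have : Measurable fun t : ℝ => ENNReal.ofReal (freqA ξ) *
      ENNReal.ofReal (Real.exp (-(t * freqA ξ))) := by fun_prop
  simp only
  rw [lintegral_const_mul _ this]
  exact (mul_le_mul' le_rfl (lintegral_freqA_mul_exp_le ξ T)).trans (mul_one _).le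

theorem HasSpectrum.lintegral_freqA_bessel_lt_top (h : HasSpectrum T u U G C) (hT : 0 < T)
    (hu₀ : MemLp (fun x => (u₀ x : ℂ)) 2 volume) (hu : IsWeakSolution (Ico 0 T) u₀ u)
    (hS : sourceNorm (fun ξ => bessel ρ ξ ^ 2) (fun p => ‖G p‖ₑ) T < ⊤)
    (h0 : ∫⁻ ξ, bessel ρ ξ ^ 2 * ‖fourierL2 (fun x => (u₀ x : ℂ)) ξ‖ₑ ^ 2 < ⊤) :
    ∫⁻ t in Ioo 0 T, ∫⁻ ξ, bessel ρ ξ ^ 2 * (ENNReal.ofReal (freqA ξ) * ‖U (t, ξ)‖ₑ ^ 2) < ⊤ := by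
  have hbm := (measurable_bessel ρ).pow_const 2
  have hgm : Measurable fun p => ‖G p‖ₑ := h.measG.enorm
  have hfm := (stronglyMeasurable_fourierL2 (fun x => (u₀ x : ℂ))).enorm
  have hsq := h.enorm_sq_le hT hu₀ hu
  generalize fourierL2 (fun x => (u₀ x : ℂ)) = f at *
  have hF : Measurable fun ξ => bessel ρ ξ ^ 2 * ‖f ξ‖ₑ ^ 2 := hbm.mul (hfm.pow_const 2)
  have hAm := measurable_freqA_mul_exp hF
  have hI := (lintegral_lintegral_freqA_mul_exp_le hF T).trans_lt h0
  have hB := (lintegral_lintegral_freqA_mul_duh_sq_le hgm hbm T).trans_lt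
    (ENNReal.mul_lt_top (by norm_num) hS)
  refine lt_of_le_of_lt ?_ (ENNReal.add_lt_top.2
    ⟨ENNReal.mul_lt_top (by norm_num : (2 : ℝ≥0∞) < ⊤) hI,
      ENNReal.mul_lt_top (by norm_num : (2 : ℝ≥0∞) < ⊤) hB⟩)
  rw [← lintegral_const_mul' _ _ (by norm_num), ← lintegral_const_mul' _ _ (by norm_num)]
  refine le_trans ?_ (lintegral_add_left (hAm.lintegral_prod_right'.const_mul 2) _).le
  apply lintegral_mono_ae
  filter_upwards [hsq] with t ht
  have hAt := (hAm.comp (by fun_prop : Measurable fun ξ : ℝ => (t, ξ))).const_mul 2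
  refine le_trans ?_ (add_le_add (lintegral_const_mul' _ _ (by norm_num)).le
    (lintegral_const_mul' _ _ (by norm_num)).le)
  refine le_trans ?_ (lintegral_add_left hAt _).le
  apply lintegral_mono_ae
  filter_upwards [ht] with ξ hξ
  refine (mul_le_mul' le_rfl (mul_le_mul' le_rfl hξ)).trans (le_of_eq ?_)
  simp only [Function.comp_apply, Function.uncurry_apply_pair]
  ring

/-- The power 3/4 is subadditive, and |2πξ|^{3/2} ≤ 7^{3/2}|ξ|^{3/2} ≤ 49 a. The added 1 is needed
because a vanishes at 0. -/
theorem bessel_three_halves_le (ξ : ℝ) :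
    bessel (3 / 2) ξ ≤ 49 * (1 + ENNReal.ofReal (freqA ξ)) := by
  unfold bessel
  rw [← ENNReal.ofReal_one, ← ENNReal.ofReal_add (by norm_num) (freqA_nonneg ξ),
    show (49 : ℝ≥0∞) = ENNReal.ofReal 49 by norm_num, ← ENNReal.ofReal_mul (by norm_num)]
  apply ENNReal.ofReal_le_ofReal
  have hpi : 2 * Real.pi ≤ 7 := by linarith [Real.pi_lt_d2]
  have h1 : (1 + (2 * Real.pi * ξ) ^ 2) ^ (3 / 2 / 2 : ℝ) ≤
      1 ^ (3 / 2 / 2 : ℝ) + ((2 * Real.pi * ξ) ^ 2) ^ (3 / 2 / 2 : ℝ) :=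
    Real.rpow_add_le_add_rpow zero_le_one (sq_nonneg _) (by norm_num) (by norm_num)
  have h2 : ((2 * Real.pi * ξ) ^ 2) ^ (3 / 2 / 2 : ℝ) ≤ 49 * |ξ| ^ (3 / 2 : ℝ) := by
    calc ((2 * Real.pi * ξ) ^ 2) ^ (3 / 2 / 2 : ℝ) = (|2 * Real.pi * ξ| ^ 2) ^ (3 / 2 / 2 : ℝ) := by
          rw [sq_abs]
      _ = |2 * Real.pi * ξ| ^ (3 / 2 : ℝ) := by
          rw [← Real.rpow_natCast, ← Real.rpow_mul (abs_nonneg _)]; norm_num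
      _ ≤ (7 * |ξ|) ^ (3 / 2 : ℝ) := by
          apply Real.rpow_le_rpow (abs_nonneg _) _ (by norm_num)
          rw [abs_mul, abs_of_pos (by positivity : 0 < 2 * Real.pi)]
          gcongr
      _ = 7 ^ (3 / 2 : ℝ) * |ξ| ^ (3 / 2 : ℝ) := Real.mul_rpow (by norm_num) (abs_nonneg _)
      _ ≤ _ := by
          gcongr
          calc (7 : ℝ) ^ (3 / 2 : ℝ) ≤ 7 ^ (2 : ℝ) :=
                Real.rpow_le_rpow_of_exponent_le (by norm_num) (by norm_num)
            _ = 49 := by norm_num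
  rw [Real.one_rpow] at h1
  linarith [rpow_le_freqA ξ]

/-- Order ρ + 3/8 is the midpoint of ρ and ρ + 3/4, and the weight of the latter is that of H^ρ
times at most 1 + a, up to a constant. -/
theorem besselEnergy_sq_le {X : ℝ × ℝ → ℂ} (hX : StronglyMeasurable X) (ρ t : ℝ) :
    besselEnergy (ρ + 3 / 8) X t ^ 2 ≤ besselEnergy ρ X t * (49 * (besselEnergy ρ X t +
      ∫⁻ ξ, bessel ρ ξ ^ 2 * (ENNReal.ofReal (freqA ξ) * ‖X (t, ξ)‖ₑ ^ 2))) := by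
  have hm := measurable_enorm_section hX t
  have h := sq_lintegral_mul_le (μ := volume) (f := fun ξ => bessel ρ ξ * ‖X (t, ξ)‖ₑ)
    (g := fun ξ => bessel (ρ + 3 / 4) ξ * ‖X (t, ξ)‖ₑ)
    ((measurable_bessel _).mul hm).aemeasurable ((measurable_bessel _).mul hm).aemeasurable
  have e : besselEnergy (ρ + 3 / 8) X t =
      ∫⁻ ξ, bessel ρ ξ * ‖X (t, ξ)‖ₑ * (bessel (ρ + 3 / 4) ξ * ‖X (t, ξ)‖ₑ) := by
    unfold besselEnergy
    congr 1; ext ξ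
    rw [mul_pow, bessel_sq, mul_mul_mul_comm, bessel_mul, sq]
    congr 2; ring
  rw [e]
  refine h.trans (mul_le_mul' le_rfl ?_)
  unfold besselEnergy
  rw [← lintegral_add_left (f := fun ξ => (bessel ρ ξ * ‖X (t, ξ)‖ₑ) ^ 2)
      (((measurable_bessel _).mul hm).pow_const 2),
    ← lintegral_const_mul' _ _ (by norm_num)]
  apply lintegral_mono
  intro ξ
  calc (bessel (ρ + 3 / 4) ξ * ‖X (t, ξ)‖ₑ) ^ 2
      = bessel ρ ξ ^ 2 * bessel (3 / 2) ξ * ‖X (t, ξ)‖ₑ ^ 2 := by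
        rw [mul_pow, bessel_sq, bessel_sq, bessel_mul]
        congr 2; ring
    _ ≤ bessel ρ ξ ^ 2 * (49 * (1 + ENNReal.ofReal (freqA ξ))) * ‖X (t, ξ)‖ₑ ^ 2 := by
        gcongr
        exact bessel_three_halves_le ξ
    _ = _ := by ring

/-- Smoothing of the Duhamel formula: a gain of `1/8` derivative in `L⁴ H^r`. -/
theorem HasSpectrum.lintegral_besselEnergy_sq_lt_top (h : HasSpectrum T u U G C) (hT : 0 < T)
    (hu₀ : MemLp (fun x => (u₀ x : ℂ)) 2 volume) (hu : IsWeakSolution (Ico 0 T) u₀ u)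
    (hr : 1 / 2 < r) (hP : ∫⁻ t in Ioo 0 T, besselEnergy r U t ^ 2 < ⊤)
    (h0 : ∫⁻ ξ, bessel (r - 1 / 4) ξ ^ 2 * ‖fourierL2 (fun x => (u₀ x : ℂ)) ξ‖ₑ ^ 2 < ⊤) :
    ∫⁻ t in Ioo 0 T, besselEnergy (r + 1 / 8) U t ^ 2 < ⊤ := by
  have hS := h.sourceNorm_lt_top hr (ρ := r - 1 / 4) (by linarith) hP
  obtain ⟨M, hM, hb⟩ := h.exists_besselEnergy_le hT hu₀ hu hS h0
  have hI := h.lintegral_freqA_bessel_lt_top hT hu₀ hu hS h0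
  have e : r + 1 / 8 = (r - 1 / 4) + 3 / 8 := by ring
  rw [e]
  calc _ ≤ ∫⁻ t in Ioo 0 T, M * (49 * (M + ∫⁻ ξ, bessel (r - 1 / 4) ξ ^ 2 *
        (ENNReal.ofReal (freqA ξ) * ‖U (t, ξ)‖ₑ ^ 2))) := by
        apply lintegral_mono_ae
        filter_upwards [hb] with t ht
        refine (besselEnergy_sq_le h.measU _ t).trans ?_
        gcongr
    _ = M * (49 * ((∫⁻ _ in Ioo 0 T, M) + ∫⁻ t in Ioo 0 T, ∫⁻ ξ, bessel (r - 1 / 4) ξ ^ 2 *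
        (ENNReal.ofReal (freqA ξ) * ‖U (t, ξ)‖ₑ ^ 2))) := by
        rw [lintegral_const_mul' _ _ hM.ne, lintegral_const_mul' _ _ (by norm_num),
          lintegral_add_left measurable_const]
    _ < ⊤ := by
        refine ENNReal.mul_lt_top hM (ENNReal.mul_lt_top (by norm_num)
          (ENNReal.add_lt_top.2 ⟨?_, hI⟩))
        rw [setLIntegral_const, Real.volume_Ioo]
        exact ENNReal.mul_lt_top hM ENNReal.ofReal_lt_top

/-- The gain of 1/8 is iterated with the order capped at ρ + 1/4. A step from order q uses the datum
at order q - 1/4, so the cap never asks for more than H^ρ; once it is reached, the source is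
admissible at order ρ. -/
theorem HasSpectrum.exists_besselEnergy_le_of_initial (h : HasSpectrum T u U G C) (hT : 0 < T)
    (hu₀ : MemLp (fun x => (u₀ x : ℂ)) 2 volume) (hu : IsWeakSolution (Ico 0 T) u₀ u)
    (hr : 1 / 2 < r) (hP : ∫⁻ t in Ioo 0 T, besselEnergy r U t ^ 2 < ⊤)
    (h0 : ∫⁻ ξ, bessel ρ ξ ^ 2 * ‖fourierL2 (fun x => (u₀ x : ℂ)) ξ‖ₑ ^ 2 < ⊤) :
    ∃ M : ℝ≥0∞, M < ⊤ ∧ ∀ᵐ t ∂(volume.restrict (Ioo 0 T)), besselEnergy ρ U t ≤ M := by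
  rcases le_total (ρ + 1 / 4) r with hle | hle
  · exact h.exists_besselEnergy_le hT hu₀ hu (h.sourceNorm_lt_top hr hle hP) h0
  have step : ∀ n : ℕ,
      ∫⁻ t in Ioo 0 T, besselEnergy (min (r + n / 8) (ρ + 1 / 4)) U t ^ 2 < ⊤ := by
    intro n
    induction n with
    | zero => simpa only [Nat.cast_zero, zero_div, add_zero, min_eq_left hle] using hP
    | succ n ih =>
      set q := min (r + n / 8) (ρ + 1 / 4) with hq
      have hq1 : r ≤ q := le_min (by linarith [(Nat.cast_nonneg n : (0 : ℝ) ≤ n)]) hle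
      have hq2 : q - 1 / 4 ≤ ρ := by linarith [min_le_right (r + n / 8) (ρ + 1 / 4)]
      have h1 := h.lintegral_besselEnergy_sq_lt_top hT hu₀ hu (hr.trans_le hq1) ih
        (lt_of_le_of_lt (lintegral_mono fun ξ =>
          mul_le_mul' (ENNReal.pow_le_pow_left (bessel_mono hq2 ξ)) le_rfl) h0)
      refine lt_of_le_of_lt (lintegral_mono fun t => ?_) h1
      refine ENNReal.pow_le_pow_left (besselEnergy_mono ?_ U t)
      rw [hq, min_add]
      apply min_le_min
      · push_cast; linarith
      · linarith
  obtain ⟨n, hn⟩ := exists_nat_gt ((ρ + 1 / 4 - r) * 8)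
  have h1 := step n
  rw [min_eq_right (by linarith)] at h1
  exact h.exists_besselEnergy_le hT hu₀ hu (h.sourceNorm_lt_top (by linarith) le_rfl h1) h0

theorem HasSpectrum.lintegral_besselEnergy_sq_lt_top_of_memLpTime (h : HasSpectrum T u U G C)
    (hN : MemLpTime (Ioo 0 T) 4 (normH r) u) :
    ∫⁻ t in Ioo 0 T, besselEnergy r U t ^ 2 < ⊤ := by
  have h1 : ∫⁻ t in Ioo 0 T, normH r (u t) ^ 4 < ⊤ := by
    unfold MemLpTime at hN
    rw [eLpNorm_eq_lintegral_rpow_enorm_toReal (by norm_num) (by norm_num)] at hN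
    have h3 := (ENNReal.rpow_lt_top_iff_of_pos (by norm_num)).1 hN
    simpa using h3
  refine lt_of_eq_of_lt ?_ h1
  apply lintegral_congr_ae
  filter_upwards [h.ae] with t ⟨h1, _, h3, _⟩
  rw [show (4 : ℕ) = 2 * 2 by norm_num, pow_mul]
  congr 1
  unfold normH besselEnergy
  rw [multiplierNorm_sq _ h1]
  apply lintegral_congr_ae
  filter_upwards [h3] with ξ hξ
  rw [hξ, abs_of_nonneg (by positivity)]
  rfl

theorem lintegral_bessel_lt_top_of_normHdot (hρ : 0 ≤ ρ)
    (hu₀ : MemLp (fun x => (u₀ x : ℂ)) 2 volume) (hd : normHdot ρ u₀ < ⊤) :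
    ∫⁻ ξ, bessel ρ ξ ^ 2 * ‖fourierL2 (fun x => (u₀ x : ℂ)) ξ‖ₑ ^ 2 < ⊤ := by
  have h1 : normHdot ρ u₀ ^ 2 < ⊤ := ENNReal.pow_lt_top hd
  unfold normHdot at h1
  rw [multiplierNorm_sq _ hu₀] at h1
  have h2 : ∫⁻ ξ, ‖fourierL2 (fun x => (u₀ x : ℂ)) ξ‖ₑ ^ 2 < ⊤ := by
    rw [← eLpNorm_two_sq]
    exact ENNReal.pow_lt_top (memLp_fourierL2 _).2
  have hfm := (stronglyMeasurable_fourierL2 (fun x => (u₀ x : ℂ))).enorm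
  calc _ ≤ ∫⁻ ξ, ENNReal.ofReal (2 ^ ρ) * (‖fourierL2 (fun x => (u₀ x : ℂ)) ξ‖ₑ ^ 2 +
        (ENNReal.ofReal |(|2 * Real.pi * ξ| ^ ρ)| * ‖fourierL2 (fun x => (u₀ x : ℂ)) ξ‖ₑ) ^ 2) := by
        apply lintegral_mono
        intro ξ
        simp only
        rw [mul_pow, ← one_add_mul, ← mul_assoc]
        refine mul_le_mul' ?_ le_rfl
        rw [abs_of_nonneg (by positivity), ← ENNReal.ofReal_pow (by positivity),
          ← ENNReal.ofReal_one, ← ENNReal.ofReal_add (by norm_num) (by positivity),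
          ← ENNReal.ofReal_mul (by positivity), bessel_sq, bessel]
        apply ENNReal.ofReal_le_ofReal
        rw [mul_div_cancel_left₀ _ two_ne_zero]
        set x := 2 * Real.pi * ξ
        have e : (|x| ^ ρ) ^ 2 = (x ^ 2) ^ ρ := by
          rw [← sq_abs x, ← Real.rpow_natCast, ← Real.rpow_natCast, ← Real.rpow_mul (abs_nonneg _),
            ← Real.rpow_mul (abs_nonneg _), mul_comm]
        rw [e]
        calc (1 + x ^ 2) ^ ρ ≤ (2 * max 1 (x ^ 2)) ^ ρ := by
              apply Real.rpow_le_rpow (by positivity) _ hρ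
              linarith [le_max_left 1 (x ^ 2), le_max_right 1 (x ^ 2)]
          _ = 2 ^ ρ * (max 1 (x ^ 2)) ^ ρ := Real.mul_rpow (by norm_num) (by positivity)
          _ ≤ 2 ^ ρ * (1 + (x ^ 2) ^ ρ) := by
              gcongr
              rcases max_choice 1 (x ^ 2) with h | h <;> rw [h]
              · rw [Real.one_rpow]
                have : 0 ≤ (x ^ 2) ^ ρ := by positivity
                linarith
              · linarith
    _ = ENNReal.ofReal (2 ^ ρ) * (_ + _) := by
        rw [lintegral_const_mul' _ _ ENNReal.ofReal_ne_top, lintegral_add_left (hfm.pow_const 2)]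
    _ < ⊤ := ENNReal.mul_lt_top ENNReal.ofReal_lt_top (ENNReal.add_lt_top.2 ⟨h2, h1⟩)

theorem normHdot_sq_le (hρ : 0 ≤ ρ) {f : ℝ → ℝ} (hf : MemLp (fun x => (f x : ℂ)) 2 volume) :
    normHdot ρ f ^ 2 ≤ ∫⁻ ξ, (bessel ρ ξ * ‖fourierL2 (fun x => (f x : ℂ)) ξ‖ₑ) ^ 2 := by
  unfold normHdot
  rw [multiplierNorm_sq _ hf]
  apply lintegral_mono
  intro ξ
  refine ENNReal.pow_le_pow_left (mul_le_mul' ?_ le_rfl)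
  apply ENNReal.ofReal_le_ofReal
  rw [abs_of_nonneg (by positivity)]
  set x := 2 * Real.pi * ξ
  calc |x| ^ ρ = (x ^ 2) ^ (ρ / 2) := by
        rw [← sq_abs x, ← Real.rpow_natCast, ← Real.rpow_mul (abs_nonneg _)]
        congr 1; push_cast; ring
    _ ≤ (1 + x ^ 2) ^ (ρ / 2) := by
        apply Real.rpow_le_rpow (by positivity) (by linarith) (by linarith)

/-- Homogeneous Sobolev regularity of the initial datum persists for weak solutions in `L⁴ H^r`,
`r > 1/2`. -/
theorem IsWeakSolution.exists_normHdot_le (hT : 0 < T) (hu₀ : MemLp u₀ 2 volume)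
    (hu : IsWeakSolution (Ico 0 T) u₀ u) (hr : 1 / 2 < r)
    (hN : MemLpTime (Ioo 0 T) 4 (normH r) u) (hρ : 0 ≤ ρ) (hd : normHdot ρ u₀ < ⊤) :
    ∃ M : ℝ≥0∞, M < ⊤ ∧ ∀ᵐ t ∂(volume.restrict (Ioo 0 T)), normHdot ρ (u t) ≤ M := by
  obtain ⟨U, G, C, h⟩ := hu.exists_hasSpectrum
  have hu₀' := memLp_ofReal_iff.2 hu₀
  obtain ⟨M, hM, hb⟩ := h.exists_besselEnergy_le_of_initial hT hu₀' hu hr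
    (h.lintegral_besselEnergy_sq_lt_top_of_memLpTime hN)
    (lintegral_bessel_lt_top_of_normHdot hρ hu₀' hd)
  refine ⟨M + 1, ENNReal.add_lt_top.2 ⟨hM, ENNReal.one_lt_top⟩, ?_⟩
  filter_upwards [hb, h.ae] with t ht ⟨h1, _, h3, _⟩
  have h4 : normHdot ρ (u t) ^ 2 ≤ M := by
    refine (normHdot_sq_le hρ h1).trans (le_trans (le_of_eq ?_) ht)
    apply lintegral_congr_ae
    filter_upwards [h3] with ξ hξ
    rw [hξ]
  -- A square bounded by M forces the number below M + 1, which avoids taking square roots of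
  -- extended reals.
  by_contra hlt
  rw [not_le] at hlt
  have h5 : M + 1 ≤ M := by
    calc M + 1 = (M + 1) * 1 := (mul_one _).symm
      _ ≤ (M + 1) * (M + 1) := mul_le_mul' le_rfl le_add_self
      _ = (M + 1) ^ 2 := (sq _).symm
      _ ≤ normHdot ρ (u t) ^ 2 := ENNReal.pow_le_pow_left hlt.le
      _ ≤ M := h4
  exact (ENNReal.lt_add_right hM.ne one_ne_zero).not_ge h5

end

end Whitham

namespace Whitham

open scoped NNReal
open Filter Topology

/-! ### The kernel of the linear semigroup is integrable -/

/-- The left factor is 2|sin(πhx)|, and |sin y| ≥ 2|y|/π for |y| ≤ π/2. Thus a finite difference in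
frequency controls multiplication by x where |hx| ≤ 1/2. -/
theorem four_mul_abs_le_norm_char_sub_one {h x : ℝ} (hx : |h * x| ≤ 1 / 2) :
    4 * |h * x| ≤ ‖char h x - 1‖ := by
  have e : char h x = Complex.exp (Complex.I * ((-2 * Real.pi * x * h : ℝ) : ℂ)) := by
    unfold char; rw [mul_comm]
  have e2 : -2 * Real.pi * x * h / 2 = -(Real.pi * (h * x)) := by ring
  rw [e, Complex.norm_exp_I_mul_ofReal_sub_one, e2, Real.sin_neg, mul_neg, norm_neg, norm_mul,
    Real.norm_eq_abs, Real.norm_eq_abs, abs_two]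
  have hpi := Real.pi_pos
  have h1 : |Real.pi * (h * x)| = Real.pi * |h * x| := by rw [abs_mul, abs_of_pos hpi]
  have h2 := Real.mul_abs_le_abs_sin (x := Real.pi * (h * x)) (by rw [h1]; nlinarith)
  rw [h1, ← mul_assoc, div_mul_cancel₀ _ hpi.ne'] at h2
  linarith

/-- The symbol of the linear semigroup. -/
noncomputable def heat (t ξ : ℝ) : ℝ := Real.exp (-(t * freqA ξ))

theorem heat_pos (t ξ : ℝ) : 0 < heat t ξ := Real.exp_pos _

theorem continuous_heat (t : ℝ) : Continuous (heat t) := by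
  have := continuous_freqA
  unfold heat; fun_prop

theorem abs_exp_neg_sub_le (p q : ℝ) :
    |Real.exp (-p) - Real.exp (-q)| ≤ |p - q| * (Real.exp (-p) + Real.exp (-q)) := by
  wlog h : p ≤ q generalizing p q
  · have := this q p (le_of_not_ge h)
    rwa [abs_sub_comm, abs_sub_comm p q, add_comm (Real.exp (-p))]
  have h1 : Real.exp (-q) = Real.exp (-p) * Real.exp (-(q - p)) := by
    rw [← Real.exp_add]; congr 1; ring
  have h2 := Real.one_sub_le_exp_neg (q - p)
  have h3 := Real.exp_pos (-p)
  have h4 := Real.exp_pos (-q)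
  rw [abs_of_nonneg (sub_nonneg.2 (Real.exp_le_exp.2 (by linarith))), abs_sub_comm,
    abs_of_nonneg (sub_nonneg.2 h)]
  have h5 : Real.exp (-p) - Real.exp (-q) ≤ (q - p) * Real.exp (-p) := by
    rw [h1]; nlinarith
  nlinarith [mul_nonneg (sub_nonneg.2 h) h4.le]

/-- A difference estimate takes the place of differentiation in ξ, which fails at the origin. Since
h ≤ 1, the sum 1+|ξ+h|+|ξ| is at most twice either bracket, so that each exponential carries its own
weight. -/
theorem sq_heat_sub_le {t h : ℝ} (ht : 0 ≤ t) (h0 : 0 ≤ h) (h1 : h ≤ 1) (ξ : ℝ) :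
    (heat t (ξ + h) - heat t ξ) ^ 2 ≤ 40000 * t ^ 2 * h ^ 2 *
      ((1 + |ξ + h|) * heat t (ξ + h) ^ 2 + (1 + |ξ|) * heat t ξ ^ 2) := by
  set a := heat t (ξ + h)
  set b := heat t ξ
  have ha : 0 < a := heat_pos _ _
  have hb : 0 < b := heat_pos _ _
  have k1 : |a - b| ≤ |t * freqA (ξ + h) - t * freqA ξ| * (a + b) := abs_exp_neg_sub_le _ _
  set S := 1 + |ξ + h| + |ξ| with hS
  have hS0 : 0 ≤ S := by positivity
  have k2 : |t * freqA (ξ + h) - t * freqA ξ| ≤ t * (100 * h * Real.sqrt S) := by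
    rw [← mul_sub, abs_mul, abs_of_nonneg ht]
    have := abs_freqA_sub_le (ξ + h) ξ
    rw [add_sub_cancel_left, abs_of_nonneg h0] at this
    gcongr
  have k3 : |ξ + h| ≤ |ξ| + 1 := by
    refine (abs_add_le _ _).trans ?_
    rw [abs_of_nonneg h0]; linarith
  have k4 : |ξ| ≤ |ξ + h| + 1 := by
    calc |ξ| = |(ξ + h) - h| := by ring_nf
      _ ≤ |ξ + h| + |h| := abs_sub _ _
      _ ≤ _ := by rw [abs_of_nonneg h0]; linarith
  have k5 : |a - b| ≤ t * (100 * h * Real.sqrt S) * (a + b) :=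
    k1.trans (mul_le_mul_of_nonneg_right k2 (by positivity))
  have k6 : (a - b) ^ 2 ≤ 10000 * t ^ 2 * h ^ 2 * (S * (a + b) ^ 2) := by
    rw [← sq_abs]
    refine (pow_le_pow_left₀ (abs_nonneg _) k5 2).trans (le_of_eq ?_)
    rw [mul_pow, mul_pow, mul_pow, Real.sq_sqrt hS0]
    ring
  refine k6.trans ?_
  have k7 : S * (a + b) ^ 2 ≤ 4 * ((1 + |ξ + h|) * a ^ 2 + (1 + |ξ|) * b ^ 2) := by
    have : (a + b) ^ 2 ≤ 2 * a ^ 2 + 2 * b ^ 2 := by nlinarith [sq_nonneg (a - b)]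
    calc S * (a + b) ^ 2 ≤ S * (2 * a ^ 2 + 2 * b ^ 2) := by gcongr
      _ = S * (2 * a ^ 2) + S * (2 * b ^ 2) := by ring
      _ ≤ (2 * (1 + |ξ + h|)) * (2 * a ^ 2) + (2 * (1 + |ξ|)) * (2 * b ^ 2) := by
          gcongr <;> rw [hS] <;> linarith
      _ = _ := by ring
  have k8 : 0 ≤ 10000 * t ^ 2 * h ^ 2 := by positivity
  nlinarith [mul_le_mul_of_nonneg_left k7 k8]

section

variable {t l : ℝ}

/-- The length l = t^{2/3} is the natural scale of the semigroup. With y = l|ξ|, the exponent ta is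
at least y^{3/2} ≥ y - 1, and e ≤ 3. -/
theorem heat_le (ht : 0 < t) (_hl : 0 < l) (htl : t ^ 2 = l ^ 3) (ξ : ℝ) :
    heat t ξ ≤ 3 * Real.exp (-(l * |ξ|)) := by
  have h1 : l * |ξ| - 1 ≤ t * |ξ| ^ (3 / 2 : ℝ) := by
    have hp : 0 ≤ t * |ξ| ^ (3 / 2 : ℝ) := by positivity
    rcases le_total (l * |ξ|) 1 with h | h
    · linarith
    · have : l * |ξ| ≤ t * |ξ| ^ (3 / 2 : ℝ) := by
        apply le_of_sq_le_sq _ hp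
        have e : (t * |ξ| ^ (3 / 2 : ℝ)) ^ 2 = (l * |ξ|) ^ 3 := by
          rw [mul_pow, htl, ← Real.rpow_natCast (|ξ| ^ (3 / 2 : ℝ)), ← Real.rpow_mul (abs_nonneg _),
            mul_pow, ← Real.rpow_natCast |ξ| 3]
          norm_num
        rw [e]
        exact pow_le_pow_right₀ h (by norm_num)
      linarith
  have h2 : l * |ξ| - 1 ≤ t * freqA ξ :=
    h1.trans (mul_le_mul_of_nonneg_left (rpow_le_freqA ξ) ht.le)
  calc heat t ξ ≤ Real.exp (1 + -(l * |ξ|)) := Real.exp_le_exp.2 (by linarith)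
    _ = Real.exp 1 * Real.exp (-(l * |ξ|)) := Real.exp_add _ _
    _ ≤ _ := by
        gcongr
        exact (Real.exp_one_lt_d9.trans (by norm_num)).le

theorem lintegral_exp_neg_abs_le (hl : 0 < l) :
    ∫⁻ ξ, ENNReal.ofReal (Real.exp (-(l * |ξ|))) ≤ ENNReal.ofReal (2 / l) := by
  rw [lintegral_comp_abs (F := fun x => ENNReal.ofReal (Real.exp (-(l * x))))]
  have h := lintegral_exp_right_le hl 0
  simp only [sub_zero, mul_comm _ l] at h
  refine (mul_le_mul' le_rfl h).trans (le_of_eq ?_)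
  rw [show (2 : ℝ≥0∞) = ENNReal.ofReal 2 by simp, ← ENNReal.ofReal_mul (by norm_num)]
  rfl

theorem lintegral_weight_heat_sq_le (ht : 0 < t) (hl : 0 < l) (htl : t ^ 2 = l ^ 3) :
    ∫⁻ ξ, ENNReal.ofReal ((1 + |ξ|) * heat t ξ ^ 2) ≤ ENNReal.ofReal (18 / l * (1 + 1 / l)) := by
  calc _ ≤ ∫⁻ ξ, ENNReal.ofReal (9 * (1 + 1 / l)) * ENNReal.ofReal (Real.exp (-(l * |ξ|))) := by
        apply lintegral_mono
        intro ξ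
        simp only
        rw [← ENNReal.ofReal_mul (by positivity)]
        apply ENNReal.ofReal_le_ofReal
        set E := Real.exp (-(l * |ξ|)) with hE
        have hE0 : 0 < E := Real.exp_pos _
        have h1 : heat t ξ ^ 2 ≤ 9 * E ^ 2 := by
          have := pow_le_pow_left₀ (heat_pos t ξ).le (heat_le ht hl htl ξ) 2
          rw [mul_pow] at this
          linarith
        -- One of the two exponentials in the square is spent on the weight 1 + |ξ|; the other is
        -- left for the integral.
        have h2 : 1 + l * |ξ| ≤ E⁻¹ := by
          rw [hE, ← Real.exp_neg, neg_neg, add_comm]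
          exact Real.add_one_le_exp _
        have h3 : (1 + |ξ|) ≤ (1 + 1 / l) * E⁻¹ := by
          have : 0 ≤ l * |ξ| := by positivity
          have e : |ξ| = 1 / l * (l * |ξ|) := by field_simp
          have h4 : 1 ≤ E⁻¹ := by linarith
          have h5 : 1 / l * (l * |ξ|) ≤ 1 / l * E⁻¹ := by gcongr; linarith
          linarith
        calc (1 + |ξ|) * heat t ξ ^ 2 ≤ ((1 + 1 / l) * E⁻¹) * (9 * E ^ 2) := by gcongr
          _ = 9 * (1 + 1 / l) * E := by field_simp
    _ ≤ ENNReal.ofReal (9 * (1 + 1 / l)) * ENNReal.ofReal (2 / l) := by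
        rw [lintegral_const_mul' _ _ ENNReal.ofReal_ne_top]
        gcongr
        exact lintegral_exp_neg_abs_le hl
    _ = _ := by
        rw [← ENNReal.ofReal_mul (by positivity)]
        congr 1; ring

theorem lintegral_heat_sq_le (ht : 0 < t) (hl : 0 < l) (htl : t ^ 2 = l ^ 3) :
    ∫⁻ ξ, ENNReal.ofReal (heat t ξ ^ 2) ≤ ENNReal.ofReal (18 / l) := by
  calc _ ≤ ∫⁻ ξ, ENNReal.ofReal 9 * ENNReal.ofReal (Real.exp (-(l * |ξ|))) := by
        apply lintegral_mono
        intro ξ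
        simp only
        rw [← ENNReal.ofReal_mul (by positivity)]
        apply ENNReal.ofReal_le_ofReal
        have h1 := pow_le_pow_left₀ (heat_pos t ξ).le (heat_le ht hl htl ξ) 2
        have h2 : Real.exp (-(l * |ξ|)) ≤ 1 := Real.exp_le_one_iff.2 (by
          have : 0 ≤ l * |ξ| := by positivity
          linarith)
        nlinarith [Real.exp_pos (-(l * |ξ|))]
    _ ≤ ENNReal.ofReal 9 * ENNReal.ofReal (2 / l) := by
        rw [lintegral_const_mul' _ _ ENNReal.ofReal_ne_top]
        gcongr
        exact lintegral_exp_neg_abs_le hl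
    _ = _ := by
        rw [← ENNReal.ofReal_mul (by positivity)]
        congr 1; ring

theorem integrable_heat (ht : 0 < t) : Integrable (heat t) volume := by
  have hl : 0 < t ^ (2 / 3 : ℝ) := by positivity
  have htl : t ^ 2 = (t ^ (2 / 3 : ℝ)) ^ 3 := by
    rw [← Real.rpow_natCast, ← Real.rpow_natCast, ← Real.rpow_mul ht.le]; norm_num
  refine ⟨(continuous_heat t).aestronglyMeasurable, ?_⟩
  unfold HasFiniteIntegral
  calc _ ≤ ∫⁻ ξ, ENNReal.ofReal 3 * ENNReal.ofReal (Real.exp (-(t ^ (2 / 3 : ℝ) * |ξ|))) := by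
        apply lintegral_mono
        intro ξ
        simp only
        rw [← ENNReal.ofReal_mul (by norm_num), Real.enorm_of_nonneg (heat_pos t ξ).le]
        exact ENNReal.ofReal_le_ofReal (heat_le ht hl htl ξ)
    _ < ⊤ := by
        rw [lintegral_const_mul' _ _ ENNReal.ofReal_ne_top]
        exact ENNReal.mul_lt_top ENNReal.ofReal_lt_top
          ((lintegral_exp_neg_abs_le hl).trans_lt ENNReal.ofReal_lt_top)

theorem memLp_heat (ht : 0 < t) : MemLp (fun ξ => (heat t ξ : ℂ)) 2 volume := by
  have hl : 0 < t ^ (2 / 3 : ℝ) := by positivity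
  have htl : t ^ 2 = (t ^ (2 / 3 : ℝ)) ^ 3 := by
    rw [← Real.rpow_natCast, ← Real.rpow_natCast, ← Real.rpow_mul ht.le]; norm_num
  refine ⟨(Complex.continuous_ofReal.comp (continuous_heat t)).aestronglyMeasurable, ?_⟩
  have h : eLpNorm (fun ξ => (heat t ξ : ℂ)) 2 volume ^ 2 < ⊤ := by
    rw [eLpNorm_two_sq]
    refine lt_of_eq_of_lt ?_ ((lintegral_heat_sq_le ht hl htl).trans_lt ENNReal.ofReal_lt_top)
    congr 1; ext ξ
    rw [← ofReal_norm, Complex.norm_real, Real.norm_of_nonneg (heat_pos t ξ).le,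
      ENNReal.ofReal_pow (heat_pos t ξ).le]
  by_contra htop
  rw [not_lt_top_iff.1 htop] at h
  simp at h

variable {k : ℝ → ℂ}

theorem lintegral_enorm_sq_eq_of_fourierL2 {m : ℝ → ℝ} {k : ℝ → ℂ} (hk : MemLp k 2 volume)
    (hm : fourierL2 k =ᵐ[volume] fun ξ => (m ξ : ℂ)) :
    ∫⁻ x, ‖k x‖ₑ ^ 2 = ∫⁻ ξ, ENNReal.ofReal (m ξ ^ 2) := by
  rw [← eLpNorm_two_sq, ← eLpNorm_fourierL2 hk, eLpNorm_congr_ae hm, eLpNorm_two_sq]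
  congr 1; ext ξ
  rw [← ofReal_norm, Complex.norm_real, ← ENNReal.ofReal_pow (norm_nonneg _), Real.norm_eq_abs,
    sq_abs]

/-- Plancherel for the modulated kernel minus the kernel. In space this dominates 16h²x²|k|² on the
window; in frequency it is at most 40000t²h² times twice the weighted integral. The powers of h
cancel, and 40000·2·18/16 = 90000 while t² = l³. -/
theorem setLIntegral_sq_mul_kernel_le (ht : 0 < t) (hl : 0 < l) (htl : t ^ 2 = l ^ 3)
    (hk : MemLp k 2 volume) (hkm : fourierL2 k =ᵐ[volume] fun ξ => (heat t ξ : ℂ)) {h : ℝ}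
    (h0 : 0 < h) (h1 : h ≤ 1) :
    ∫⁻ x in {x | |h * x| ≤ 1 / 2}, ENNReal.ofReal (x ^ 2) * ‖k x‖ₑ ^ 2 ≤
      ENNReal.ofReal (90000 * (l * (1 + l))) := by
  have hms : MeasurableSet {x : ℝ | |h * x| ≤ 1 / 2} :=
    measurableSet_le (by fun_prop) measurable_const
  have hch := memLp_char_mul hk h
  have hd : MemLp ((fun x => char h x * k x) - k) 2 volume := hch.sub hk
  have hdm : fourierL2 ((fun x => char h x * k x) - k) =ᵐ[volume]
      fun ξ => ((heat t (ξ + h) - heat t ξ : ℝ) : ℂ) := by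
    have hs := (measurePreserving_add_right (volume : Measure ℝ) h).quasiMeasurePreserving.ae_eq_comp hkm
    filter_upwards [fourierL2_sub hch hk, fourierL2_char_mul hk h, hs, hkm] with ξ a b c d
    simp only [Function.comp_apply] at c
    rw [a, Pi.sub_apply, b, c, d]
    push_cast; rfl
  have hJ := lintegral_weight_heat_sq_le ht hl htl
  set J := ∫⁻ ξ, ENNReal.ofReal ((1 + |ξ|) * heat t ξ ^ 2) with hJdef
  have hF : Measurable fun ξ => ENNReal.ofReal ((1 + |ξ|) * heat t ξ ^ 2) := by
    have := (continuous_heat t).measurable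
    fun_prop
  have upper : ∫⁻ x, ‖((fun x => char h x * k x) - k) x‖ₑ ^ 2 ≤
      ENNReal.ofReal (40000 * t ^ 2 * h ^ 2) * (J + J) := by
    rw [lintegral_enorm_sq_eq_of_fourierL2 hd hdm]
    calc _ ≤ ∫⁻ ξ, ENNReal.ofReal (40000 * t ^ 2 * h ^ 2) *
          (ENNReal.ofReal ((1 + |ξ + h|) * heat t (ξ + h) ^ 2) +
            ENNReal.ofReal ((1 + |ξ|) * heat t ξ ^ 2)) := by
          apply lintegral_mono
          intro ξ
          simp only
          rw [← ENNReal.ofReal_add (by positivity) (by positivity),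
            ← ENNReal.ofReal_mul (by positivity)]
          exact ENNReal.ofReal_le_ofReal (sq_heat_sub_le ht.le h0.le h1 ξ)
      _ = _ := by
          rw [lintegral_const_mul' _ _ ENNReal.ofReal_ne_top, lintegral_add_right _ hF,
            lintegral_add_right_eq_self (fun ξ => ENNReal.ofReal ((1 + |ξ|) * heat t ξ ^ 2)) h]
  have lower : ENNReal.ofReal (16 * h ^ 2) *
      ∫⁻ x in {x | |h * x| ≤ 1 / 2}, ENNReal.ofReal (x ^ 2) * ‖k x‖ₑ ^ 2 ≤
      ∫⁻ x, ‖((fun x => char h x * k x) - k) x‖ₑ ^ 2 := by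
    rw [← lintegral_const_mul' _ _ ENNReal.ofReal_ne_top]
    refine le_trans ?_ (setLIntegral_le_lintegral {x | |h * x| ≤ 1 / 2} _)
    apply setLIntegral_mono' hms
    intro x hx
    have e : ((fun x => char h x * k x) - k) x = (char h x - 1) * k x := by
      simp only [Pi.sub_apply]; ring
    rw [e, enorm_mul, mul_pow, ← mul_assoc]
    gcongr
    rw [← ENNReal.ofReal_mul (by positivity), ← ofReal_norm, ← ENNReal.ofReal_pow (norm_nonneg _)]
    apply ENNReal.ofReal_le_ofReal
    have := pow_le_pow_left₀ (by positivity) (four_mul_abs_le_norm_char_sub_one hx) 2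
    refine le_trans (le_of_eq ?_) this
    rw [mul_pow, sq_abs]; ring
  have hc : 0 < 16 * h ^ 2 := by positivity
  have hc0 : ENNReal.ofReal (16 * h ^ 2) ≠ 0 := (ENNReal.ofReal_pos.2 hc).ne'
  refine (ENNReal.mul_le_mul_iff_right hc0 ENNReal.ofReal_ne_top).1 ?_
  refine (lower.trans upper).trans ((mul_le_mul' le_rfl (add_le_add hJ hJ)).trans ?_)
  rw [← ENNReal.ofReal_add (by positivity) (by positivity), ← ENNReal.ofReal_mul (by positivity),
    ← ENNReal.ofReal_mul (by positivity)]
  apply ENNReal.ofReal_le_ofReal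
  rw [htl]
  apply le_of_eq
  field_simp
  ring

/-- The bound on the window does not depend on h, so h = 1/(n+1) and monotone convergence exhaust
the line. -/
theorem lintegral_sq_mul_kernel_le (ht : 0 < t) (hl : 0 < l) (htl : t ^ 2 = l ^ 3)
    (hk : MemLp k 2 volume) (hkm : fourierL2 k =ᵐ[volume] fun ξ => (heat t ξ : ℂ)) :
    ∫⁻ x, ENNReal.ofReal (x ^ 2) * ‖k x‖ₑ ^ 2 ≤ ENNReal.ofReal (90000 * (l * (1 + l))) := by
  let s : ℕ → Set ℝ := fun n => {x | |1 / ((n : ℝ) + 1) * x| ≤ 1 / 2}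
  have hmono : Monotone s := by
    intro n m hnm x hx
    change |1 / ((n : ℝ) + 1) * x| ≤ 1 / 2 at hx
    change |1 / ((m : ℝ) + 1) * x| ≤ 1 / 2
    rw [abs_mul] at hx ⊢
    refine le_trans (mul_le_mul_of_nonneg_right ?_ (abs_nonneg x)) hx
    rw [abs_of_pos (by positivity), abs_of_pos (by positivity)]
    apply one_div_le_one_div_of_le (by positivity)
    have : (n : ℝ) ≤ m := by exact_mod_cast hnm
    linarith
  have hU : ⋃ n, s n = univ := by
    rw [eq_univ_iff_forall]
    intro x
    obtain ⟨n, hn⟩ := exists_nat_gt (2 * |x|)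
    refine mem_iUnion.2 ⟨n, ?_⟩
    change |1 / ((n : ℝ) + 1) * x| ≤ 1 / 2
    rw [abs_mul, abs_of_pos (by positivity), one_div, inv_mul_le_iff₀ (by positivity)]
    linarith
  rw [← setLIntegral_univ, ← hU, setLIntegral_iUnion_of_directed _ (directed_of_isDirected_le hmono)]
  apply iSup_le
  intro n
  apply setLIntegral_sq_mul_kernel_le ht hl htl hk hkm (by positivity)
  rw [div_le_one (by positivity)]
  linarith [(Nat.cast_nonneg n : (0 : ℝ) ≤ n)]

theorem lintegral_inv_sq_add_sq_le (hl : 0 < l) :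
    ∫⁻ x, ENNReal.ofReal ((l ^ 2 + x ^ 2)⁻¹) ≤ ENNReal.ofReal (4 / l) := by
  have h1 : Integrable (fun x : ℝ => (1 + (x / l) ^ 2)⁻¹) := integrable_inv_one_add_sq.comp_div hl.ne'
  have e : ∀ x : ℝ, (l ^ 2 + x ^ 2)⁻¹ = (l ^ 2)⁻¹ * (1 + (x / l) ^ 2)⁻¹ := by
    intro x
    rw [← mul_inv]
    congr 1
    field_simp
  simp only [e]
  rw [← ofReal_integral_eq_lintegral_ofReal (h1.const_mul _)
    (Eventually.of_forall fun x => by positivity), integral_const_mul,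
    Measure.integral_comp_div (fun x : ℝ => (1 + x ^ 2)⁻¹), integral_univ_inv_one_add_sq,
    abs_of_pos hl, smul_eq_mul]
  apply ENNReal.ofReal_le_ofReal
  have : (l ^ 2)⁻¹ * (l * Real.pi) = Real.pi / l := by field_simp
  rw [this]
  gcongr
  exact Real.pi_le_four

/-- The kernel of the linear semigroup is bounded in `L¹`, locally uniformly in time. -/
theorem sq_lintegral_kernel_le (ht : 0 < t) (hl : 0 < l) (htl : t ^ 2 = l ^ 3)
    (hk : MemLp k 2 volume) (hkm : fourierL2 k =ᵐ[volume] fun ξ => (heat t ξ : ℂ)) :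
    (∫⁻ x, ‖k x‖ₑ) ^ 2 ≤ ENNReal.ofReal (400000 * (1 + l)) := by
  have hkn := hk.1.enorm
  have hpos : ∀ x : ℝ, 0 < l ^ 2 + x ^ 2 := fun x => by positivity
  -- The Carlson–Beurling argument: Cauchy–Schwarz with weight l² + x², whose inverse has integral
  -- π/l. The second factor is estimated by Plancherel and the x² moment, and the negative powers of
  -- l cancel.
  have h := sq_lintegral_mul_le (μ := volume)
    (f := fun x : ℝ => ENNReal.ofReal (Real.sqrt (l ^ 2 + x ^ 2)⁻¹))
    (g := fun x => ENNReal.ofReal (Real.sqrt (l ^ 2 + x ^ 2)) * ‖k x‖ₑ) (by fun_prop) (by fun_prop)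
  have e1 : ∀ x, ENNReal.ofReal (Real.sqrt (l ^ 2 + x ^ 2)⁻¹) *
      (ENNReal.ofReal (Real.sqrt (l ^ 2 + x ^ 2)) * ‖k x‖ₑ) = ‖k x‖ₑ := by
    intro x
    rw [← mul_assoc, ← ENNReal.ofReal_mul (Real.sqrt_nonneg _), ← Real.sqrt_mul
      (inv_nonneg.2 (hpos x).le), inv_mul_cancel₀ (hpos x).ne']
    simp
  have e2 : ∀ x : ℝ, ENNReal.ofReal (Real.sqrt (l ^ 2 + x ^ 2)⁻¹) ^ 2 =
      ENNReal.ofReal ((l ^ 2 + x ^ 2)⁻¹) := by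
    intro x
    rw [← ENNReal.ofReal_pow (Real.sqrt_nonneg _), Real.sq_sqrt (inv_nonneg.2 (hpos x).le)]
  have e3 : ∀ x, (ENNReal.ofReal (Real.sqrt (l ^ 2 + x ^ 2)) * ‖k x‖ₑ) ^ 2 =
      ENNReal.ofReal (l ^ 2) * ‖k x‖ₑ ^ 2 + ENNReal.ofReal (x ^ 2) * ‖k x‖ₑ ^ 2 := by
    intro x
    rw [mul_pow, ← ENNReal.ofReal_pow (Real.sqrt_nonneg _), Real.sq_sqrt (hpos x).le,
      ENNReal.ofReal_add (by positivity) (by positivity), add_mul]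
  simp only [e1, e2, e3] at h
  rw [lintegral_add_left' ((hkn.pow_const 2).const_mul _),
    lintegral_const_mul' _ _ ENNReal.ofReal_ne_top,
    lintegral_enorm_sq_eq_of_fourierL2 hk hkm] at h
  refine h.trans ((mul_le_mul' (lintegral_inv_sq_add_sq_le hl) (add_le_add
    (mul_le_mul' le_rfl (lintegral_heat_sq_le ht hl htl))
    (lintegral_sq_mul_kernel_le ht hl htl hk hkm))).trans ?_)
  rw [← ENNReal.ofReal_mul (by positivity), ← ENNReal.ofReal_add (by positivity) (by positivity),
    ← ENNReal.ofReal_mul (by positivity)]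
  apply ENNReal.ofReal_le_ofReal
  have : 4 / l * (l ^ 2 * (18 / l) + 90000 * (l * (1 + l))) = 72 + 360000 * (1 + l) := by
    field_simp
    ring
  rw [this]
  linarith

end

end Whitham

namespace Whitham

open scoped NNReal ComplexConjugate
open Filter Topology

/-! ### Boundedness of weak solutions -/

variable {T : ℝ} {u : ℝ → ℝ → ℝ} {u₀ : ℝ → ℝ} {U G : ℝ × ℝ → ℂ} {C : ℝ≥0} {r : ℝ}

/-- The linear semigroup is bounded on `L^∞`, locally uniformly in time. -/
theorem enorm_integral_heat_mul_le {t : ℝ} (ht : 0 < t)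
    (hu₀ : MemLp (fun x => (u₀ x : ℂ)) 2 volume) (x : ℝ) :
    ‖∫ ξ, char (-x) ξ * (heat t ξ * fourierL2 (fun x => (u₀ x : ℂ)) ξ)‖ₑ ≤
      ENNReal.ofReal (1000 * (1 + t ^ (2 / 3 : ℝ))) * eLpNorm u₀ ⊤ volume := by
  set l := t ^ (2 / 3 : ℝ) with hldef
  have hl : 0 < l := by positivity
  have htl : t ^ 2 = l ^ 3 := by
    rw [hldef, ← Real.rpow_natCast, ← Real.rpow_natCast, ← Real.rpow_mul ht.le]; norm_num
  have hm := memLp_heat ht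
  have hm1 : MemLp (fun ξ => (heat t ξ : ℂ)) 1 volume :=
    memLp_one_iff_integrable.2 (integrable_heat ht).ofReal
  obtain ⟨hk, hkm⟩ := memLp_fourierInv hm (memLp_one_iff_integrable.1 hm1)
  obtain ⟨hkx, hkxm⟩ := memLp_fourierInv (memLp_char_mul hm x)
    (memLp_one_iff_integrable.1 (memLp_char_mul hm1 x))
  -- Modulating the symbol translates the kernel, so one L¹ bound serves every x.
  have htr : ∀ y, 𝓕⁻ (fun ξ => char x ξ * (heat t ξ : ℂ)) y =
      𝓕⁻ (fun ξ => (heat t ξ : ℂ)) (y - x) := by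
    intro y
    rw [fourierInv_eq_integral_char, fourierInv_eq_integral_char, neg_sub, sub_eq_neg_add]
    simp only [char_add, mul_assoc]
  have hK : ∫⁻ y, ‖𝓕⁻ (fun ξ => (heat t ξ : ℂ)) y‖ₑ ≤ ENNReal.ofReal (1000 * (1 + l)) := by
    have h := sq_lintegral_kernel_le ht hl htl hk hkm
    rw [← ENNReal.pow_le_pow_left_iff two_ne_zero]
    refine h.trans ?_
    rw [← ENNReal.ofReal_pow (by positivity)]
    apply ENNReal.ofReal_le_ofReal
    nlinarith
  have hP := integral_conj_mul_fourierL2 hkx hu₀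
  have e : ∫ ξ, char (-x) ξ * (heat t ξ * fourierL2 (fun x => (u₀ x : ℂ)) ξ) =
      ∫ y, conj (𝓕⁻ (fun ξ => char x ξ * (heat t ξ : ℂ)) y) * (u₀ y : ℂ) := by
    rw [← hP]
    apply integral_congr_ae
    filter_upwards [hkxm] with ξ hξ
    rw [hξ, map_mul, conj_char, Complex.conj_ofReal, mul_assoc]
  rw [e]
  refine (enorm_integral_le_lintegral_enorm _).trans ?_
  calc _ ≤ ∫⁻ y, ‖𝓕⁻ (fun ξ => (heat t ξ : ℂ)) (y - x)‖ₑ * eLpNorm u₀ ⊤ volume := by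
        apply lintegral_mono_ae
        rw [eLpNorm_exponent_top]
        filter_upwards [enorm_ae_le_eLpNormEssSup u₀ volume] with y hy
        rw [enorm_mul, htr]
        refine mul_le_mul' (le_of_eq ?_) (le_trans (le_of_eq ?_) hy)
        · rw [← ofReal_norm, ← ofReal_norm, RCLike.norm_conj]
        · rw [← ofReal_norm, ← ofReal_norm, Complex.norm_real]
    _ = (∫⁻ y, ‖𝓕⁻ (fun ξ => (heat t ξ : ℂ)) y‖ₑ) * eLpNorm u₀ ⊤ volume := by
        have hkn := (hk.1.comp_measurePreserving
          (measurePreserving_sub_right volume x)).enorm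
        refine (lintegral_mul_const'' _ hkn).trans ?_
        simp only [Function.comp_apply]
        rw [lintegral_sub_right_eq_self (fun y => ‖𝓕⁻ (fun ξ => (heat t ξ : ℂ)) y‖ₑ) x]
    _ ≤ _ := mul_le_mul' hK le_rfl

/-- The Fourier form of the Sobolev embedding: Cauchy–Schwarz against a weight of order -ρ, which is
square integrable when ρ > 1/2. -/
theorem sq_lintegral_duh_le {g : ℝ × ℝ → ℝ≥0∞} (hg : Measurable g) (ρ : ℝ) {t : ℝ} (ht : t < T) :
    (∫⁻ ξ, duh g t ξ) ^ 2 ≤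
      (∫⁻ ξ, bessel (-(2 * ρ)) ξ) * (10 * sourceNorm (fun ξ => bessel ρ ξ ^ 2) g T) := by
  have hd : Measurable fun ξ => duh g t ξ :=
    (measurable_duh hg).comp (by fun_prop : Measurable fun ξ : ℝ => (t, ξ))
  have h := sq_lintegral_mul_le (μ := volume) (f := bessel (-ρ))
    (g := fun ξ => bessel ρ ξ * duh g t ξ) (measurable_bessel _).aemeasurable
    ((measurable_bessel _).mul hd).aemeasurable
  have e : ∀ ξ, bessel (-ρ) ξ * (bessel ρ ξ * duh g t ξ) = duh g t ξ := by
    intro ξ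
    rw [← mul_assoc, bessel_mul, neg_add_cancel]
    simp [bessel]
  simp only [e, bessel_sq, mul_neg, mul_pow] at h
  refine h.trans (mul_le_mul' le_rfl ?_)
  simp only [← bessel_sq ρ]
  exact lintegral_mul_duh_sq_le hg ((measurable_bessel ρ).pow_const 2) ht

/-- Both parts of Duhamel's formula are integrable in ξ at positive time, so u(t) is recovered
pointwise a.e. by the inversion integral. The linear part is then bounded through the kernel and the
Duhamel part by its L¹ norm in frequency. -/
theorem HasSpectrum.eLpNorm_top_le (h : HasSpectrum T u U G C) (hT : 0 < T)
    (hu₀ : MemLp (fun x => (u₀ x : ℂ)) 2 volume) (hu : IsWeakSolution (Ico 0 T) u₀ u)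
    {K : ℝ≥0∞} (hK : K < ⊤) (hD : ∀ t < T, ∫⁻ ξ, duh (fun p => ‖G p‖ₑ) t ξ ≤ K) :
    ∀ᵐ t ∂(volume.restrict (Ioo 0 T)), eLpNorm (u t) ⊤ volume ≤
      ENNReal.ofReal (1000 * (1 + T ^ (2 / 3 : ℝ))) * eLpNorm u₀ ⊤ volume + K := by
  filter_upwards [h.duhamel hT hu₀ hu, h.ae, ae_restrict_mem measurableSet_Ioo]
    with t hdu ⟨u1, _, u3, _⟩ htT
  set f := fourierL2 (fun x => (u₀ x : ℂ)) with hf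
  have hfm : MemLp f 2 volume := memLp_fourierL2 _
  let L : ℝ → ℂ := fun ξ => heat t ξ * f ξ
  let D : ℝ → ℂ := fun ξ => U (t, ξ) - L ξ
  have hL : Integrable L volume := (memLp_heat htT.1).integrable_mul hfm
  have hUm : StronglyMeasurable fun ξ => U (t, ξ) :=
    h.measU.comp_measurable (by fun_prop : Measurable fun ξ : ℝ => (t, ξ))
  have hDle : ∫⁻ ξ, ‖D ξ‖ₑ ≤ K := by
    refine le_trans (lintegral_mono_ae ?_) (hD t htT.2)
    filter_upwards [hdu] with ξ hξ
    have : D ξ = ∫ s in (0)..t, (Real.exp (-((t - s) * freqA ξ)) : ℂ) *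
        (Real.pi * Complex.I * ξ * G (s, ξ)) := by
      simp only [D, L, hξ, heat]
      ring
    rw [this]
    exact enorm_integral_duhamel_le G htT.1.le ξ
  have hDi : Integrable D volume := ⟨hUm.aestronglyMeasurable.sub hL.1, hDle.trans_lt hK⟩
  have hUi : Integrable (fun ξ => U (t, ξ)) volume := by
    refine (hL.add hDi).congr (Eventually.of_forall fun ξ => ?_)
    simp [D]
  have hinv := ae_eq_fourierInv u1 hUi u3.symm
  rw [eLpNorm_exponent_top]
  apply eLpNormEssSup_le_of_ae_enorm_bound
  filter_upwards [hinv] with x hx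
  have hLx : Integrable (fun ξ => char (-x) ξ * L ξ) volume :=
    memLp_one_iff_integrable.1 (memLp_char_mul (memLp_one_iff_integrable.2 hL) _)
  have hDx : Integrable (fun ξ => char (-x) ξ * D ξ) volume :=
    memLp_one_iff_integrable.1 (memLp_char_mul (memLp_one_iff_integrable.2 hDi) _)
  have e : (u t x : ℂ) = (∫ ξ, char (-x) ξ * L ξ) + ∫ ξ, char (-x) ξ * D ξ := by
    rw [hx, fourierInv_eq_integral_char, ← integral_add hLx hDx]
    congr 1; ext ξ
    simp only [D]; ring
  calc ‖u t x‖ₑ = ‖(u t x : ℂ)‖ₑ := by rw [← ofReal_norm, ← ofReal_norm, Complex.norm_real]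
    _ ≤ ‖∫ ξ, char (-x) ξ * L ξ‖ₑ + ‖∫ ξ, char (-x) ξ * D ξ‖ₑ := by rw [e]; exact enorm_add_le _ _
    _ ≤ ENNReal.ofReal (1000 * (1 + T ^ (2 / 3 : ℝ))) * eLpNorm u₀ ⊤ volume + K := by
        apply add_le_add
        · refine (enorm_integral_heat_mul_le htT.1 hu₀ x).trans (mul_le_mul' ?_ le_rfl)
          apply ENNReal.ofReal_le_ofReal
          have := Real.rpow_le_rpow htT.1.le htT.2.le (by norm_num : (0 : ℝ) ≤ 2 / 3)
          linarith
        · refine (enorm_integral_le_lintegral_enorm _).trans (le_trans (le_of_eq ?_) hDle)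
          simp

/-- Weak solutions in `L⁴ H^r`, `r > 3/4`, with bounded initial datum are bounded. -/
theorem IsWeakSolution.exists_eLpNorm_top_le (hT : 0 < T) (hu₀ : MemLp u₀ 2 volume)
    (hu₀_bdd : MemLp u₀ ⊤ volume) (hu : IsWeakSolution (Ico 0 T) u₀ u) (hr : 3 / 4 < r)
    (hN : MemLpTime (Ioo 0 T) 4 (normH r) u) :
    ∃ M : ℝ≥0∞, M < ⊤ ∧ ∀ᵐ t ∂(volume.restrict (Ioo 0 T)), eLpNorm (u t) ⊤ volume ≤ M := by
  obtain ⟨U, G, C, h⟩ := hu.exists_hasSpectrum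
  have hS := h.sourceNorm_lt_top (ρ := r - 1 / 4) (by linarith) (by linarith)
    (h.lintegral_besselEnergy_sq_lt_top_of_memLpTime hN)
  have hB : (∫⁻ ξ, bessel (-(2 * (r - 1 / 4))) ξ) *
      (10 * sourceNorm (fun ξ => bessel (r - 1 / 4) ξ ^ 2) (fun p => ‖G p‖ₑ) T) < ⊤ :=
    ENNReal.mul_lt_top (lintegral_bessel_lt_top (by linarith))
      (ENNReal.mul_lt_top (by norm_num) hS)
  set B := (∫⁻ ξ, bessel (-(2 * (r - 1 / 4))) ξ) *
      (10 * sourceNorm (fun ξ => bessel (r - 1 / 4) ξ ^ 2) (fun p => ‖G p‖ₑ) T)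
  -- The square of the frequency integral is at most B, and B ≤ (B+1)² makes B + 1 a bound for the
  -- integral itself.
  have hB1 : B + 1 < ⊤ := ENNReal.add_lt_top.2 ⟨hB, ENNReal.one_lt_top⟩
  refine ⟨_, ENNReal.add_lt_top.2 ⟨ENNReal.mul_lt_top ENNReal.ofReal_lt_top hu₀_bdd.2, hB1⟩,
    h.eLpNorm_top_le hT (memLp_ofReal_iff.2 hu₀) hu hB1 fun t ht => ?_⟩
  rw [← ENNReal.pow_le_pow_left_iff two_ne_zero]
  refine (sq_lintegral_duh_le h.measG.enorm (r - 1 / 4) ht).trans ?_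
  calc B ≤ B + 1 := le_self_add
    _ = (B + 1) * 1 := (mul_one _).symm
    _ ≤ (B + 1) * (B + 1) := mul_le_mul' le_rfl le_add_self
    _ = (B + 1) ^ 2 := (sq _).symm

end Whitham

/-! ### The proposition -/

theorem mainTheorem4 (u₀ : ℝ → ℝ) (hu₀ : MemLp u₀ 2 volume) (hu₀_bdd : MemLp u₀ ⊤ volume)
    (u : ℝ → ℝ → ℝ) (hu : Whitham.IsWeakSolution (Ici 0) u₀ u)
    (T : ℝ) (hT : 0 < T) (ε : ℝ) (hε : 0 < ε)
    (hreg : Whitham.MemLpTime (Icc 0 T) 4 (Whitham.normH (3 / 4 + ε)) u) :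
    Whitham.MemLpTime (Icc 0 T) ⊤ (fun f => eLpNorm f ⊤ volume) u ∧
    ∀ ρ : ℝ, 0 < ρ → Whitham.normHdot ρ u₀ < ⊤ →
      Whitham.MemLpTime (Icc 0 T) ⊤ (Whitham.normHdot ρ) u ∧
      ∀ v : ℝ → ℝ → ℝ, Whitham.IsWeakSolution (Ico 0 T) u₀ v →
        ∀ᵐ t ∂(volume.restrict (Icc 0 T)), v t =ᵐ[volume] u t := by
  -- The closed interval in the statement, the half-open one of the weak formulation and the open
  -- one of the estimates differ by null sets.
  have hI : (volume : Measure ℝ).restrict (Icc 0 T) = volume.restrict (Ioo 0 T) :=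
    Measure.restrict_congr_set Ioo_ae_eq_Icc.symm
  have hu' : Whitham.IsWeakSolution (Ico 0 T) u₀ u := hu.restrict
  have hN : Whitham.MemLpTime (Ioo 0 T) 4 (Whitham.normH (3 / 4 + ε)) u := by
    unfold Whitham.MemLpTime at hreg ⊢
    rwa [hI] at hreg
  refine ⟨?_, fun ρ hρ hd => ⟨?_, fun v hv => ?_⟩⟩
  · obtain ⟨M, hM, hb⟩ := hu'.exists_eLpNorm_top_le hT hu₀ hu₀_bdd (by linarith) hN
    exact Whitham.memLpTime_top_of_ae_le hM (by rwa [hI])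
  · obtain ⟨M, hM, hb⟩ := hu'.exists_normHdot_le hT hu₀ (by linarith) hN hρ.le hd
    exact Whitham.memLpTime_top_of_ae_le hM (by rwa [hI])
  · rw [hI]
    exact hu'.unique hT hu₀ hv
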